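/- **The ZX-calculus.** A ZX-diagram is a finite open graph built from wires, green spiders and red spiders with any number of legs and a phase in $\mathbb R/2\pi\mathbb Z$, two-legged Hadamard nodes $H$, and star nodes $\star$ without legs. Only its topology matters (diagrams are taken up to isomorphism of open graphs, bends and crossings of wires being irrelevant, and inputs and outputs of a node are not distinguished). Diagrams are interpreted by matrices, where a wire is $|0\rangle\langle0|+|1\rangle\langle1|$, a green spider of phase $\alpha$ is $|0\cdots0\rangle\langle0\cdots0|+e^{i\alpha}|1\cdots1\rangle\langle1\cdots1|$, a red one is $|{+}\cdots{+}\rangle\langle{+}\cdots{+}|+e^{i\alpha}|{-}\cdots{-}\rangle\langle{-}\cdots{-}|$, $H=|{+}\rangle\langle0|+|{-}\rangle\langle1|$ and $\star=\tfrac12$; connecting wires is composition and juxtaposition is the tensor product. A *scalar diagram* has no dangling wires; it represents a complex number $[\![D]\!]$. It is a *stabilizer* scalar diagram if all its phases are multiples of $\pi/2$. Write $g_\alpha$, $r_\alpha$ for green and red spiders of phase $\alpha$, and $\langle\alpha|\beta\rangle$ for the scalar diagram consisting of a one-legged green node of phase $\alpha$ joined to a one-legged red node of phase $\beta$; so $[\![\langle0|0\rangle]\!]=\sqrt2$.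 The rewrite rules, which may be used in both directions, inside any diagram, and with the colours exchanged, are: (spider) two green spiders joined by a wire fuse and their phases add; (loop) a self-loop on a spider may be removed; (cup) a two-legged green spider of phase $0$ is a wire; (bialgebra) $\langle0|0\rangle$ beside two three-legged $g_0$ each joined to both of two three-legged $r_0$, the third legs being dangling, equals a three-legged $r_0$ joined by one wire to a three-legged $g_0$, where the dangling legs of the $g_0$'s on the left are those of the $r_0$ on the right and vice versa; (copy) $\langle0|0\rangle$ beside a one-legged $r_0$ joined to a three-legged $g_0$ equals two one-legged $r_0$; ($\pi$-copy) $g_\pi$ on one leg of a spider $r_0$ may be replaced by $g_\pi$ on each of the other legs; ($\pi$-commutation) $\langle0|0\rangle$ beside $g_\pi$ followed by $r_\alpha$ on a wire equals $\langle\pi|\alpha\rangle$ beside $r_{-\alpha}$ followed by $g_\pi$; (colour) $r_\alpha$ equals $g_\alpha$ with $H$ on each leg; (Euler) $\langle0|0\rangle\langle0|0\rangle H$ equals $\langle-\tfrac\pi2|-\tfrac\pi2\rangle$ beside $g_{\pi/2},r_{\pi/2},g_{\pi/2}$ in sequence on a wire; (star) $\star$ beside the legless $g_0$ equals the empty diagram;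 (zero) beside a legless $g_\pi$, a wire may be cut into a one-legged $g_0$ and a one-legged $r_0$; (zero scalar) a legless $g_\pi$ beside a legless $g_\alpha$ equals the legless $g_\pi$. For a subgroup $A\subseteq\mathbb R/2\pi\mathbb Z$ write $D=_AD'$ if $D$ can be transformed into $D'$ by these rules with all phases in all intermediate diagrams in $A$. **Normal forms.** For $s=0,\dots,7$ let $P_s$ be, respectively, the empty diagram, $\langle\tfrac\pi2|\tfrac\pi2\rangle$, $\langle\tfrac\pi2|\pi\rangle$, $\langle\tfrac\pi2|\pi\rangle\langle\tfrac\pi2|\tfrac\pi2\rangle$, $\langle\pi|\pi\rangle$, $\langle-\tfrac\pi2|\pi\rangle\langle-\tfrac\pi2|-\tfrac\pi2\rangle$, $\langle-\tfrac\pi2|\pi\rangle$, $\langle-\tfrac\pi2|-\tfrac\pi2\rangle$. For $r\in\mathbb Z$ let $M_r$ be: $r$ copies of $\langle0|0\rangle$ if $r>0$; the empty diagram if $r=0$; $|r|/2$ copies of $\star$ if $r<0$ is even; one copy of $\langle0|0\rangle$ and $(1-r)/2$ copies of $\star$ if $r<0$ is odd. The *normal form diagrams* are the juxtapositions $N_{s,r}$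 of $P_s$ and $M_r$. **Theorem.** Let $A\subseteq\mathbb R/2\pi\mathbb Z$ be any subgroup containing $\pi/2$ (for example $A=\langle\pi/2\rangle$, the stabilizer ZX-calculus, or $A=\mathbb R/2\pi\mathbb Z$, the full ZX-calculus). 1. For every $s$ there is a natural number $k$ with $[\![P_s]\!]=\sqrt2^{\,k}e^{is\pi/4}$, and $[\![M_r]\!]=\sqrt2^{\,r}$ for every $r$; every $N_{s,r}$ is a non-zero stabilizer scalar diagram. 2. (Unique normal form) For every stabilizer scalar diagram $D$ with $[\![D]\!]\neq0$ there is exactly one pair $(s,r)\in\{0,\dots,7\}\times\mathbb Z$ with $D=_AN_{s,r}$. 3. (Completeness) If $D,D'$ are stabilizer scalar diagrams with $[\![D]\!]=[\![D']\!]\neq0$, then $D=_AD'$. 4. (Group) The normal form diagrams form a group in which the unit is the empty diagram and the product of $N$ and $N'$ is a normal form that is $=_A$ to the juxtaposition of $N$ and $N'$; there is an isomorphism from this group to $\mathbb Z_8\times\mathbb Z$ such that a diagram with image $(s,r)$ represents the number $\sqrt2^{\,r}e^{is\pi/4}$. 5. (Invertibility) For every stabilizer scalar diagram $D$ with $[\![D]\!]\neq0$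 there is a stabilizer scalar diagram $E$ such that the juxtaposition of $E$ and $D$ is $=_A$ to the empty diagram. -/

import Mathlib

/-!
  The ZX-calculus with scalars.

  A diagram is a finite open graph: a multiset of elements (green and red spiders, Hadamard nodes,
  star nodes, plain pieces of wire), each listing the names of the wires that its legs are plugged
  into.  A wire name occurring twice is an internal connection, a name occurring once is a dangling
  end (an input or output of the diagram), and no name occurs more often.  Bends and crossings of
  wires, the positions of the elements and the distinction between inputs and outputs of a node
  leave no trace in this data, as only the topology of a diagram matters.
-/

noncomputable section

namespace ZX

/-- The basic elements of diagrams, with the names of the wires at their legs.  Phases are angles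
modulo `2π`. -/
inductive Node : Type
  | green (α : Real.Angle) (legs : Multiset ℕ) : Node
  | red (α : Real.Angle) (legs : Multiset ℕ) : Node
  | had (a b : ℕ) : Node
  | star : Node
  | wire (a b : ℕ) : Node

/-- The wire ends used by an element. -/
def Node.ends : Node → Multiset ℕ
  | green _ S => S
  | red _ S => S
  | had a b => {a, b}
  | star => 0
  | wire a b => {a, b}

/-- Renaming of wires. -/
def Node.rename (f : ℕ → ℕ) : Node → Node
  | green α S => green α (S.map f)
  | red α S => red α (S.map f)
  | had a b => had (f a) (f b)
  | star => star
  | wire a b => wire (f a) (f b)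

/-- Exchange of the colours red and green. -/
def Node.swapColour : Node → Node
  | green α S => red α S
  | red α S => green α S
  | had a b => had a b
  | star => star
  | wire a b => wire a b

/-- The phase of a spider lies in `A` (no condition on elements without phase). -/
def Node.PhaseIn (A : AddSubgroup Real.Angle) : Node → Prop
  | green α _ => α ∈ A
  | red α _ => α ∈ A
  | had _ _ => True
  | star => True
  | wire _ _ => True

/-! ### Interpretation of the elements -/

/-- Components `⟨b|0⟩`, `⟨b|1⟩`, `⟨b|+⟩`, `⟨b|-⟩` in the computational basis
(`false` is `0`, `true` is `1`). -/
def ket0 (b : Bool) : ℂ := if b then 0 else 1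
/-- See `ket0`. -/
def ket1 (b : Bool) : ℂ := if b then 1 else 0
/-- See `ket0`. -/
def ketPlus (b : Bool) : ℂ := (ket0 b + ket1 b) / (Real.sqrt 2 : ℂ)
/-- See `ket0`. -/
def ketMinus (b : Bool) : ℂ := (ket0 b - ket1 b) / (Real.sqrt 2 : ℂ)

/-- The matrix entry of an element when the wire `a` carries the basis state `x a`:
a green spider is `|0…0⟩⟨0…0| + e^{iα} |1…1⟩⟨1…1|`, a red spider is
`|+…+⟩⟨+…+| + e^{iα} |-…-⟩⟨-…-|`, a Hadamard node is `|+⟩⟨0| + |-⟩⟨1|`, a star is `1/2` and a wire is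
`|0⟩⟨0| + |1⟩⟨1|`.  (All these vectors are real, so inputs and outputs contribute alike.) -/
def Node.amp (x : ℕ → Bool) : Node → ℂ
  | green α S => (S.map fun a => ket0 (x a)).prod + (α.toCircle : ℂ) * (S.map fun a => ket1 (x a)).prod
  | red α S =>
      (S.map fun a => ketPlus (x a)).prod + (α.toCircle : ℂ) * (S.map fun a => ketMinus (x a)).prod
  | had a b => ketPlus (x b) * ket0 (x a) + ketMinus (x b) * ket1 (x a)
  | star => 1 / 2
  | wire a b => ket0 (x b) * ket0 (x a) + ket1 (x b) * ket1 (x a)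

/-! ### Diagrams -/

/-- The data of a diagram; see `Diagram.Valid` for the condition on wire names. The empty diagram
is `0`. -/
abbrev Diagram : Type := Multiset Node

namespace Diagram

/-- All wire ends in a diagram. -/
def ends (D : Diagram) : Multiset ℕ := D.bind Node.ends

/-- Renaming of wires. -/
def rename (f : ℕ → ℕ) (D : Diagram) : Diagram := D.map (Node.rename f)

/-- Exchange of the colours red and green. -/
def swapColour (D : Diagram) : Diagram := D.map Node.swapColour

/-- `D` is a diagram with all phases in `A`: every wire has at most two ends. -/
def Valid (A : AddSubgroup Real.Angle) (D : Diagram) : Prop :=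
  (∀ a, (ends D).count a ≤ 2) ∧ ∀ v ∈ D, v.PhaseIn A

/-- The internal wires of a diagram. -/
def internal (D : Diagram) : Finset ℕ := {a ∈ (ends D).toFinset | (ends D).count a = 2}

/-- The matrix entry of `D` at which exactly those dangling wires that lie in `T` carry `|1⟩`
(the others carry `|0⟩`): the elements are multiplied and the internal wires are summed over, each
internal wire carrying `|1⟩` if it lies in `S` and `|0⟩` otherwise. -/
def entry (D : Diagram) (T : Finset ℕ) : ℂ :=
  ∑ S ∈ (internal D).powerset, (D.map (Node.amp fun a => decide (a ∈ S ∪ T))).prod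

/-- A scalar diagram has no dangling wires. -/
def IsScalar (D : Diagram) : Prop := ∀ a, (ends D).count a = 0 ∨ (ends D).count a = 2

/-- The complex number (`1 × 1` matrix) represented by a scalar diagram. -/
def value (D : Diagram) : ℂ := entry D ∅

/-- Juxtaposition of two diagrams, with their wires made distinct. -/
def par (D E : Diagram) : Diagram := rename (fun a => 2 * a) D + rename (fun a => 2 * a + 1) E

/-- `n` copies of a diagram side by side. -/
def copies (D : Diagram) : ℕ → Diagram
  | 0 => 0
  | n + 1 => par D (copies D n)

/-- A green node with phase `α` and a red node with phase `β`, joined by the wire `i`. -/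
def innerprod (i : ℕ) (α β : Real.Angle) : Diagram := {Node.green α {i}, Node.red β {i}}

end Diagram

/-- The subgroup of integer multiples of `π/2` in `ℝ/2πℤ`. -/
def stabilizerPhases : AddSubgroup Real.Angle := AddSubgroup.zmultiples ((Real.pi / 2 : ℝ) : Real.Angle)

/-- A stabilizer scalar diagram: no dangling wires and all phases integer multiples of `π/2`. -/
def IsStabilizerScalar (D : Diagram) : Prop := D.IsScalar ∧ ∀ v ∈ D, v.PhaseIn stabilizerPhases

/-! ### Rewrite rules -/

open Node Diagram in
/-- The rewrite rules of the ZX-calculus.  Wire names that occur twice on one side and do not occur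
on the other are internal to the rule.  Where a spider has an arbitrary number of legs that each
acquire a node, `P` lists for each leg the outer wire and the inner wire (next to the spider). -/
inductive Rule : Diagram → Diagram → Prop
  | spider (α β : Real.Angle) (e : ℕ) (S T : Multiset ℕ) :
      Rule {green α (e ::ₘ S), green β (e ::ₘ T)} {green (α + β) (S + T)}
  | loop (α : Real.Angle) (e : ℕ) (S : Multiset ℕ) :
      Rule {green α (e ::ₘ e ::ₘ S)} {green α S}
  | cup (a b : ℕ) : Rule {green 0 {a, b}} {wire a b}
  | bialgebra (i a b c d p q r s e : ℕ) :
      Rule (innerprod i 0 0 +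
          {green 0 {a, p, q}, green 0 {b, r, s}, red 0 {p, r, c}, red 0 {q, s, d}})
        {red 0 {a, b, e}, green 0 {e, c, d}}
  | copy (i e a b : ℕ) :
      Rule (innerprod i 0 0 + {red 0 {e}, green 0 {e, a, b}}) {red 0 {a}, red 0 {b}}
  | piCopy (a e : ℕ) (P : Multiset (ℕ × ℕ)) :
      Rule {green (Real.pi : Real.Angle) {a, e}, red 0 (e ::ₘ P.map Prod.fst)}
        (red 0 (a ::ₘ P.map Prod.snd) ::ₘ
          P.map fun p => green (Real.pi : Real.Angle) {p.2, p.1})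
  | piCommutation (α : Real.Angle) (i j a b e f : ℕ) :
      Rule (innerprod i 0 0 + {green (Real.pi : Real.Angle) {a, e}, red α {e, b}})
        (innerprod j (Real.pi : Real.Angle) α +
          {red (-α) {a, f}, green (Real.pi : Real.Angle) {f, b}})
  | colour (α : Real.Angle) (P : Multiset (ℕ × ℕ)) :
      Rule {red α (P.map Prod.fst)} (green α (P.map Prod.snd) ::ₘ P.map fun p => had p.1 p.2)
  | euler (i j k a b e f : ℕ) :
      Rule (innerprod i 0 0 + innerprod j 0 0 + {had a b})
        (innerprod k ((-(Real.pi / 2) : ℝ) : Real.Angle) ((-(Real.pi / 2) : ℝ) : Real.Angle) +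
          {green ((Real.pi / 2 : ℝ) : Real.Angle) {a, e},
            red ((Real.pi / 2 : ℝ) : Real.Angle) {e, f},
            green ((Real.pi / 2 : ℝ) : Real.Angle) {f, b}})
  | starRule : Rule {star, green 0 0} 0
  | zero (a b : ℕ) :
      Rule {green (Real.pi : Real.Angle) 0, wire a b}
        {green (Real.pi : Real.Angle) 0, green 0 {a}, red 0 {b}}
  | zeroScalar (α : Real.Angle) :
      Rule {green (Real.pi : Real.Angle) 0, green α 0} {green (Real.pi : Real.Angle) 0}
  /-- Every rule also holds with the colours swapped. -/
  | swap {L R : Diagram} : Rule L R → Rule L.swapColour R.swapColour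
  /-- Wires and Hadamard nodes have no direction. -/
  | wireSymm (a b : ℕ) : Rule {wire a b} {wire b a}
  | hadSymm (a b : ℕ) : Rule {had a b} {had b a}

/-- `Eqv A D D'`: `D` can be rewritten into `D'` by finitely many applications of the rewrite rules
(in either direction, inside an arbitrary context `C`) and of topological identities, where
all phases in all the diagrams involved lie in `A`.  For `A = ⊤` this is derivability in the
ZX-calculus, for `A = stabilizerPhases` derivability in the stabilizer ZX-calculus.
Validity of both sides of `rule` ensures that wires internal to a rule do not occur in `C`. -/
inductive Eqv (A : AddSubgroup Real.Angle) : Diagram → Diagram → Prop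
  | refl {D : Diagram} : D.Valid A → Eqv A D D
  | symm {D E : Diagram} : Eqv A D E → Eqv A E D
  | trans {D E F : Diagram} : Eqv A D E → Eqv A E F → Eqv A D F
  | rule {L R : Diagram} (C : Diagram) : Rule L R → Diagram.Valid A (L + C) →
      Diagram.Valid A (R + C) → Eqv A (L + C) (R + C)
  /-- Names of internal wires do not matter. -/
  | rename {D : Diagram} (f : Equiv.Perm ℕ) : D.Valid A →
      (∀ a, D.ends.count a = 1 → f a = a) → Eqv A D (D.rename f)
  /-- A piece of wire plugged into another wire end can be shortened. -/
  | shorten {D : Diagram} (a b : ℕ) : Diagram.Valid A (Node.wire a b ::ₘ D) → a ≠ b →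
      D.ends.count b = 1 → Eqv A (Node.wire a b ::ₘ D) (D.rename (Function.update id b a))

/-! ### Normal forms of non-zero stabilizer scalars -/

/-- The angle `k · π/2`. -/
def quarter (k : ℤ) : Real.Angle := ((k * (Real.pi / 2) : ℝ) : Real.Angle)

open Diagram in
/-- The chosen diagrams for the complex phases `e^{isπ/4}` (up to a power of `√2`),
`s = 0, …, 7`. -/
def phaseDiagram : Fin 8 → Diagram :=
  ![0,
    innerprod 0 (quarter 1) (quarter 1),
    innerprod 0 (quarter 1) (quarter 2),
    par (innerprod 0 (quarter 1) (quarter 2)) (innerprod 0 (quarter 1) (quarter 1)),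
    innerprod 0 (quarter 2) (quarter 2),
    par (innerprod 0 (quarter (-1)) (quarter 2)) (innerprod 0 (quarter (-1)) (quarter (-1))),
    innerprod 0 (quarter (-1)) (quarter 2),
    innerprod 0 (quarter (-1)) (quarter (-1))]

open Diagram in
/-- The chosen diagram for the scalar `√2 ^ r`. -/
def modulusDiagram (r : ℤ) : Diagram :=
  if 0 < r then copies (innerprod 0 0 0) r.toNat
  else if r = 0 then 0
  else if Even r then copies {Node.star} (r.natAbs / 2)
  else par (innerprod 0 0 0) (copies {Node.star} ((1 - r).toNat / 2))

/-- The normal form with indices `s` and `r`. -/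
def normalForm (s : Fin 8) (r : ℤ) : Diagram := Diagram.par (phaseDiagram s) (modulusDiagram r)

/-- The normal form diagrams. -/
def NormalFormDiagram : Type := {N : Diagram // ∃ s r, N = normalForm s r}

end ZX

end

noncomputable section
namespace ZX
open Node

/-! ### Basic facts about wire ends -/

namespace Diagram

/-! One half is soundness: every rule preserves the matrix entries of the diagram, whatever the
context, so a derivable equation between scalar diagrams is an equation between numbers
(`Eqv.value_eq`). Since √2 > 1, the number √2^m e^{isπ/4} determines m and s modulo 8
(`polar_injective`), hence distinct normal forms are never derivably equal.

The other half is that each stabilizer scalar of non-zero value reduces to a normal form. Stabilizer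
scalar diagrams up to derivability form a commutative monoid `Scalar` under juxtaposition, and the
claim is that every class of non-zero value lies in one explicit group of units. The unit t = ⟨0|0⟩
is `tU`: copying gives t² = the legless green spider, which the star inverts. The π-rules and the
Euler rule determine the classes `ip a b` of ⟨aπ/2|bπ/2⟩ in terms of t and of ω = t²⟨-π/2|-π/2⟩⁻¹
(`omega`), and they force ω⁸ = 1 (`omega_pow_eight`). All ⟨aπ/2|bπ/2⟩ and all legless spiders of
non-zero value lie in the group `scalarGroup` generated by t and ω (`exists_ip`,
`exists_cl_green_empty`). So scalar factors arising in a derivation may be ignored: the relation `Rw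
scalarGroup`, written ≐, is rewriting up to this group.

Up to such factors the reduction is the elimination procedure for graph states. A diagram becomes a
family of green spiders and Hadamard nodes (`exists_pregraph`), and fusing plain wires leaves a
graph whose edges are Hadamard nodes (`isReducible_pregraph`). In such a graph a Hadamard loop only
shifts a phase by π (`Rw.had_loop`) and parallel edges cancel (`Rw.hopf`). A spider of odd phase is
removed by local complementation: it becomes a red spider, which is a complete graph on its
neighbours (`exists_complete`). If all phases are multiples of π, two adjacent spiders are removed
together by pivoting (`exists_pivot`). An isolated spider is a unit, unless its phase is π and the
value is zero. Induction on the numbers of spiders and edges (`isReducible_graph`) ends with the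
empty diagram, so the class is ω^s t^m, which is also the class of a normal form. The group
structure and the inverses are then read off in `scalarGroup`. All derivations use only multiples of
π/2 as phases, and `Eqv.mono` carries them to larger phase groups. -/

@[simp] theorem ends_zero : ends 0 = 0 := rfl
@[simp] theorem ends_cons (v : Node) (D : Diagram) : ends (v ::ₘ D) = v.ends + ends D := by
  simp [ends]
@[simp] theorem ends_add (D E : Diagram) : ends (D + E) = ends D + ends E := by simp [ends]
@[simp] theorem ends_singleton (v : Node) : ends {v} = v.ends := by simp [ends]

theorem ends_rename (f : ℕ → ℕ) (D : Diagram) : ends (rename f D) = (ends D).map f := by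
  induction D using Multiset.induction with
  | empty => rfl
  | cons v D ih =>
    have : (v.rename f).ends = v.ends.map f := by cases v <;> simp [Node.rename, Node.ends]
    simp only [rename, Multiset.map_cons, ends_cons, Multiset.map_add] at *
    rw [ih, this]

@[simp] theorem ends_swapColour (D : Diagram) : ends (swapColour D) = ends D := by
  induction D using Multiset.induction with
  | empty => rfl
  | cons v D ih =>
    have : v.swapColour.ends = v.ends := by cases v <;> rfl
    simp only [swapColour, Multiset.map_cons, ends_cons] at *
    rw [ih, this]

@[simp] theorem rename_zero (f : ℕ → ℕ) : rename f 0 = 0 := rfl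
@[simp] theorem rename_cons (f : ℕ → ℕ) (v : Node) (D : Diagram) :
    rename f (v ::ₘ D) = v.rename f ::ₘ rename f D := by simp [rename]
@[simp] theorem rename_add (f : ℕ → ℕ) (D E : Diagram) :
    rename f (D + E) = rename f D + rename f E := by simp [rename]

theorem rename_rename (f g : ℕ → ℕ) (D : Diagram) :
    rename f (rename g D) = rename (f ∘ g) D := by
  simp only [rename, Multiset.map_map]
  refine Multiset.map_congr rfl fun v _ => ?_
  cases v <;> simp [Node.rename]

theorem rename_congr {f g : ℕ → ℕ} {D : Diagram} (h : ∀ a ∈ ends D, f a = g a) :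
    rename f D = rename g D := by
  refine Multiset.map_congr rfl fun v hv => ?_
  have h' : ∀ a ∈ v.ends, f a = g a := fun a ha => h a (Multiset.mem_bind.2 ⟨v, hv, ha⟩)
  cases v with
  | green α S => exact congrArg _ (Multiset.map_congr rfl h')
  | red α S => exact congrArg _ (Multiset.map_congr rfl h')
  | had a b =>
    simp only [Node.rename]; rw [h' a (by simp [Node.ends]), h' b (by simp [Node.ends])]
  | star => rfl
  | wire a b =>
    simp only [Node.rename]; rw [h' a (by simp [Node.ends]), h' b (by simp [Node.ends])]

theorem rename_id (D : Diagram) : rename id D = D := by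
  have : Node.rename id = id := by funext v; cases v <;> simp [Node.rename]
  simp [rename, this]

@[simp] theorem swapColour_zero : swapColour 0 = 0 := rfl
@[simp] theorem swapColour_cons (v : Node) (D : Diagram) :
    swapColour (v ::ₘ D) = v.swapColour ::ₘ swapColour D := by simp [swapColour]
@[simp] theorem swapColour_insert (v : Node) (D : Diagram) :
    swapColour (insert v D : Multiset Node) = v.swapColour ::ₘ swapColour D := by
  simp [Multiset.insert_eq_cons]
@[simp] theorem swapColour_singleton (v : Node) : swapColour {v} = {v.swapColour} := by
  simp [swapColour]
@[simp] theorem swapColour_add (D E : Diagram) :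
    swapColour (D + E) = swapColour D + swapColour E := by simp [swapColour]
@[simp] theorem swapColour_swapColour (D : Diagram) : swapColour (swapColour D) = D := by
  have : ∀ v : Node, v.swapColour.swapColour = v := by intro v; cases v <;> rfl
  simp [swapColour, this]

/-- The product of the amplitudes of the elements. -/
def amp (D : Diagram) (x : ℕ → Bool) : ℂ := (D.map (Node.amp x)).prod

@[simp] theorem amp_zero (x : ℕ → Bool) : amp 0 x = 1 := by simp [amp]
@[simp] theorem amp_cons (v : Node) (D : Diagram) (x : ℕ → Bool) :
    amp (v ::ₘ D) x = v.amp x * amp D x := by simp [amp]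
@[simp] theorem amp_add (D E : Diagram) (x : ℕ → Bool) : amp (D + E) x = amp D x * amp E x := by
  simp [amp]
@[simp] theorem amp_singleton (v : Node) (x : ℕ → Bool) : amp {v} x = v.amp x := by simp [amp]

end Diagram

theorem Node.amp_congr {v : Node} {x y : ℕ → Bool} (h : ∀ a ∈ v.ends, x a = y a) :
    v.amp x = v.amp y := by
  have key : ∀ (u : Bool → ℂ) (S : Multiset ℕ), (∀ a ∈ S, x a = y a) →
      S.map (fun a => u (x a)) = S.map (fun a => u (y a)) := fun u S hS =>
    Multiset.map_congr rfl fun a ha => by rw [hS a ha]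
  cases v with
  | green α S => simp only [Node.amp]; rw [key _ S h, key _ S h]
  | red α S => simp only [Node.amp]; rw [key _ S h, key _ S h]
  | had a b =>
    simp only [Node.amp]; rw [h a (by simp [Node.ends]), h b (by simp [Node.ends])]
  | star => rfl
  | wire a b =>
    simp only [Node.amp]; rw [h a (by simp [Node.ends]), h b (by simp [Node.ends])]

theorem Diagram.amp_congr {D : Diagram} {x y : ℕ → Bool} (h : ∀ a ∈ D.ends, x a = y a) :
    D.amp x = D.amp y := by
  unfold Diagram.amp
  rw [Multiset.map_congr rfl fun v hv =>
    Node.amp_congr fun a ha => h a (Multiset.mem_bind.2 ⟨v, hv, ha⟩)]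

theorem Diagram.amp_rename (f : ℕ → ℕ) (D : Diagram) (x : ℕ → Bool) :
    (D.rename f).amp x = D.amp (x ∘ f) := by
  simp only [Diagram.amp, Diagram.rename, Multiset.map_map]
  congr 1
  refine Multiset.map_congr rfl fun v _ => ?_
  cases v <;> simp [Node.rename, Node.amp]

/-! ### Summation over wires -/

/-- Sum over all basis states of the wires in `F`, the other wires carrying `|0⟩`. -/
def sumStates (F : Finset ℕ) (f : (ℕ → Bool) → ℂ) : ℂ :=
  ∑ S ∈ F.powerset, f (fun a => decide (a ∈ S))

/-- Sum over the basis states of one wire. -/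
def sumWire (a : ℕ) (f : (ℕ → Bool) → ℂ) (x : ℕ → Bool) : ℂ :=
  f (Function.update x a false) + f (Function.update x a true)

/-- Sum over the basis states of the wires in a list. -/
def sumWires : List ℕ → ((ℕ → Bool) → ℂ) → (ℕ → Bool) → ℂ
  | [], f => f
  | a :: l, f => sumWire a (sumWires l f)

theorem sumStates_insert {a : ℕ} {F : Finset ℕ} {f : (ℕ → Bool) → ℂ} (h : a ∉ F) :
    sumStates (insert a F) f = sumStates F (sumWire a f) := by
  unfold sumStates sumWire
  rw [Finset.sum_powerset_insert h, ← Finset.sum_add_distrib]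
  refine Finset.sum_congr rfl fun S hS => ?_
  have : a ∉ S := fun h' => h (Finset.mem_powerset.1 hS h')
  congr 2 <;> funext b <;> by_cases hb : b = a <;> simp [hb, this]

theorem sumWire_comm (a b : ℕ) (f : (ℕ → Bool) → ℂ) :
    sumWire a (sumWire b f) = sumWire b (sumWire a f) := by
  funext x
  by_cases h : a = b
  · rw [h]
  · simp only [sumWire, Function.update_comm h]
    ring

theorem sumWires_sumWire (a : ℕ) (l : List ℕ) (f : (ℕ → Bool) → ℂ) :
    sumWires l (sumWire a f) = sumWire a (sumWires l f) := by
  induction l with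
  | nil => rfl
  | cons b l ih => simp only [sumWires, ih, sumWire_comm]

theorem sumStates_union {l : List ℕ} (hl : l.Nodup) {F : Finset ℕ} (h : ∀ a ∈ l, a ∉ F)
    (f : (ℕ → Bool) → ℂ) : sumStates (l.toFinset ∪ F) f = sumStates F (sumWires l f) := by
  induction l generalizing f with
  | nil => simp [sumWires]
  | cons a l ih =>
    rw [List.nodup_cons] at hl
    have h1 : a ∉ l.toFinset ∪ F := by simp [hl.1, h a (by simp)]
    rw [List.toFinset_cons, Finset.insert_union, sumStates_insert h1,
      ih hl.2 (fun b hb => h b (by simp [hb])), sumWires_sumWire]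
    rfl

theorem sumWire_add (a : ℕ) (f g : (ℕ → Bool) → ℂ) :
    sumWire a (fun x => f x + g x) = fun x => sumWire a f x + sumWire a g x := by
  funext x; simp only [sumWire]; ring

theorem sumWires_add (l : List ℕ) (f g : (ℕ → Bool) → ℂ) :
    sumWires l (fun x => f x + g x) = fun x => sumWires l f x + sumWires l g x := by
  induction l with
  | nil => rfl
  | cons a l ih => simp only [sumWires, ih]; exact sumWire_add _ _ _

theorem sumWires_mul {l : List ℕ} {f g : (ℕ → Bool) → ℂ}
    (hg : ∀ a ∈ l, ∀ x b, g (Function.update x a b) = g x) :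
    sumWires l (fun x => f x * g x) = fun x => sumWires l f x * g x := by
  induction l with
  | nil => rfl
  | cons a l ih =>
    simp only [sumWires, ih fun b hb => hg b (by simp [hb])]
    funext x
    simp only [sumWire, hg a (by simp)]
    ring

theorem sumWires_mul_left {l : List ℕ} {f g : (ℕ → Bool) → ℂ}
    (hg : ∀ a ∈ l, ∀ x b, g (Function.update x a b) = g x) :
    sumWires l (fun x => g x * f x) = fun x => g x * sumWires l f x := by
  simp only [fun x => mul_comm (g x) (f x), sumWires_mul hg]
  funext x; ring

theorem sumWires_congr {l : List ℕ} {f g : (ℕ → Bool) → ℂ} (h : ∀ x, f x = g x) :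
    sumWires l f = sumWires l g := by rw [funext h]

theorem Diagram.value_eq (D : Diagram) : D.value = sumStates D.internal D.amp := by
  simp [Diagram.value, Diagram.entry, sumStates, Diagram.amp]

theorem Diagram.amp_update {D : Diagram} {a : ℕ} (h : a ∉ D.ends) (x : ℕ → Bool) (b : Bool) :
    D.amp (Function.update x a b) = D.amp x :=
  Diagram.amp_congr fun c hc => by
    rw [Function.update_of_ne]; rintro rfl; exact h hc

/-! ### Soundness of the rules -/

/-- `l` and `l'` are the wires internal to the two sides of a rule, `B` its dangling wires. -/
def Sound (L R : Diagram) : Prop :=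
  ∃ (l l' : List ℕ) (B : Multiset ℕ), L.ends = l + l + B ∧ R.ends = l' + l' + B ∧
    (l.Nodup → (∀ a ∈ B, a ∉ l) → l'.Nodup → (∀ a ∈ B, a ∉ l') →
      ∀ x, sumWires l L.amp x = sumWires l' R.amp x)

/-- This is how validity of a diagram supplies the freshness conditions that the definition of
`Sound` assumes of the internal wires. -/
theorem nodup_of_count {l : List ℕ} {B : Multiset ℕ}
    (h : ∀ a, (l + l + B : Multiset ℕ).count a ≤ 2) : l.Nodup ∧ ∀ a ∈ l, a ∉ B := by
  simp only [Multiset.count_add, Multiset.coe_count] at h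
  constructor
  · rw [List.nodup_iff_count_le_one]; intro a; have := h a; omega
  · intro a ha hB
    have := h a
    have := List.count_pos_iff.2 ha
    have := Multiset.count_pos.2 hB
    omega

theorem internal_add_eq {L C : Diagram} {l : List ℕ} {B : Multiset ℕ}
    (hL : L.ends = l + l + B) (h : ∀ a, (L + C).ends.count a ≤ 2) :
    Diagram.internal (L + C) =
      l.toFinset ∪ (B + C.ends).toFinset.filter (fun a => (B + C.ends).count a = 2) := by
  ext a
  have h1 := h a
  simp only [Diagram.internal, Diagram.ends_add, hL, Finset.mem_filter, Finset.mem_union,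
    Multiset.mem_toFinset, List.mem_toFinset, Multiset.count_add, ← Multiset.count_pos, Multiset.coe_count, ← List.count_pos_iff] at *
  omega

/-- The internal wires of `L + C` are those internal to the rule and those determined by the
boundary and the context alone; the latter are the same for both sides. Summing over the former
first, the amplitude of the context factors out and the local identity applies. -/
theorem Sound.value_eq {L R C : Diagram} (h : Sound L R) (hL : ∀ a, (L + C).ends.count a ≤ 2)
    (hR : ∀ a, (R + C).ends.count a ≤ 2) : (L + C).value = (R + C).value := by
  obtain ⟨l, l', B, eL, eR, h⟩ := h
  have aux : ∀ {L : Diagram} {l : List ℕ}, L.ends = l + l + B →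
      (∀ a, (L + C).ends.count a ≤ 2) → l.Nodup ∧ (∀ a ∈ B, a ∉ l) ∧
      (L + C).value = sumStates ((B + C.ends).toFinset.filter (fun a => (B + C.ends).count a = 2))
        (fun x => sumWires l L.amp x * C.amp x) := by
    intro L l eL hL
    have h1 : ∀ a, (l + l + (B + C.ends) : Multiset ℕ).count a ≤ 2 := by
      simpa [eL, add_assoc] using hL
    obtain ⟨n1, n2⟩ := nodup_of_count h1
    refine ⟨n1, fun a hB ha => n2 a ha (by simp [hB]), ?_⟩
    rw [Diagram.value_eq, internal_add_eq eL hL, sumStates_union n1]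
    · rw [← sumWires_mul (fun a ha x b => Diagram.amp_update (fun hc => n2 a ha (by simp [hc])) x b)]
      congr 2
      funext x; simp
    · intro a ha hm
      exact n2 a ha (by simpa using (Finset.mem_filter.1 hm).1)
  obtain ⟨a1, a2, a4⟩ := aux eL hL
  obtain ⟨b1, b2, b4⟩ := aux eR hR
  rw [a4, b4]
  congr 1
  funext x
  rw [h a1 a2 b1 b2]


/-! ### Spider amplitudes in an orthonormal basis, for both colours at once -/

/-- The amplitude of a spider with respect to an orthonormal basis `u`, `v`. -/
def spiderAmp (u v : Bool → ℂ) (c : ℂ) (S : Multiset ℕ) (x : ℕ → Bool) : ℂ :=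
  (S.map fun a => u (x a)).prod + c * (S.map fun a => v (x a)).prod

/-- Summing over the common wire produces the inner products of `u` and `v`: the mixed terms vanish
and the pure terms keep coefficient one. -/
theorem spiderAmp_sumWire_fuse {u v : Bool → ℂ} (huu : u false * u false + u true * u true = 1)
    (hvv : v false * v false + v true * v true = 1)
    (huv : u false * v false + u true * v true = 0) (c d : ℂ) {e : ℕ} {S T : Multiset ℕ}
    (hS : e ∉ S) (hT : e ∉ T) (x : ℕ → Bool) :
    sumWire e (fun x => spiderAmp u v c (e ::ₘ S) x * spiderAmp u v d (e ::ₘ T) x) x =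
      spiderAmp u v (c * d) (S + T) x := by
  have key : ∀ (w : Bool → ℂ) (S : Multiset ℕ) (b : Bool), e ∉ S →
      (S.map fun a => w (Function.update x e b a)) = S.map fun a => w (x a) := fun w S b h =>
    Multiset.map_congr rfl fun a ha => by
      rw [Function.update_of_ne]; rintro rfl; exact h ha
  simp only [sumWire, spiderAmp, Multiset.map_cons, Multiset.prod_cons, Function.update_self,
    key _ _ _ hS, key _ _ _ hT, Multiset.map_add, Multiset.prod_add]
  generalize (S.map fun a => u (x a)).prod = us
  generalize (S.map fun a => v (x a)).prod = vs
  generalize (T.map fun a => u (x a)).prod = ut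
  generalize (T.map fun a => v (x a)).prod = vt
  linear_combination (us * ut) * huu + c * d * vs * vt * hvv + (us * d * vt + c * vs * ut) * huv

theorem spiderAmp_sumWire_loop {u v : Bool → ℂ} (huu : u false * u false + u true * u true = 1)
    (hvv : v false * v false + v true * v true = 1) (c : ℂ) {e : ℕ} {S : Multiset ℕ}
    (hS : e ∉ S) (x : ℕ → Bool) :
    sumWire e (spiderAmp u v c (e ::ₘ e ::ₘ S)) x = spiderAmp u v c S x := by
  have key : ∀ (w : Bool → ℂ) (b : Bool),
      (S.map fun a => w (Function.update x e b a)) = S.map fun a => w (x a) := fun w b =>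
    Multiset.map_congr rfl fun a ha => by
      rw [Function.update_of_ne]; rintro rfl; exact hS ha
  simp only [sumWire, spiderAmp, Multiset.map_cons, Multiset.prod_cons, Function.update_self, key]
  linear_combination (S.map fun a => u (x a)).prod * huu + c * (S.map fun a => v (x a)).prod * hvv

/-- Each factor involves its own inner wire only, so the sum of the product is the product of the
sums. -/
theorem sumWires_prod (φ : Bool → Bool → ℂ) (l : List (ℕ × ℕ)) (hl : (l.map Prod.snd).Nodup)
    (h : ∀ a ∈ l.map Prod.snd, a ∉ l.map Prod.fst) (x : ℕ → Bool) :
    sumWires (l.map Prod.snd) (fun x => (l.map fun p => φ (x p.2) (x p.1)).prod) x =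
      (l.map fun p => φ false (x p.1) + φ true (x p.1)).prod := by
  induction l generalizing x with
  | nil => simp [sumWires]
  | cons p l ih =>
    simp only [List.map_cons, List.nodup_cons, List.mem_cons, forall_eq_or_imp, not_or] at hl h
    have hne : p.2 ≠ p.1 := h.1.1
    simp only [List.map_cons, sumWires, List.prod_cons]
    rw [sumWires_mul_left]
    · have key : ∀ b, (l.map fun q => φ false (Function.update x p.2 b q.1) +
          φ true (Function.update x p.2 b q.1)) =
          l.map fun q => φ false (x q.1) + φ true (x q.1) := fun b =>
        List.map_congr_left fun q hq => by
          rw [Function.update_of_ne]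
          intro hq'
          exact h.1.2 (hq' ▸ List.mem_map_of_mem hq)
      simp only [ih hl.2 (fun a ha => (h.2 a ha).2), sumWire, key, Function.update_self,
        Function.update_of_ne hne.symm]
      ring
    · intro a ha x b
      have h1 : p.2 ≠ a := by rintro rfl; exact hl.1 ha
      have h2 : p.1 ≠ a := fun h' => (h.2 a ha).1 h'.symm
      simp [Function.update_of_ne h1, Function.update_of_ne h2]

/-- The tool for rules with arbitrarily many legs: a matrix `φ` sitting on each leg in `l` acts on
the two product vectors of the spider separately, replacing `u` by `p` and `v` by `m` there. The
legs in `A` are left bare. -/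
theorem sumWires_spiderAmp {u v : Bool → ℂ} {φ : Bool → Bool → ℂ} {p m : Bool → ℂ}
    (hp : ∀ b, u false * φ false b + u true * φ true b = p b)
    (hm : ∀ b, v false * φ false b + v true * φ true b = m b)
    (c : ℂ) (l : List (ℕ × ℕ)) (A : Multiset ℕ) (hl : (l.map Prod.snd).Nodup)
    (h : ∀ a ∈ l.map Prod.snd, a ∉ l.map Prod.fst ∧ a ∉ A) (x : ℕ → Bool) :
    sumWires (l.map Prod.snd) (fun x => spiderAmp u v c (A + (l.map Prod.snd : List ℕ)) x *
        (l.map fun p => φ (x p.2) (x p.1)).prod) x =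
      (A.map fun a => u (x a)).prod * (l.map fun q => p (x q.1)).prod +
        c * ((A.map fun a => v (x a)).prod * (l.map fun q => m (x q.1)).prod) := by
  have aux : ∀ {u p : Bool → ℂ}, (∀ b, u false * φ false b + u true * φ true b = p b) →
      sumWires (l.map Prod.snd) (fun x => (A.map fun a => u (x a)).prod *
        (l.map fun p => u (x p.2) * φ (x p.2) (x p.1)).prod) x =
      (A.map fun a => u (x a)).prod * (l.map fun q => p (x q.1)).prod := by
    intro u p hp
    rw [sumWires_mul_left]
    · have := sumWires_prod (fun b b' => u b * φ b b') l hl (fun a ha => (h a ha).1) x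
      simp only [hp] at this
      simp only [this]
    · intro a ha x b
      congr 1
      refine Multiset.map_congr rfl fun c hc => ?_
      rw [Function.update_of_ne]; rintro rfl; exact (h _ ha).2 hc
  have h2 : sumWires (l.map Prod.snd) (fun x => c * ((A.map fun a => v (x a)).prod *
        (l.map fun p => v (x p.2) * φ (x p.2) (x p.1)).prod)) x =
      c * ((A.map fun a => v (x a)).prod * (l.map fun q => m (x q.1)).prod) := by
    rw [← aux hm, sumWires_mul_left (fun _ _ _ _ => rfl)]
  rw [← h2, ← aux hp, ← congrFun (sumWires_add _ _ _) x]
  refine congrFun (sumWires_congr fun x => ?_) x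
  simp only [spiderAmp, Multiset.map_add, Multiset.map_coe, List.map_map, Multiset.prod_add,
    Multiset.prod_coe, List.prod_map_mul, Function.comp_def]
  ring

theorem sqrt_two_mul_self : (Real.sqrt 2 : ℂ) * Real.sqrt 2 = 2 := by
  rw [← Complex.ofReal_mul, Real.mul_self_sqrt (by norm_num)]; norm_num

theorem sqrt_two_ne_zero : (Real.sqrt 2 : ℂ) ≠ 0 := by
  intro h; have := sqrt_two_mul_self; rw [h] at this; norm_num at this

theorem inv_sqrt_two_mul_self : (Real.sqrt 2 : ℂ)⁻¹ * (Real.sqrt 2 : ℂ)⁻¹ = 1 / 2 := by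
  rw [← mul_inv, sqrt_two_mul_self]; norm_num

theorem Diagram.amp_cons_fun (v : Node) (D : Diagram) :
    Diagram.amp (v ::ₘ D) = fun x => v.amp x * D.amp x := funext fun x => Diagram.amp_cons v D x
theorem Diagram.amp_add_fun (D E : Diagram) :
    Diagram.amp (D + E) = fun x => D.amp x * E.amp x := funext fun x => Diagram.amp_add D E x
theorem Diagram.amp_singleton_fun (v : Node) : Diagram.amp {v} = v.amp :=
  funext fun x => Diagram.amp_singleton v x

theorem amp_green (α : Real.Angle) (S : Multiset ℕ) (x : ℕ → Bool) :
    (green α S).amp x = spiderAmp ket0 ket1 α.toCircle S x := rfl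
theorem amp_red (α : Real.Angle) (S : Multiset ℕ) (x : ℕ → Bool) :
    (red α S).amp x = spiderAmp ketPlus ketMinus α.toCircle S x := rfl

theorem ketPlus_eq (b : Bool) : ketPlus b = (Real.sqrt 2 : ℂ)⁻¹ := by
  cases b <;> simp [ketPlus, ket0, ket1]
theorem ketMinus_false : ketMinus false = (Real.sqrt 2 : ℂ)⁻¹ := by
  simp [ketMinus, ket0, ket1]
theorem ketMinus_true : ketMinus true = -(Real.sqrt 2 : ℂ)⁻¹ := by
  simp [ketMinus, ket0, ket1, neg_div]
@[simp] theorem ket0_false : ket0 false = 1 := rfl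
@[simp] theorem ket0_true : ket0 true = 0 := rfl
@[simp] theorem ket1_false : ket1 false = 0 := rfl
@[simp] theorem ket1_true : ket1 true = 1 := rfl

theorem ketPlus_norm : ketPlus false * ketPlus false + ketPlus true * ketPlus true = 1 := by
  simp only [ketPlus_eq, inv_sqrt_two_mul_self]; norm_num
theorem ketMinus_norm :
    ketMinus false * ketMinus false + ketMinus true * ketMinus true = 1 := by
  simp only [ketMinus_false, ketMinus_true, neg_mul_neg, inv_sqrt_two_mul_self]; norm_num
theorem ketPlus_ketMinus : ketPlus false * ketMinus false + ketPlus true * ketMinus true = 0 := by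
  simp only [ketPlus_eq, ketMinus_false, ketMinus_true]; ring

theorem toCircle_neg_mul (α : Real.Angle) : ((-α).toCircle : ℂ) * (α.toCircle : ℂ) = 1 := by
  have h := congrArg (fun z : Circle => (z : ℂ)) (Real.Angle.toCircle_add (-α) α)
  simp at h ⊢

/-! ### Soundness of the individual rules -/

theorem sound_spider (α β : Real.Angle) (e : ℕ) (S T : Multiset ℕ) :
    Sound {green α (e ::ₘ S), green β (e ::ₘ T)} {green (α + β) (S + T)} ∧
    Sound {red α (e ::ₘ S), red β (e ::ₘ T)} {red (α + β) (S + T)} := by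
  constructor <;> refine ⟨[e], [], S + T, ?_, ?_, fun _ h _ _ x => ?_⟩
  · simp [Node.ends, ← Multiset.singleton_add]; abel
  · simp [Node.ends]
  · have hS : e ∉ S := fun he => h e (by simp [he]) (by simp)
    have hT : e ∉ T := fun he => h e (by simp [he]) (by simp)
    have := spiderAmp_sumWire_fuse (u := ket0) (v := ket1) (by simp) (by simp) (by simp)
      α.toCircle β.toCircle hS hT x
    simpa [sumWires, Diagram.amp_cons_fun, Diagram.amp_singleton_fun, amp_green, Real.Angle.toCircle_add] using this
  · simp [Node.ends, ← Multiset.singleton_add]; abel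
  · simp [Node.ends]
  · have hS : e ∉ S := fun he => h e (by simp [he]) (by simp)
    have hT : e ∉ T := fun he => h e (by simp [he]) (by simp)
    have := spiderAmp_sumWire_fuse ketPlus_norm ketMinus_norm ketPlus_ketMinus
      α.toCircle β.toCircle hS hT x
    simpa [sumWires, Diagram.amp_cons_fun, Diagram.amp_singleton_fun, amp_red, Real.Angle.toCircle_add] using this

theorem sound_loop (α : Real.Angle) (e : ℕ) (S : Multiset ℕ) :
    Sound {green α (e ::ₘ e ::ₘ S)} {green α S} ∧ Sound {red α (e ::ₘ e ::ₘ S)} {red α S} := by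
  constructor <;> refine ⟨[e], [], S, ?_, ?_, fun _ h _ _ x => ?_⟩
  · simp [Node.ends, ← Multiset.singleton_add]; abel
  · simp [Node.ends]
  · have := spiderAmp_sumWire_loop (u := ket0) (v := ket1) (by simp) (by simp) α.toCircle
      (fun he => h e he (by simp)) x
    simpa [sumWires, Diagram.amp_cons_fun, Diagram.amp_singleton_fun, amp_green] using this
  · simp [Node.ends, ← Multiset.singleton_add]; abel
  · simp [Node.ends]
  · have := spiderAmp_sumWire_loop ketPlus_norm ketMinus_norm α.toCircle (fun he => h e he (by simp)) x
    simpa [sumWires, Diagram.amp_cons_fun, Diagram.amp_singleton_fun, amp_red] using this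



-- A finite check: with the five internal wires summed out, the sixteen states of the four dangling
-- wires are compared, using only that t = 1/√2 satisfies t² = 1/2. The other rules with a bounded
-- number of legs are treated alike.
set_option maxHeartbeats 1000000 in
theorem sound_bialgebra (i a b c d p q r s e : ℕ) :
    Sound (Diagram.innerprod i 0 0 +
          {green 0 {a, p, q}, green 0 {b, r, s}, red 0 {p, r, c}, red 0 {q, s, d}})
        {red 0 {a, b, e}, green 0 {e, c, d}} ∧
    Sound (Diagram.swapColour (Diagram.innerprod i 0 0 +
          {green 0 {a, p, q}, green 0 {b, r, s}, red 0 {p, r, c}, red 0 {q, s, d}}))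
        (Diagram.swapColour {red 0 {a, b, e}, green 0 {e, c, d}}) := by
  constructor <;> refine ⟨[i, p, q, r, s], [e], {a, b, c, d}, ?_, ?_, fun n h n' h' x => ?_⟩
  · simp [Diagram.innerprod, Node.ends, ← Multiset.singleton_add, ← Multiset.cons_coe]; abel
  · simp [Node.ends, ← Multiset.singleton_add, ← Multiset.cons_coe]; abel
  · simp only [List.nodup_cons, List.mem_cons, Multiset.insert_eq_cons, Multiset.mem_cons,
      forall_eq_or_imp, Multiset.mem_singleton, forall_eq, List.not_mem_nil, or_false, not_or] at n h n' h'
    simp [Diagram.innerprod, sumWires, sumWire,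
      amp_green, amp_red, spiderAmp, Function.update_apply, n, h, h', ketPlus_eq,
      ketMinus_true, ketMinus_false]
    obtain ⟨t, ht, hs⟩ : ∃ t : ℂ, (Real.sqrt 2 : ℂ)⁻¹ = t ∧ t * t = 1 / 2 :=
      ⟨_, rfl, inv_sqrt_two_mul_self⟩
    try simp only [ht]
    clear n h n' h'
    cases x a <;> cases x b <;> cases x c <;> cases x d <;>
      simp only [ket0_false, ket0_true, ket1_false, ket1_true, ketMinus_true, ketMinus_false, ht,
        mul_zero, zero_mul, add_zero, zero_add, mul_one, one_mul] <;>
      grind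
  · simp [Diagram.innerprod, Node.ends, ← Multiset.singleton_add, ← Multiset.cons_coe,
      Node.swapColour]
    abel
  · simp [Node.ends, ← Multiset.singleton_add, ← Multiset.cons_coe, Node.swapColour]; abel
  · simp only [List.nodup_cons, List.mem_cons, Multiset.insert_eq_cons, Multiset.mem_cons,
      forall_eq_or_imp, Multiset.mem_singleton, forall_eq, List.not_mem_nil, or_false, not_or] at n h n' h'
    simp [Diagram.innerprod, sumWires, sumWire,
      amp_green, amp_red, spiderAmp, Function.update_apply, n, h, h', ketPlus_eq,
      ketMinus_true, ketMinus_false, Node.swapColour]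
    obtain ⟨t, ht, hs⟩ : ∃ t : ℂ, (Real.sqrt 2 : ℂ)⁻¹ = t ∧ t * t = 1 / 2 :=
      ⟨_, rfl, inv_sqrt_two_mul_self⟩
    try simp only [ht]
    clear n h n' h'
    cases x a <;> cases x b <;> cases x c <;> cases x d <;>
      simp only [ket0_false, ket0_true, ket1_false, ket1_true, ketMinus_true, ketMinus_false, ht,
        mul_zero, zero_mul, add_zero, zero_add, mul_one, one_mul] <;>
      grind

theorem sound_cup (a b : ℕ) :
    Sound ({green 0 {a, b}}) ({wire a b}) ∧
    Sound (Diagram.swapColour ({green 0 {a, b}})) (Diagram.swapColour ({wire a b})) := by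
  constructor <;> refine ⟨[], [], {a, b}, ?_, ?_, fun n h n' h' x => ?_⟩
  · simp [Node.ends, ← Multiset.singleton_add, ← Multiset.cons_coe] <;> abel
  · simp [Node.ends, ← Multiset.singleton_add, ← Multiset.cons_coe] <;> abel
  · simp only [Multiset.insert_eq_cons, Multiset.mem_cons,
      forall_eq_or_imp, Multiset.mem_singleton, forall_eq, List.not_mem_nil]
      at n h n' h'
    simp [sumWires,
      Node.amp]
    obtain ⟨t, ht, hs⟩ : ∃ t : ℂ, (Real.sqrt 2 : ℂ)⁻¹ = t ∧ t * t = 1 / 2 :=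
      ⟨_, rfl, inv_sqrt_two_mul_self⟩
    have hI := Complex.I_mul_I
    try simp only [ht]
    clear n h n' h'
    cases x a <;> cases x b <;>
      simp only [ket0_false, ket0_true, ket1_false, ket1_true, ht,
        mul_zero, add_zero, zero_add, mul_one] <;>
      grind
  · simp [Node.ends, Node.swapColour, ← Multiset.singleton_add, ← Multiset.cons_coe] <;> abel
  · simp [Node.ends, Node.swapColour, ← Multiset.singleton_add, ← Multiset.cons_coe] <;> abel
  · simp only [Multiset.insert_eq_cons, Multiset.mem_cons,
      forall_eq_or_imp, Multiset.mem_singleton, forall_eq, List.not_mem_nil]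
      at n h n' h'
    simp [sumWires,
      ketPlus_eq,
      Node.swapColour, Node.amp]
    obtain ⟨t, ht, hs⟩ : ∃ t : ℂ, (Real.sqrt 2 : ℂ)⁻¹ = t ∧ t * t = 1 / 2 :=
      ⟨_, rfl, inv_sqrt_two_mul_self⟩
    have hI := Complex.I_mul_I
    try simp only [ht]
    clear n h n' h'
    cases x a <;> cases x b <;>
      simp only [ket0_false, ket0_true, ket1_false, ket1_true, ketMinus_true, ketMinus_false, ht,
        mul_zero, add_zero, zero_add, mul_one] <;>
      grind

theorem sound_copy (i e a b : ℕ) :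
    Sound (Diagram.innerprod i 0 0 + {red 0 {e}, green 0 {e, a, b}}) ({red 0 {a}, red 0 {b}}) ∧
    Sound (Diagram.swapColour (Diagram.innerprod i 0 0 + {red 0 {e}, green 0 {e, a, b}})) (Diagram.swapColour ({red 0 {a}, red 0 {b}})) := by
  constructor <;> refine ⟨[i, e], [], {a, b}, ?_, ?_, fun n h n' h' x => ?_⟩
  · simp [Diagram.innerprod, Node.ends, ← Multiset.singleton_add, ← Multiset.cons_coe] <;> abel
  · simp [Node.ends, ← Multiset.singleton_add, ← Multiset.cons_coe] <;> abel
  · simp only [List.nodup_cons, List.mem_cons, Multiset.insert_eq_cons, Multiset.mem_cons,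
      forall_eq_or_imp, Multiset.mem_singleton, forall_eq, List.not_mem_nil, or_false, not_or]
      at n h n' h'
    simp [Diagram.innerprod, sumWires, sumWire,
      Function.update_apply, n, h, ketPlus_eq,
      ketMinus_true, ketMinus_false, Node.amp]
    obtain ⟨t, ht, hs⟩ : ∃ t : ℂ, (Real.sqrt 2 : ℂ)⁻¹ = t ∧ t * t = 1 / 2 :=
      ⟨_, rfl, inv_sqrt_two_mul_self⟩
    have hI := Complex.I_mul_I
    try simp only [ht]
    clear n h n' h'
    cases x a <;> cases x b <;>
      simp only [ket0_false, ket0_true, ketMinus_true, ketMinus_false, ht,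
        mul_zero, mul_one] <;>
      grind
  · simp [Diagram.innerprod, Node.ends, Node.swapColour, ← Multiset.singleton_add, ← Multiset.cons_coe] <;> abel
  · simp [Node.ends, Node.swapColour, ← Multiset.singleton_add, ← Multiset.cons_coe] <;> abel
  · simp only [List.nodup_cons, List.mem_cons, Multiset.insert_eq_cons, Multiset.mem_cons,
      forall_eq_or_imp, Multiset.mem_singleton, forall_eq, List.not_mem_nil, or_false, not_or]
      at n h n' h'
    simp [Diagram.innerprod, sumWires, sumWire,
      Function.update_apply, n, h, ketPlus_eq,
      ketMinus_true, ketMinus_false, Node.swapColour, Node.amp]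
    obtain ⟨t, ht, hs⟩ : ∃ t : ℂ, (Real.sqrt 2 : ℂ)⁻¹ = t ∧ t * t = 1 / 2 :=
      ⟨_, rfl, inv_sqrt_two_mul_self⟩
    have hI := Complex.I_mul_I
    try simp only [ht]
    clear n h n' h'
    cases x a <;> cases x b <;>
      simp only [ket0_false, ket0_true, ket1_false, ket1_true, ketMinus_true, ketMinus_false, ht,
        add_zero, zero_add, mul_one] <;>
      grind

theorem sound_piCommutation (α : Real.Angle) (i j a b e f : ℕ) :
    Sound (Diagram.innerprod i 0 0 + {green (Real.pi : Real.Angle) {a, e}, red α {e, b}}) (Diagram.innerprod j (Real.pi : Real.Angle) α +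
          {red (-α) {a, f}, green (Real.pi : Real.Angle) {f, b}}) ∧
    Sound (Diagram.swapColour (Diagram.innerprod i 0 0 + {green (Real.pi : Real.Angle) {a, e}, red α {e, b}})) (Diagram.swapColour (Diagram.innerprod j (Real.pi : Real.Angle) α +
          {red (-α) {a, f}, green (Real.pi : Real.Angle) {f, b}})) := by
  constructor <;> refine ⟨[i, e], [j, f], {a, b}, ?_, ?_, fun n h n' h' x => ?_⟩
  · simp [Diagram.innerprod, Node.ends, ← Multiset.singleton_add, ← Multiset.cons_coe] <;> abel
  · simp [Diagram.innerprod, Node.ends, ← Multiset.singleton_add, ← Multiset.cons_coe] <;> abel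
  · simp only [List.nodup_cons, List.mem_cons, Multiset.insert_eq_cons, Multiset.mem_cons,
      forall_eq_or_imp, Multiset.mem_singleton, forall_eq, List.not_mem_nil, or_false, not_or]
      at n h n' h'
    simp [Diagram.innerprod, sumWires, sumWire,
      Function.update_apply, n, h, n', h', ketPlus_eq,
      ketMinus_true, ketMinus_false, Node.amp]
    obtain ⟨t, ht, hs⟩ : ∃ t : ℂ, (Real.sqrt 2 : ℂ)⁻¹ = t ∧ t * t = 1 / 2 :=
      ⟨_, rfl, inv_sqrt_two_mul_self⟩
    have hI := Complex.I_mul_I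
    try simp only [ht]
    clear n h n' h'
    -- The two phase factors enter only through the relation that they are inverse to each other.
    have hc := toCircle_neg_mul α
    generalize ((-α).toCircle : ℂ) = c' at *
    generalize (α.toCircle : ℂ) = c at *
    cases x a <;> cases x b <;>
      simp only [ket0_false, ket0_true, ket1_false, ket1_true, ketMinus_true, ketMinus_false, ht,
        mul_zero, zero_mul, add_zero, zero_add, mul_one, one_mul] <;>
      grind
  · simp [Diagram.innerprod, Node.ends, Node.swapColour, ← Multiset.singleton_add, ← Multiset.cons_coe] <;> abel
  · simp [Diagram.innerprod, Node.ends, Node.swapColour, ← Multiset.singleton_add, ← Multiset.cons_coe] <;> abel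
  · simp only [List.nodup_cons, List.mem_cons, Multiset.insert_eq_cons, Multiset.mem_cons,
      forall_eq_or_imp, Multiset.mem_singleton, forall_eq, List.not_mem_nil, or_false, not_or]
      at n h n' h'
    simp [Diagram.innerprod, sumWires, sumWire,
      Function.update_apply, n, h, n', h', ketPlus_eq,
      ketMinus_true, ketMinus_false, Node.swapColour, Node.amp]
    obtain ⟨t, ht, hs⟩ : ∃ t : ℂ, (Real.sqrt 2 : ℂ)⁻¹ = t ∧ t * t = 1 / 2 :=
      ⟨_, rfl, inv_sqrt_two_mul_self⟩
    have hI := Complex.I_mul_I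
    try simp only [ht]
    clear n h n' h'
    have hc := toCircle_neg_mul α
    generalize ((-α).toCircle : ℂ) = c' at *
    generalize (α.toCircle : ℂ) = c at *
    cases x a <;> cases x b <;>
      simp only [ket0_false, ket0_true, ket1_false, ket1_true, ketMinus_true, ketMinus_false, ht,
        mul_zero, zero_mul, add_zero, zero_add, mul_one, one_mul] <;>
      grind

theorem sound_euler (i j k a b e f : ℕ) :
    Sound (Diagram.innerprod i 0 0 + Diagram.innerprod j 0 0 + {had a b}) (Diagram.innerprod k ((-(Real.pi / 2) : ℝ) : Real.Angle) ((-(Real.pi / 2) : ℝ) : Real.Angle) +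
          {green ((Real.pi / 2 : ℝ) : Real.Angle) {a, e}, red ((Real.pi / 2 : ℝ) : Real.Angle) {e, f}, green ((Real.pi / 2 : ℝ) : Real.Angle) {f, b}}) ∧
    Sound (Diagram.swapColour (Diagram.innerprod i 0 0 + Diagram.innerprod j 0 0 + {had a b})) (Diagram.swapColour (Diagram.innerprod k ((-(Real.pi / 2) : ℝ) : Real.Angle) ((-(Real.pi / 2) : ℝ) : Real.Angle) +
          {green ((Real.pi / 2 : ℝ) : Real.Angle) {a, e}, red ((Real.pi / 2 : ℝ) : Real.Angle) {e, f}, green ((Real.pi / 2 : ℝ) : Real.Angle) {f, b}})) := by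
  constructor <;> refine ⟨[i, j], [k, e, f], {a, b}, ?_, ?_, fun n h n' h' x => ?_⟩
  · simp [Diagram.innerprod, Node.ends, ← Multiset.singleton_add, ← Multiset.cons_coe] <;> abel
  · simp [Diagram.innerprod, Node.ends, ← Multiset.singleton_add, ← Multiset.cons_coe] <;> abel
  · simp only [List.nodup_cons, List.mem_cons, Multiset.insert_eq_cons, Multiset.mem_cons,
      forall_eq_or_imp, Multiset.mem_singleton, forall_eq, List.not_mem_nil, or_false, not_or]
      at n h n' h'
    simp [Diagram.innerprod, sumWires, sumWire,
      Function.update_apply, n, h, n', h', ketPlus_eq,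
      ketMinus_true, ketMinus_false, Node.amp]
    obtain ⟨t, ht, hs⟩ : ∃ t : ℂ, (Real.sqrt 2 : ℂ)⁻¹ = t ∧ t * t = 1 / 2 :=
      ⟨_, rfl, inv_sqrt_two_mul_self⟩
    have hI := Complex.I_mul_I
    try simp only [ht]
    clear n h n' h'
    cases x a <;> cases x b <;>
      simp only [ket0_false, ket0_true, ket1_false, ket1_true, ketMinus_true, ketMinus_false, ht,
        mul_zero, zero_mul, add_zero, zero_add, mul_one, one_mul] <;>
      grind
  · simp [Diagram.innerprod, Node.ends, Node.swapColour, ← Multiset.singleton_add, ← Multiset.cons_coe] <;> abel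
  · simp [Diagram.innerprod, Node.ends, Node.swapColour, ← Multiset.singleton_add, ← Multiset.cons_coe] <;> abel
  · simp only [List.nodup_cons, List.mem_cons, Multiset.insert_eq_cons, Multiset.mem_cons,
      forall_eq_or_imp, Multiset.mem_singleton, forall_eq, List.not_mem_nil, or_false, not_or]
      at n h n' h'
    simp [Diagram.innerprod, sumWires, sumWire,
      Function.update_apply, n, h, n', h', ketPlus_eq,
      ketMinus_true, ketMinus_false, Node.swapColour, Node.amp]
    obtain ⟨t, ht, hs⟩ : ∃ t : ℂ, (Real.sqrt 2 : ℂ)⁻¹ = t ∧ t * t = 1 / 2 :=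
      ⟨_, rfl, inv_sqrt_two_mul_self⟩
    have hI := Complex.I_mul_I
    try simp only [ht]
    clear n h n' h'
    cases x a <;> cases x b <;>
      simp only [ket0_false, ket0_true, ket1_false, ket1_true, ketMinus_true, ketMinus_false, ht,
        mul_zero, add_zero, zero_add, mul_one] <;>
      grind

theorem sound_star  :
    Sound ({star, green 0 0}) (0) ∧
    Sound (Diagram.swapColour ({star, green 0 0})) (Diagram.swapColour (0)) := by
  constructor <;> refine ⟨[], [], 0, ?_, ?_, fun n h n' h' x => ?_⟩
  · simp [Node.ends, ← Multiset.singleton_add, ← Multiset.cons_coe] <;> abel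
  · simp [← Multiset.singleton_add, ← Multiset.cons_coe] <;> abel
  · simp only [
      List.not_mem_nil]
      at n h n' h'
    simp [sumWires,
      Node.amp]
    norm_num
  · simp [Node.ends, Node.swapColour, ← Multiset.singleton_add, ← Multiset.cons_coe] <;> abel
  · simp [← Multiset.singleton_add, ← Multiset.cons_coe] <;> abel
  · simp only [
      List.not_mem_nil]
      at n h n' h'
    simp [sumWires,
      ketPlus_eq,
      Node.swapColour, Node.amp]
    norm_num

theorem sound_zero (a b : ℕ) :
    Sound ({green (Real.pi : Real.Angle) 0, wire a b}) ({green (Real.pi : Real.Angle) 0, green 0 {a}, red 0 {b}}) ∧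
    Sound (Diagram.swapColour ({green (Real.pi : Real.Angle) 0, wire a b})) (Diagram.swapColour ({green (Real.pi : Real.Angle) 0, green 0 {a}, red 0 {b}})) := by
  constructor <;> refine ⟨[], [], {a, b}, ?_, ?_, fun n h n' h' x => ?_⟩
  · simp [Node.ends, ← Multiset.singleton_add, ← Multiset.cons_coe] <;> abel
  · simp [Node.ends, ← Multiset.singleton_add, ← Multiset.cons_coe] <;> abel
  · simp only [Multiset.insert_eq_cons, Multiset.mem_cons,
      forall_eq_or_imp, Multiset.mem_singleton, forall_eq, List.not_mem_nil]
      at n h n' h'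
    simp [sumWires,
      ketPlus_eq,
      Node.amp]
  · simp [Node.ends, Node.swapColour, ← Multiset.singleton_add, ← Multiset.cons_coe] <;> abel
  · simp [Node.ends, Node.swapColour, ← Multiset.singleton_add, ← Multiset.cons_coe] <;> abel
  · simp only [Multiset.insert_eq_cons, Multiset.mem_cons,
      forall_eq_or_imp, Multiset.mem_singleton, forall_eq, List.not_mem_nil]
      at n h n' h'
    simp [sumWires,
      ketPlus_eq,
      Node.swapColour, Node.amp]

theorem sound_zeroScalar (α : Real.Angle) :
    Sound ({green (Real.pi : Real.Angle) 0, green α 0}) ({green (Real.pi : Real.Angle) 0}) ∧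
    Sound (Diagram.swapColour ({green (Real.pi : Real.Angle) 0, green α 0})) (Diagram.swapColour ({green (Real.pi : Real.Angle) 0})) := by
  constructor <;> refine ⟨[], [], 0, ?_, ?_, fun n h n' h' x => ?_⟩
  · simp [Node.ends, ← Multiset.singleton_add, ← Multiset.cons_coe] <;> abel
  · simp [Node.ends, ← Multiset.singleton_add, ← Multiset.cons_coe] <;> abel
  · simp only [
      List.not_mem_nil]
      at n h n' h'
    simp [sumWires,
      Node.amp]
  · simp [Node.ends, Node.swapColour, ← Multiset.singleton_add, ← Multiset.cons_coe] <;> abel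
  · simp [Node.ends, Node.swapColour, ← Multiset.singleton_add, ← Multiset.cons_coe] <;> abel
  · simp only [
      List.not_mem_nil]
      at n h n' h'
    simp [sumWires,
      ketPlus_eq,
      Node.swapColour, Node.amp]

theorem sound_wireSymm (a b : ℕ) :
    Sound ({wire a b}) ({wire b a}) ∧
    Sound (Diagram.swapColour ({wire a b})) (Diagram.swapColour ({wire b a})) := by
  constructor <;> refine ⟨[], [], {a, b}, ?_, ?_, fun n h n' h' x => ?_⟩
  · simp [Node.ends, ← Multiset.singleton_add, ← Multiset.cons_coe] <;> abel
  · simp [Node.ends, ← Multiset.singleton_add, ← Multiset.cons_coe] <;> abel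
  · simp only [Multiset.insert_eq_cons, Multiset.mem_cons,
      forall_eq_or_imp, Multiset.mem_singleton, forall_eq, List.not_mem_nil]
      at n h n' h'
    simp [sumWires,
      Node.amp]
    obtain ⟨t, ht, hs⟩ : ∃ t : ℂ, (Real.sqrt 2 : ℂ)⁻¹ = t ∧ t * t = 1 / 2 :=
      ⟨_, rfl, inv_sqrt_two_mul_self⟩
    have hI := Complex.I_mul_I
    try simp only [ht]
    clear n h n' h'
    cases x a <;> cases x b <;>
      simp only [ket0_false, ket0_true, ket1_false, ket1_true, ht,
        mul_zero, add_zero, zero_add, mul_one] <;>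
      grind
  · simp [Node.ends, Node.swapColour, ← Multiset.singleton_add, ← Multiset.cons_coe] <;> abel
  · simp [Node.ends, Node.swapColour, ← Multiset.singleton_add, ← Multiset.cons_coe] <;> abel
  · simp only [Multiset.insert_eq_cons, Multiset.mem_cons,
      forall_eq_or_imp, Multiset.mem_singleton, forall_eq, List.not_mem_nil]
      at n h n' h'
    simp [sumWires,
      Node.swapColour, Node.amp]
    obtain ⟨t, ht, hs⟩ : ∃ t : ℂ, (Real.sqrt 2 : ℂ)⁻¹ = t ∧ t * t = 1 / 2 :=
      ⟨_, rfl, inv_sqrt_two_mul_self⟩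
    have hI := Complex.I_mul_I
    try simp only [ht]
    clear n h n' h'
    cases x a <;> cases x b <;>
      simp only [ket0_false, ket0_true, ket1_false, ket1_true, ht,
        mul_zero, add_zero, zero_add, mul_one] <;>
      grind

theorem sound_hadSymm (a b : ℕ) :
    Sound ({had a b}) ({had b a}) ∧
    Sound (Diagram.swapColour ({had a b})) (Diagram.swapColour ({had b a})) := by
  constructor <;> refine ⟨[], [], {a, b}, ?_, ?_, fun n h n' h' x => ?_⟩
  · simp [Node.ends, ← Multiset.singleton_add, ← Multiset.cons_coe] <;> abel
  · simp [Node.ends, ← Multiset.singleton_add, ← Multiset.cons_coe] <;> abel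
  · simp only [Multiset.insert_eq_cons, Multiset.mem_cons,
      forall_eq_or_imp, Multiset.mem_singleton, forall_eq, List.not_mem_nil]
      at n h n' h'
    simp [sumWires,
      ketPlus_eq,
      Node.amp]
    obtain ⟨t, ht, hs⟩ : ∃ t : ℂ, (Real.sqrt 2 : ℂ)⁻¹ = t ∧ t * t = 1 / 2 :=
      ⟨_, rfl, inv_sqrt_two_mul_self⟩
    have hI := Complex.I_mul_I
    try simp only [ht]
    clear n h n' h'
    cases x a <;> cases x b <;>
      simp only [ket0_false, ket0_true, ket1_false, ket1_true, ketMinus_true, ketMinus_false, ht,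
        mul_zero, add_zero, zero_add, mul_one] <;>
      grind
  · simp [Node.ends, Node.swapColour, ← Multiset.singleton_add, ← Multiset.cons_coe] <;> abel
  · simp [Node.ends, Node.swapColour, ← Multiset.singleton_add, ← Multiset.cons_coe] <;> abel
  · simp only [Multiset.insert_eq_cons, Multiset.mem_cons,
      forall_eq_or_imp, Multiset.mem_singleton, forall_eq, List.not_mem_nil]
      at n h n' h'
    simp [sumWires,
      ketPlus_eq,
      Node.swapColour, Node.amp]
    obtain ⟨t, ht, hs⟩ : ∃ t : ℂ, (Real.sqrt 2 : ℂ)⁻¹ = t ∧ t * t = 1 / 2 :=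
      ⟨_, rfl, inv_sqrt_two_mul_self⟩
    have hI := Complex.I_mul_I
    try simp only [ht]
    clear n h n' h'
    cases x a <;> cases x b <;>
      simp only [ket0_false, ket0_true, ket1_false, ket1_true, ketMinus_true, ketMinus_false, ht,
        mul_zero, add_zero, zero_add, mul_one] <;>
      grind

theorem prod_map_update {w : Bool → ℂ} {S : Multiset ℕ} {e : ℕ} (h : e ∉ S) (x : ℕ → Bool)
    (b : Bool) : (S.map fun a => w (Function.update x e b a)) = S.map fun a => w (x a) :=
  Multiset.map_congr rfl fun a ha => by rw [Function.update_of_ne]; rintro rfl; exact h ha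

/-- The two-legged spider of coefficient -1 is a matrix `φ` exchanging `p` and `m`. Applying it to
one leg of p⋯p + m⋯m, or to all the other legs, gives the same two terms in opposite order; this
needs the coefficient of the second spider to be 1. -/
theorem spiderAmp_piCopy {u v p m : Bool → ℂ} {φ : Bool → Bool → ℂ}
    (hφ : ∀ b c, φ b c = φ c b)
    (hp : ∀ b, p false * φ false b + p true * φ true b = m b)
    (hm : ∀ b, m false * φ false b + m true * φ true b = p b)
    (h0 : ∀ a e x, spiderAmp u v (-1) {a, e} x = φ (x a) (x e))
    (a e : ℕ) (l : List (ℕ × ℕ)) (he : ∀ b ∈ a ::ₘ (l.map Prod.fst : List ℕ), b ∉ [e])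
    (hl : (l.map Prod.snd).Nodup)
    (h : ∀ b ∈ a ::ₘ (l.map Prod.fst : List ℕ), b ∉ l.map Prod.snd) (x : ℕ → Bool) :
    sumWires [e] (fun x => spiderAmp u v (-1) {a, e} x *
        spiderAmp p m 1 (e ::ₘ (l.map Prod.fst : List ℕ)) x) x =
      sumWires (l.map Prod.snd) (fun x => spiderAmp p m 1 (a ::ₘ (l.map Prod.snd : List ℕ)) x *
        (l.map fun q => spiderAmp u v (-1) {q.2, q.1} x).prod) x := by
  have hl' : ∀ b ∈ l.map Prod.snd, b ∉ l.map Prod.fst ∧ b ∉ ({a} : Multiset ℕ) := fun b hb =>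
    ⟨fun hb' => h b (by simpa using Or.inr (by simpa using hb')) hb, fun hb' => by
      rw [Multiset.mem_singleton] at hb'; exact h b (by simp [hb']) hb⟩
  have := sumWires_spiderAmp (u := p) (v := m) hp hm 1 l {a} hl hl' x
  simp only [h0]
  simp only [Multiset.singleton_add] at this
  rw [this]
  have hae : a ≠ e := by simpa using he a (by simp)
  have hel : e ∉ ((l.map Prod.fst : List ℕ) : Multiset ℕ) := fun h =>
    he e (by simpa using Or.inr (by simpa using h)) (by simp)
  simp only [sumWires, sumWire, spiderAmp, Multiset.map_cons, Multiset.prod_cons,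
    Function.update_self, Function.update_of_ne hae, prod_map_update hel, Multiset.map_singleton,
    Multiset.prod_singleton, Multiset.map_coe, Multiset.prod_coe, List.map_map, Function.comp_def]
  rw [hφ _ false, hφ _ true]
  linear_combination (l.map fun q => p (x q.1)).prod * hp (x a) +
    (l.map fun q => m (x q.1)).prod * hm (x a)

theorem ends_map_green (α : Real.Angle) (P : Multiset (ℕ × ℕ)) :
    Diagram.ends (P.map fun p => green α {p.2, p.1}) = P.map Prod.snd + P.map Prod.fst := by
  induction P using Multiset.induction with
  | empty => rfl
  | cons p P ih =>
    simp only [Multiset.map_cons, Diagram.ends_cons, ih, Node.ends]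
    simp only [Multiset.insert_eq_cons]
    simp only [← Multiset.singleton_add]
    abel

theorem ends_map_had (P : Multiset (ℕ × ℕ)) :
    Diagram.ends (P.map fun p => had p.1 p.2) = P.map Prod.snd + P.map Prod.fst := by
  induction P using Multiset.induction with
  | empty => rfl
  | cons p P ih =>
    simp only [Multiset.map_cons, Diagram.ends_cons, ih, Node.ends]
    simp only [Multiset.insert_eq_cons]
    simp only [← Multiset.singleton_add]
    abel

theorem amp_map_coe (f : ℕ × ℕ → Node) (l : List (ℕ × ℕ)) :
    Diagram.amp ((l : Multiset (ℕ × ℕ)).map f) = fun x => (l.map fun q => (f q).amp x).prod := by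
  funext x
  simp [Diagram.amp, Function.comp_def]

theorem sound_piCopy (a e : ℕ) (P : Multiset (ℕ × ℕ)) :
    Sound {green (Real.pi : Real.Angle) {a, e}, red 0 (e ::ₘ P.map Prod.fst)}
        (red 0 (a ::ₘ P.map Prod.snd) ::ₘ
          P.map fun p => green (Real.pi : Real.Angle) {p.2, p.1}) ∧
    Sound (Diagram.swapColour {green (Real.pi : Real.Angle) {a, e}, red 0 (e ::ₘ P.map Prod.fst)})
        (Diagram.swapColour (red 0 (a ::ₘ P.map Prod.snd) ::ₘ
          P.map fun p => green (Real.pi : Real.Angle) {p.2, p.1})) := by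
  obtain ⟨l, rfl⟩ : ∃ l : List (ℕ × ℕ), P = l := ⟨P.toList, P.coe_toList.symm⟩
  have e1 : ∀ D : Diagram, D.swapColour.ends = D.ends := fun D => by simp
  have hL : Diagram.ends {green (Real.pi : Real.Angle) {a, e},
      red 0 (e ::ₘ (l : Multiset (ℕ × ℕ)).map Prod.fst)} =
      ([e] : List ℕ) + ([e] : List ℕ) + a ::ₘ (l.map Prod.fst : List ℕ) := by
    simp [Node.ends, ← Multiset.singleton_add, ← Multiset.cons_coe]; abel
  have hR : Diagram.ends (red 0 (a ::ₘ (l : Multiset (ℕ × ℕ)).map Prod.snd) ::ₘ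
      (l : Multiset (ℕ × ℕ)).map fun p => green (Real.pi : Real.Angle) {p.2, p.1}) =
      (l.map Prod.snd : List ℕ) + (l.map Prod.snd : List ℕ) + a ::ₘ (l.map Prod.fst : List ℕ) := by
    rw [Diagram.ends_cons, ends_map_green]
    simp only [Node.ends, ← Multiset.singleton_add, Multiset.map_coe]; abel
  constructor
  · refine ⟨[e], l.map Prod.snd, a ::ₘ (l.map Prod.fst : List ℕ), hL, hR, fun _ h n' h' x => ?_⟩
    have := spiderAmp_piCopy (u := ket0) (v := ket1) (p := ketPlus) (m := ketMinus)
      (φ := fun b c => ket0 b * ket0 c - ket1 b * ket1 c) (fun b c => by ring)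
      (fun b => by cases b <;> simp [ketPlus_eq, ketMinus_false, ketMinus_true])
      (fun b => by cases b <;> simp [ketPlus_eq, ketMinus_false, ketMinus_true])
      (fun a e x => by simp [spiderAmp]; ring) a e l h n' h' x
    simp only [Diagram.amp_cons_fun, amp_map_coe]
    simpa [Diagram.amp_cons_fun, Diagram.amp_singleton_fun, amp_map_coe, amp_green, amp_red,
      Multiset.insert_eq_cons] using this
  · refine ⟨[e], l.map Prod.snd, a ::ₘ (l.map Prod.fst : List ℕ), (e1 _).trans hL, (e1 _).trans hR,
      fun _ h n' h' x => ?_⟩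
    have := spiderAmp_piCopy (u := ketPlus) (v := ketMinus) (p := ket0) (m := ket1)
      (φ := fun b c => ketPlus b * ketPlus c - ketMinus b * ketMinus c) (fun b c => by ring)
      (fun b => by
        have := inv_sqrt_two_mul_self
        cases b <;> simp only [ketPlus_eq, ketMinus_false, ketMinus_true, ket0, ket1] <;> grind)
      (fun b => by
        have := inv_sqrt_two_mul_self
        cases b <;> simp only [ketPlus_eq, ketMinus_false, ketMinus_true, ket0, ket1] <;> grind)
      (fun a e x => by simp [spiderAmp]; ring) a e l h n' h' x
    simp only [Diagram.amp_cons_fun, amp_map_coe, Diagram.swapColour, Multiset.map_cons, Multiset.map_map,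
      Function.comp_def, Node.swapColour]
    simpa [Diagram.amp_cons_fun, Diagram.amp_singleton_fun, amp_map_coe, amp_green, amp_red,
      Multiset.insert_eq_cons, Node.swapColour, Diagram.swapColour,
      Function.comp_def] using this

theorem sound_colour (α : Real.Angle) (P : Multiset (ℕ × ℕ)) :
    Sound {red α (P.map Prod.fst)} (green α (P.map Prod.snd) ::ₘ P.map fun p => had p.1 p.2) ∧
    Sound (Diagram.swapColour {red α (P.map Prod.fst)})
      (Diagram.swapColour (green α (P.map Prod.snd) ::ₘ P.map fun p => had p.1 p.2)) := by
  obtain ⟨l, rfl⟩ : ∃ l : List (ℕ × ℕ), P = l := ⟨P.toList, P.coe_toList.symm⟩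
  have e1 : ∀ D : Diagram, D.swapColour.ends = D.ends := fun D => by simp
  have hL : Diagram.ends {red α ((l : Multiset (ℕ × ℕ)).map Prod.fst)} =
      ([] : List ℕ) + ([] : List ℕ) + (l.map Prod.fst : List ℕ) := by
    simp [Node.ends]
  have hR : Diagram.ends (green α ((l : Multiset (ℕ × ℕ)).map Prod.snd) ::ₘ
      (l : Multiset (ℕ × ℕ)).map fun p => had p.1 p.2) =
      (l.map Prod.snd : List ℕ) + (l.map Prod.snd : List ℕ) + (l.map Prod.fst : List ℕ) := by
    rw [Diagram.ends_cons, ends_map_had]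
    simp only [Node.ends, Multiset.map_coe]; abel
  constructor
  · refine ⟨[], l.map Prod.snd, (l.map Prod.fst : List ℕ), hL, hR, fun _ _ n' h' x => ?_⟩
    have := sumWires_spiderAmp (u := ket0) (v := ket1) (p := ketPlus) (m := ketMinus)
      (φ := fun b a => ketPlus b * ket0 a + ketMinus b * ket1 a)
      (fun b => by cases b <;> simp [ketPlus, ketMinus, ket0, ket1])
      (fun b => by cases b <;> simp [ketPlus, ketMinus, ket0, ket1]) α.toCircle l 0 n'
      (fun a ha => ⟨fun hb => h' a (by simpa using hb) ha, by simp⟩) x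
    simp only [Diagram.amp_cons_fun, amp_map_coe]
    simp [Node.amp, spiderAmp, sumWires,
      Function.comp_def] at this ⊢
    exact this.symm
  · refine ⟨[], l.map Prod.snd, (l.map Prod.fst : List ℕ), (e1 _).trans hL, (e1 _).trans hR,
      fun _ _ n' h' x => ?_⟩
    have := sumWires_spiderAmp (u := ketPlus) (v := ketMinus) (p := ket0) (m := ket1)
      (φ := fun b a => ketPlus b * ket0 a + ketMinus b * ket1 a)
      (fun b => by linear_combination ket0 b * ketPlus_norm + ket1 b * ketPlus_ketMinus)
      (fun b => by linear_combination ket1 b * ketMinus_norm + ket0 b * ketPlus_ketMinus)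
      α.toCircle l 0 n'
      (fun a ha => ⟨fun hb => h' a (by simpa using hb) ha, by simp⟩) x
    simp only [Diagram.amp_cons_fun, amp_map_coe, Diagram.swapColour, Multiset.map_cons, Multiset.map_map,
      Function.comp_def, Node.swapColour]
    simp [Node.amp, spiderAmp, sumWires,
      Function.comp_def, Node.swapColour] at this ⊢
    exact this.symm

/-- Every rule is sound in both colours. -/
theorem Rule.sound {L R : Diagram} (h : Rule L R) :
    Sound L R ∧ Sound L.swapColour R.swapColour := by
  induction h with
  | spider α β e S T => simpa [Node.swapColour, Multiset.insert_eq_cons] using sound_spider α β e S T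
  | loop α e S => simpa [Node.swapColour] using sound_loop α e S
  | cup a b => exact sound_cup a b
  | bialgebra i a b c d p q r s e => exact sound_bialgebra i a b c d p q r s e
  | copy i e a b => exact sound_copy i e a b
  | piCopy a e P => exact sound_piCopy a e P
  | piCommutation α i j a b e f => exact sound_piCommutation α i j a b e f
  | colour α P => exact sound_colour α P
  | euler i j k a b e f => exact sound_euler i j k a b e f
  | starRule => exact sound_star
  | zero a b => exact sound_zero a b
  | zeroScalar α => exact sound_zeroScalar α
  | swap _ ih => simpa using ih.symm
  | wireSymm a b => exact sound_wireSymm a b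
  | hadSymm a b => exact sound_hadSymm a b


/-! ### Soundness of the topological moves and of derivations -/

theorem count_map_update {a b : ℕ} (hab : a ≠ b) (S : Multiset ℕ) (c : ℕ) :
    (S.map (Function.update id b a)).count c =
      if c = b then 0 else if c = a then S.count a + S.count b else S.count c := by
  induction S using Multiset.induction with
  | empty => simp
  | cons d S ih =>
    rw [Multiset.map_cons, Multiset.count_cons, ih, Multiset.count_cons, Multiset.count_cons,
      Multiset.count_cons, Function.update_apply, id_eq]
    grind

theorem Diagram.internal_rename {f : ℕ → ℕ} (hf : Function.Injective f) (D : Diagram) :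
    (D.rename f).internal = D.internal.image f := by
  ext a
  simp only [Diagram.internal, Diagram.ends_rename, Finset.mem_filter, Multiset.mem_toFinset,
    Multiset.mem_map, Finset.mem_image]
  constructor
  · rintro ⟨⟨b, hb, rfl⟩, h2⟩
    rw [Multiset.count_map_eq_count' _ _ hf] at h2
    exact ⟨b, ⟨hb, h2⟩, rfl⟩
  · rintro ⟨b, ⟨hb, h2⟩, rfl⟩
    rw [Multiset.count_map_eq_count' _ _ hf]
    exact ⟨⟨b, hb, rfl⟩, h2⟩

theorem Diagram.value_rename {f : ℕ → ℕ} (hf : Function.Injective f) (D : Diagram) :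
    (D.rename f).value = D.value := by
  rw [Diagram.value_eq, Diagram.value_eq, Diagram.internal_rename hf]
  unfold sumStates
  rw [Finset.powerset_image, Finset.sum_image
    (fun S _ T _ hST => Finset.image_injective hf hST)]
  refine Finset.sum_congr rfl fun S _ => ?_
  rw [Diagram.amp_rename]
  congr 1
  funext a
  simp [hf.eq_iff]

/-- The amplitude of a wire is a Kronecker delta, so the sum over `b` keeps only the terms in which
`b` carries the state of `a`. -/
theorem Diagram.value_shorten {a b : ℕ} {D : Diagram} (hab : a ≠ b) (hb : D.ends.count b = 1)
    (ha : D.ends.count a ≤ 1) :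
    Diagram.value (wire a b ::ₘ D) = (D.rename (Function.update id b a)).value := by
  have hcount := count_map_update hab D.ends
  have h1 : Diagram.internal (wire a b ::ₘ D) =
      insert b (D.rename (Function.update id b a)).internal := by
    ext c
    simp only [Diagram.internal, Diagram.ends_rename, Finset.mem_filter, Multiset.mem_toFinset,
      Finset.mem_insert, ← Multiset.count_pos, hcount, Diagram.ends_cons, Multiset.count_add,
      Node.ends, Multiset.insert_eq_cons, Multiset.count_cons, Multiset.count_singleton]
    grind
  have h2 : b ∉ (D.rename (Function.update id b a)).internal := by
    simp only [Diagram.internal, Diagram.ends_rename, Finset.mem_filter, Multiset.mem_toFinset,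
      ← Multiset.count_pos, hcount]
    simp
  rw [Diagram.value_eq, Diagram.value_eq, h1, sumStates_insert h2]
  congr 1
  funext x
  have h3 : x ∘ Function.update id b a = Function.update x b (x a) := by
    funext c
    by_cases hc : c = b <;> simp [hc]
  rw [Diagram.amp_rename, h3]
  simp only [sumWire, Diagram.amp_cons, Node.amp, Function.update_self, Function.update_of_ne hab]
  cases x a <;> simp

theorem Node.phaseIn_rename {A : AddSubgroup Real.Angle} {f : ℕ → ℕ} {v : Node} :
    (v.rename f).PhaseIn A ↔ v.PhaseIn A := by
  cases v <;> rfl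

theorem Diagram.phaseIn_rename {A : AddSubgroup Real.Angle} {f : ℕ → ℕ} {D : Diagram} :
    (∀ v ∈ D.rename f, v.PhaseIn A) ↔ ∀ v ∈ D, v.PhaseIn A := by
  simp [Diagram.rename, Node.phaseIn_rename]

theorem Sound.count_mod {L R : Diagram} (h : Sound L R) (a : ℕ) :
    L.ends.count a % 2 = R.ends.count a % 2 := by
  obtain ⟨l, l', B, h1, h2, -⟩ := h
  simp only [h1, h2, Multiset.count_add]
  omega

/-- Internal names may come and go, but always two ends at a time. Together with the bound of two
ends per name this shows that derivations preserve the absence of dangling wires. -/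
theorem Eqv.count_mod {A : AddSubgroup Real.Angle} {D E : Diagram} (h : Eqv A D E) (a : ℕ) :
    D.ends.count a % 2 = E.ends.count a % 2 := by
  induction h with
  | refl _ => rfl
  | symm _ ih => exact ih.symm
  | trans _ _ ih1 ih2 => exact ih1.trans ih2
  | rule C hr _ _ =>
    have := hr.sound.1.count_mod a
    simp only [Diagram.ends_add, Multiset.count_add]
    omega
  | @rename D f hD hf =>
    rw [Diagram.ends_rename]
    obtain ⟨b, rfl⟩ := f.surjective a
    rw [Multiset.count_map_eq_count' _ _ f.injective]
    -- If `b` or `f b` is dangling, then `f` fixes it and the two names coincide; otherwise both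
    -- counts are 0 or 2.
    by_cases h1 : D.ends.count b = 1
    · rw [hf b h1]
    · by_cases h2 : D.ends.count (f b) = 1
      · have := f.injective (hf _ h2)
        rw [this]
      · have := hD.1 b
        have := hD.1 (f b)
        omega
  | @shorten D b c hD hbc hc =>
    rw [Diagram.ends_rename, count_map_update hbc]
    simp only [Diagram.ends_cons, Multiset.count_add, Node.ends, Multiset.insert_eq_cons,
      Multiset.count_cons, Multiset.count_singleton]
    grind

theorem Diagram.valid_shorten {A : AddSubgroup Real.Angle} {a b : ℕ} {D : Diagram}
    (hD : Diagram.Valid A (wire a b ::ₘ D)) (hab : a ≠ b) (hb : D.ends.count b = 1) :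
    Diagram.Valid A (D.rename (Function.update id b a)) := by
  refine ⟨fun c => ?_, Diagram.phaseIn_rename.2 fun v hv => hD.2 v (by simp [hv])⟩
  have h1 := hD.1 c
  have h2 := hD.1 a
  rw [Diagram.ends_rename, count_map_update hab]
  simp only [Diagram.ends_cons, Multiset.count_add, Node.ends, Multiset.insert_eq_cons,
      Multiset.count_cons, Multiset.count_singleton] at h1 h2
  grind

theorem Diagram.valid_rename {A : AddSubgroup Real.Angle} {D : Diagram} {f : ℕ → ℕ}
    (hf : Function.Injective f) (hD : D.Valid A) : (D.rename f).Valid A := by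
  refine ⟨fun c => ?_, Diagram.phaseIn_rename.2 hD.2⟩
  rw [Diagram.ends_rename]
  by_cases h : ∃ b, f b = c
  · obtain ⟨b, rfl⟩ := h
    rw [Multiset.count_map_eq_count' _ _ hf]; exact hD.1 b
  · rw [Multiset.count_eq_zero_of_notMem]
    · omega
    · simp only [Multiset.mem_map, not_exists, not_and]
      exact fun b _ hb => h ⟨b, hb⟩

theorem Eqv.valid {A : AddSubgroup Real.Angle} {D E : Diagram} (h : Eqv A D E) :
    D.Valid A ∧ E.Valid A := by
  induction h with
  | refl h => exact ⟨h, h⟩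
  | symm _ ih => exact ih.symm
  | trans _ _ ih1 ih2 => exact ⟨ih1.1, ih2.2⟩
  | rule C hr h1 h2 => exact ⟨h1, h2⟩
  | rename f hD hf => exact ⟨hD, Diagram.valid_rename f.injective hD⟩
  | shorten a b hD hab hb => exact ⟨hD, Diagram.valid_shorten hD hab hb⟩

theorem Eqv.isScalar {A : AddSubgroup Real.Angle} {D E : Diagram} (h : Eqv A D E)
    (hD : D.IsScalar) : E.IsScalar := fun a => by
  have h1 := h.count_mod a
  have h2 := h.valid.2.1 a
  have h3 := hD a
  omega

/-- Derivable equations between scalar diagrams hold for the numbers that they represent. -/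
theorem Eqv.value_eq {A : AddSubgroup Real.Angle} {D E : Diagram} (h : Eqv A D E)
    (hD : D.IsScalar) : D.value = E.value := by
  induction h with
  | refl _ => rfl
  | symm h ih => exact (ih (h.symm.isScalar hD)).symm
  | trans h1 _ ih1 ih2 => exact (ih1 hD).trans (ih2 (h1.isScalar hD))
  | rule C hr h1 h2 => exact hr.sound.1.value_eq h1.1 h2.1
  | rename f _ _ => exact (Diagram.value_rename f.injective _).symm
  | @shorten D a b hD' hab hb =>
    refine Diagram.value_shorten hab hb ?_
    have := hD'.1 a
    simp only [Diagram.ends_cons, Multiset.count_add, Node.ends, Multiset.insert_eq_cons,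
      Multiset.count_cons, Multiset.count_singleton] at this
    grind

/-! ### Juxtaposition -/

theorem sumWires_dependence {l : List ℕ} {s : ℕ → Prop} {f : (ℕ → Bool) → ℂ}
    (hf : ∀ x y, (∀ a, s a → x a = y a) → f x = f y) {x y : ℕ → Bool}
    (h : ∀ a, s a → a ∉ l → x a = y a) : sumWires l f x = sumWires l f y := by
  induction l generalizing x y with
  | nil => exact hf x y fun a ha => h a ha (by simp)
  | cons b l ih =>
    simp only [sumWires, sumWire]
    congr 1 <;> refine ih fun a ha hal => ?_ <;> by_cases hab : a = b <;>
      simp only [hab, Function.update_self, ne_eq, not_false_eq_true, Function.update_of_ne] <;>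
      exact h a ha (by simp [hab, hal])

theorem Diagram.IsScalar.mem_internal {D : Diagram} (hD : D.IsScalar) {a : ℕ} (ha : a ∈ D.ends) :
    a ∈ D.internal := by
  have := hD a
  have := Multiset.count_pos.2 ha
  simp only [Diagram.internal, Finset.mem_filter, Multiset.mem_toFinset]
  exact ⟨ha, by omega⟩

/-- Once all wires of a scalar diagram are summed over, nothing depends on the state `x` any more.
-/
theorem Diagram.IsScalar.sumWires_eq {D : Diagram} (hD : D.IsScalar) (x : ℕ → Bool) :
    sumWires D.internal.toList D.amp x = D.value := by
  have h := sumStates_union (F := ∅) D.internal.nodup_toList (by simp) D.amp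
  rw [Finset.toList_toFinset, Finset.union_empty] at h
  rw [Diagram.value_eq, h]
  simp only [sumStates, Finset.powerset_empty, Finset.sum_singleton]
  refine sumWires_dependence (s := fun a => a ∈ D.ends) (fun x y h => Diagram.amp_congr h)
    fun a ha hal => absurd (hD.mem_internal ha) (by simpa using hal)

/-- The state sum over disjoint sets of wires is a product; summing over the wires of `D` first
leaves its value as a constant factor. -/
theorem Diagram.value_add {D E : Diagram} (hD : D.IsScalar)
    (h : ∀ a ∈ D.ends, a ∉ E.ends) : Diagram.value (D + E) = D.value * E.value := by
  have h1 : Diagram.internal (D + E) = D.internal.toList.toFinset ∪ E.internal := by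
    ext a
    have := hD a
    have h' := h a
    simp only [Diagram.internal, Diagram.ends_add, Finset.toList_toFinset, Finset.mem_filter,
      Finset.mem_union, Multiset.mem_toFinset, Multiset.count_add,
      ← Multiset.count_pos] at *
    omega
  rw [Diagram.value_eq (D + E), h1, sumStates_union D.internal.nodup_toList]
  · have : sumWires D.internal.toList (Diagram.amp (D + E)) =
        fun x => D.value * E.amp x := by
      rw [Diagram.amp_add_fun, sumWires_mul]
      · funext x; rw [hD.sumWires_eq]
      · intro a ha x b
        refine Diagram.amp_update (h a ?_) x b
        simpa using (Finset.mem_filter.1 (Finset.mem_toList.1 ha)).1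
    rw [this, Diagram.value_eq E, sumStates, sumStates, Finset.mul_sum]
  · intro a ha ha'
    refine h a ?_ (by simpa using (Finset.mem_filter.1 ha').1)
    simpa using (Finset.mem_filter.1 (Finset.mem_toList.1 ha)).1

theorem two_mul_injective : Function.Injective fun a : ℕ => 2 * a := fun a b h => by
  simpa using h
theorem two_mul_add_one_injective : Function.Injective fun a : ℕ => 2 * a + 1 := fun a b h => by
  simpa using h

theorem Diagram.isScalar_rename {f : ℕ → ℕ} (hf : Function.Injective f) {D : Diagram}
    (hD : D.IsScalar) : (D.rename f).IsScalar := fun c => by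
  rw [Diagram.ends_rename]
  by_cases h : ∃ b, f b = c
  · obtain ⟨b, rfl⟩ := h
    rw [Multiset.count_map_eq_count' _ _ hf]; exact hD b
  · left
    rw [Multiset.count_eq_zero_of_notMem]
    simp only [Multiset.mem_map, not_exists, not_and]
    exact fun b _ hb => h ⟨b, hb⟩

theorem Diagram.par_disjoint (D E : Diagram) :
    ∀ a ∈ (D.rename fun a => 2 * a).ends, a ∉ (E.rename fun a => 2 * a + 1).ends := by
  simp only [Diagram.ends_rename, Multiset.mem_map]
  rintro _ ⟨b, -, rfl⟩ ⟨c, -, h⟩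
  omega

theorem Diagram.value_par {D E : Diagram} (hD : D.IsScalar) :
    (D.par E).value = D.value * E.value := by
  rw [Diagram.par, Diagram.value_add (Diagram.isScalar_rename two_mul_injective hD)
    (Diagram.par_disjoint D E), Diagram.value_rename two_mul_injective,
    Diagram.value_rename two_mul_add_one_injective]

theorem Diagram.IsScalar.add {D E : Diagram} (hD : D.IsScalar) (hE : E.IsScalar)
    (h : ∀ a ∈ D.ends, a ∉ E.ends) : Diagram.IsScalar (D + E) := fun a => by
  have h1 := hD a
  have h2 := hE a
  have h3 := h a
  simp only [← Multiset.count_pos, Diagram.ends_add, Multiset.count_add] at *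
  omega

theorem Diagram.IsScalar.par {D E : Diagram} (hD : D.IsScalar) (hE : E.IsScalar) :
    (D.par E).IsScalar :=
  (Diagram.isScalar_rename two_mul_injective hD).add
    (Diagram.isScalar_rename two_mul_add_one_injective hE) (Diagram.par_disjoint D E)

theorem IsStabilizerScalar.par {D E : Diagram} (hD : IsStabilizerScalar D)
    (hE : IsStabilizerScalar E) : IsStabilizerScalar (D.par E) := by
  refine ⟨hD.1.par hE.1, fun v hv => ?_⟩
  rcases Multiset.mem_add.1 hv with h | h
  · exact Diagram.phaseIn_rename.2 hD.2 v h
  · exact Diagram.phaseIn_rename.2 hE.2 v h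


/-! ### Symmetries of derivations -/

theorem Node.PhaseIn.mono {A B : AddSubgroup Real.Angle} (h : A ≤ B) {v : Node}
    (hv : v.PhaseIn A) : v.PhaseIn B := by
  cases v <;> first | exact h hv | trivial

theorem Diagram.Valid.mono {A B : AddSubgroup Real.Angle} (h : A ≤ B) {D : Diagram}
    (hD : D.Valid A) : D.Valid B := ⟨hD.1, fun v hv => (hD.2 v hv).mono h⟩

/-- The phase group enters a derivation only through validity of the diagrams. It therefore suffices
to derive everything in the stabilizer calculus. -/
theorem Eqv.mono {A B : AddSubgroup Real.Angle} (h : A ≤ B) {D E : Diagram} (hDE : Eqv A D E) :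
    Eqv B D E := by
  induction hDE with
  | refl hD => exact .refl (hD.mono h)
  | symm _ ih => exact ih.symm
  | trans _ _ ih1 ih2 => exact ih1.trans ih2
  | rule C hr h1 h2 => exact .rule C hr (h1.mono h) (h2.mono h)
  | rename f hD hf => exact .rename f (hD.mono h) hf
  | shorten a b hD hab hb => exact .shorten a b (hD.mono h) hab hb

theorem Node.phaseIn_swapColour {A : AddSubgroup Real.Angle} {v : Node} :
    v.swapColour.PhaseIn A ↔ v.PhaseIn A := by
  cases v <;> rfl

theorem Diagram.Valid.swapColour {A : AddSubgroup Real.Angle} {D : Diagram} (hD : D.Valid A) :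
    D.swapColour.Valid A := by
  refine ⟨by simpa using hD.1, fun v hv => ?_⟩
  obtain ⟨w, hw, rfl⟩ := Multiset.mem_map.1 hv
  exact Node.phaseIn_swapColour.2 (hD.2 w hw)

theorem Diagram.rename_swapColour (f : ℕ → ℕ) (D : Diagram) :
    D.swapColour.rename f = (D.rename f).swapColour := by
  simp only [Diagram.rename, Diagram.swapColour, Multiset.map_map]
  refine Multiset.map_congr rfl fun v _ => ?_
  cases v <;> rfl

theorem Eqv.swapColour {A : AddSubgroup Real.Angle} {D E : Diagram} (h : Eqv A D E) :
    Eqv A D.swapColour E.swapColour := by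
  induction h with
  | refl hD => exact .refl hD.swapColour
  | symm _ ih => exact ih.symm
  | trans _ _ ih1 ih2 => exact ih1.trans ih2
  | rule C hr h1 h2 =>
    rw [Diagram.swapColour_add, Diagram.swapColour_add]
    refine .rule _ hr.swap ?_ ?_
    · rw [← Diagram.swapColour_add]; exact h1.swapColour
    · rw [← Diagram.swapColour_add]; exact h2.swapColour
  | rename f hD hf =>
    rw [← Diagram.rename_swapColour]
    exact .rename f hD.swapColour (by simpa using hf)
  | shorten a b hD hab hb =>
    rw [← Diagram.rename_swapColour, Diagram.swapColour_cons]
    refine .shorten a b ?_ hab (by simpa using hb)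
    simpa [Node.swapColour] using hD.swapColour

theorem Rule.rename (f : ℕ → ℕ) {L R : Diagram} (h : Rule L R) :
    Rule (L.rename f) (R.rename f) := by
  induction h with
  | spider α β e S T =>
    simpa [Node.rename, Diagram.rename] using Rule.spider α β (f e) (S.map f) (T.map f)
  | loop α e S => simpa [Node.rename, Diagram.rename] using Rule.loop α (f e) (S.map f)
  | cup a b => simpa [Node.rename, Diagram.rename] using Rule.cup (f a) (f b)
  | bialgebra i a b c d p q r s e =>
    simpa [Node.rename, Diagram.rename, Diagram.innerprod] using
      Rule.bialgebra (f i) (f a) (f b) (f c) (f d) (f p) (f q) (f r) (f s) (f e)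
  | copy i e a b =>
    simpa [Node.rename, Diagram.rename, Diagram.innerprod] using
      Rule.copy (f i) (f e) (f a) (f b)
  | piCopy a e P =>
    simpa [Node.rename, Diagram.rename, Multiset.map_map, Function.comp_def] using
      Rule.piCopy (f a) (f e) (P.map fun p => (f p.1, f p.2))
  | piCommutation α i j a b e g =>
    simpa [Node.rename, Diagram.rename, Diagram.innerprod] using
      Rule.piCommutation α (f i) (f j) (f a) (f b) (f e) (f g)
  | colour α P =>
    simpa [Node.rename, Diagram.rename, Multiset.map_map, Function.comp_def] using
      Rule.colour α (P.map fun p => (f p.1, f p.2))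
  | euler i j k a b e g =>
    simpa [Node.rename, Diagram.rename, Diagram.innerprod] using
      Rule.euler (f i) (f j) (f k) (f a) (f b) (f e) (f g)
  | starRule => simpa [Node.rename, Diagram.rename] using Rule.starRule
  | zero a b => simpa [Node.rename, Diagram.rename] using Rule.zero (f a) (f b)
  | zeroScalar α => simpa [Node.rename, Diagram.rename] using Rule.zeroScalar α
  | swap _ ih => rw [Diagram.rename_swapColour, Diagram.rename_swapColour]; exact ih.swap
  | wireSymm a b => simpa [Node.rename, Diagram.rename] using Rule.wireSymm (f a) (f b)
  | hadSymm a b => simpa [Node.rename, Diagram.rename] using Rule.hadSymm (f a) (f b)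

theorem Diagram.Valid.rename_add {A : AddSubgroup Real.Angle} {D C : Diagram} {f : ℕ → ℕ}
    (hf : Function.Injective f) (hD : D.Valid A) (hC : C.Valid A)
    (h : ∀ a, f a ∉ C.ends) : Diagram.Valid A (D.rename f + C) := by
  refine ⟨fun c => ?_, fun v hv => ?_⟩
  · have h1 := (Diagram.valid_rename hf hD).1 c
    have h2 := hC.1 c
    rw [Diagram.ends_add, Multiset.count_add]
    by_cases hc : ∃ b, f b = c
    · obtain ⟨b, rfl⟩ := hc
      have := Multiset.count_eq_zero_of_notMem (h b)
      omega
    · have : c ∉ (D.rename f).ends := by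
        simp only [Diagram.ends_rename, Multiset.mem_map, not_exists, not_and]
        exact fun b _ hb => hc ⟨b, hb⟩
      have := Multiset.count_eq_zero_of_notMem this
      omega
  · rcases Multiset.mem_add.1 hv with h | h
    · exact Diagram.phaseIn_rename.2 hD.2 v h
    · exact hC.2 v h

/-- A derivation can be carried out beside another diagram, after renaming. -/
theorem Eqv.rename_add {A : AddSubgroup Real.Angle} {D E C : Diagram} {f : ℕ → ℕ}
    (hf : Function.Injective f) (hC : C.Valid A) (h : ∀ a, f a ∉ C.ends) (hDE : Eqv A D E) :
    Eqv A (D.rename f + C) (E.rename f + C) := by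
  induction hDE with
  | refl hD => exact .refl (hD.rename_add hf hC h)
  | symm _ ih => exact ih.symm
  | trans _ _ ih1 ih2 => exact ih1.trans ih2
  | rule C' hr h1 h2 =>
    have h1' := h1.rename_add hf hC h
    have h2' := h2.rename_add hf hC h
    rw [Diagram.rename_add, add_assoc] at h1' h2' ⊢
    rw [Diagram.rename_add, add_assoc]
    exact .rule _ (hr.rename f) h1' h2'
  | @rename D g hD hg =>
    -- The permutation is transported to the range of `f` and extended by the identity, so that it
    -- moves no wire of `C`.
    have h1 : ∀ a, g.viaEmbedding ⟨f, hf⟩ (f a) = f (g a) := fun a =>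
      g.viaEmbedding_apply ⟨f, hf⟩ a
    have h2 : ∀ a, (∀ b, f b ≠ a) → g.viaEmbedding ⟨f, hf⟩ a = a := fun a ha =>
      g.viaEmbedding_apply_of_notMem ⟨f, hf⟩ a (by simpa using ha)
    have h3 := Eqv.rename (g.viaEmbedding ⟨f, hf⟩) (hD.rename_add hf hC h) fun a ha => by
      by_cases hc : ∃ b, f b = a
      · obtain ⟨b, rfl⟩ := hc
        rw [Diagram.ends_add, Diagram.ends_rename, Multiset.count_add,
          Multiset.count_eq_zero_of_notMem (h b), Multiset.count_map_eq_count' _ _ hf] at ha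
        rw [h1, hg b ha]
      · exact h2 a (not_exists.1 hc)
    rw [Diagram.rename_add, Diagram.rename_rename] at h3
    have h4 : C.rename (g.viaEmbedding ⟨f, hf⟩) = C := by
      conv_rhs => rw [← Diagram.rename_id C]
      exact Diagram.rename_congr fun a ha => h2 a fun b hb => h b (hb ▸ ha)
    have h5 : ⇑(g.viaEmbedding ⟨f, hf⟩) ∘ f = f ∘ g := funext h1
    rw [h4, h5] at h3
    rwa [Diagram.rename_rename]
  | @shorten D a b hD hab hb =>
    have h0 := hD.rename_add hf hC h
    have h1 : (Diagram.ends (D.rename f + C)).count (f b) = 1 := by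
      rw [Diagram.ends_add, Diagram.ends_rename, Multiset.count_add,
          Multiset.count_eq_zero_of_notMem (h b), Multiset.count_map_eq_count' _ _ hf, hb]
    rw [Diagram.rename_cons, Multiset.cons_add] at h0 ⊢
    have h3 := Eqv.shorten (f a) (f b) h0 (fun h => hab (hf h)) h1
    rw [Diagram.rename_add, Diagram.rename_rename] at h3
    have h4 : C.rename (Function.update id (f b) (f a)) = C := by
      conv_rhs => rw [← Diagram.rename_id C]
      exact Diagram.rename_congr fun c hc => by
        rw [Function.update_of_ne]; rintro rfl; exact h b hc
    have h5 : Function.update id (f b) (f a) ∘ f = f ∘ Function.update id b a := by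
      funext c
      by_cases hc : c = b
      · simp [hc]
      · simp [hc, hf.eq_iff]
    rw [h4, h5] at h3
    rwa [Diagram.rename_rename]

/-- Permutations of an infinite set act transitively on tuples of distinct points. Renaming of wires
requires a permutation, while the maps used below are only injective on the names that occur. -/
theorem exists_perm_extending {s : Finset ℕ} {f : ℕ → ℕ} (hf : Set.InjOn f s) :
    ∃ g : Equiv.Perm ℕ, ∀ a ∈ s, g a = f a := by
  have := Equiv.Perm.isMultiplyPretransitive ℕ s.card
  let e := s.equivFin.symm
  let x : Fin s.card ↪ ℕ := ⟨fun i => e i, fun i j h => e.injective (Subtype.ext h)⟩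
  let y : Fin s.card ↪ ℕ := ⟨fun i => f (e i), fun i j h =>
    e.injective (Subtype.ext (hf (e i).2 (e j).2 h))⟩
  obtain ⟨g, hg⟩ := MulAction.exists_smul_eq (Equiv.Perm ℕ) x y
  refine ⟨g, fun a ha => ?_⟩
  have : g (e (e.symm ⟨a, ha⟩)) = f (e (e.symm ⟨a, ha⟩)) := DFunLike.congr_fun hg _
  simpa using this

/-- The names of the wires of a scalar diagram are immaterial. -/
theorem Eqv.of_rename {A : AddSubgroup Real.Angle} {D : Diagram} (hD : D.IsScalar)
    (hA : D.Valid A) {f : ℕ → ℕ} (hf : Set.InjOn f D.ends.toFinset) :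
    Eqv A D (D.rename f) := by
  obtain ⟨g, hg⟩ := exists_perm_extending hf
  have := Eqv.rename g hA fun a ha => by have := hD a; omega
  rwa [Diagram.rename_congr (g := f) fun a ha => hg a (by simpa using ha)] at this

/-! ### The monoid of scalars -/

theorem IsStabilizerScalar.valid {D : Diagram} (hD : IsStabilizerScalar D) :
    D.Valid stabilizerPhases := ⟨fun a => by have := hD.1 a; omega, hD.2⟩

theorem Eqv.isStabilizerScalar {D E : Diagram} (h : Eqv stabilizerPhases D E)
    (hD : IsStabilizerScalar D) : IsStabilizerScalar E := ⟨h.isScalar hD.1, h.valid.2.2⟩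

theorem IsStabilizerScalar.rename {f : ℕ → ℕ} (hf : Function.Injective f) {D : Diagram}
    (hD : IsStabilizerScalar D) : IsStabilizerScalar (D.rename f) :=
  ⟨Diagram.isScalar_rename hf hD.1, Diagram.phaseIn_rename.2 hD.2⟩

theorem IsStabilizerScalar.zero : IsStabilizerScalar 0 := ⟨fun a => by simp, by simp⟩

/-- Derivable equality of stabilizer scalar diagrams. -/
def scalarSetoid : Setoid {D : Diagram // IsStabilizerScalar D} where
  r D E := Eqv stabilizerPhases D.1 E.1
  iseqv := ⟨fun D => .refl D.2.valid, fun h => h.symm, fun h h' => h.trans h'⟩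

/-- Stabilizer scalar diagrams up to derivable equality. -/
def Scalar : Type := Quotient scalarSetoid

/-- The class of a stabilizer scalar diagram. -/
def Scalar.mk (D : Diagram) (h : IsStabilizerScalar D) : Scalar := Quotient.mk scalarSetoid ⟨D, h⟩

theorem Eqv.par_right {D E F : Diagram} (hF : IsStabilizerScalar F)
    (h : Eqv stabilizerPhases D E) : Eqv stabilizerPhases (D.par F) (E.par F) :=
  h.rename_add two_mul_injective (hF.rename two_mul_add_one_injective).valid fun a => by
    simp only [Diagram.ends_rename, Multiset.mem_map, not_exists, not_and]
    intro b _; omega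

theorem Eqv.par_comm {D E : Diagram} (hD : IsStabilizerScalar D) (hE : IsStabilizerScalar E) :
    Eqv stabilizerPhases (D.par E) (E.par D) := by
  -- Juxtaposition uses even names for the first factor and odd ones for the second; the renaming
  -- exchanges 2n and 2n + 1.
  have h := Eqv.of_rename (hD.par hE).1 (hD.par hE).valid
    (f := fun a => if a % 2 = 0 then a + 1 else a - 1) (fun a _ b _ h => by
      simp only at h; split_ifs at h <;> omega)
  have : (D.par E).rename (fun a => if a % 2 = 0 then a + 1 else a - 1) = E.par D := by
    rw [Diagram.par, Diagram.rename_add, Diagram.rename_rename, Diagram.rename_rename, add_comm]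
    unfold Diagram.par
    congr 1 <;> refine Diagram.rename_congr fun a _ => ?_
    · simp only [Function.comp]; rw [if_neg (by omega)]; omega
    · simp only [Function.comp]; rw [if_pos (by omega)]
  rwa [this] at h

theorem Eqv.par_assoc {D E F : Diagram} (hD : IsStabilizerScalar D) (hE : IsStabilizerScalar E)
    (hF : IsStabilizerScalar F) :
    Eqv stabilizerPhases ((D.par E).par F) (D.par (E.par F)) := by
  -- On the left the names from the three factors are 4n, 4n + 2 and 2n + 1, on the right 2n, 4n + 1
  -- and 4n + 3.
  have h := Eqv.of_rename ((hD.par hE).par hF).1 ((hD.par hE).par hF).valid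
    (f := fun a => if a % 4 = 0 then a / 2 else if a % 4 = 2 then a - 1 else 2 * a + 1)
    (fun a _ b _ h => by simp only at h; split_ifs at h <;> omega)
  have : ((D.par E).par F).rename (fun a => if a % 4 = 0 then a / 2 else
      if a % 4 = 2 then a - 1 else 2 * a + 1) = D.par (E.par F) := by
    simp only [Diagram.par, Diagram.rename_add, Diagram.rename_rename, add_assoc]
    congr 1
    · refine Diagram.rename_congr fun a _ => ?_
      simp only [Function.comp]; rw [if_pos (by omega)]; omega
    · congr 1 <;> refine Diagram.rename_congr fun a _ => ?_
      · simp only [Function.comp]; rw [if_neg (by omega), if_pos (by omega)]; omega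
      · simp only [Function.comp]; rw [if_neg (by omega), if_neg (by omega)]
  rwa [this] at h

theorem Eqv.par_zero {D : Diagram} (hD : IsStabilizerScalar D) :
    Eqv stabilizerPhases (D.par 0) D := by
  have h := Eqv.of_rename hD.1 hD.valid (f := fun a => 2 * a) two_mul_injective.injOn
  simpa [Diagram.par] using h.symm

/-- Compatibility of the product with derivability is known for the left factor; commutativity
transfers it to the right factor. -/
instance : CommMonoid Scalar where
  mul := Quotient.map₂ (fun D E => ⟨D.1.par E.1, D.2.par E.2⟩) fun D D' h E E' h' =>
    (Eqv.par_right E.2 h).trans ((Eqv.par_comm D'.2 E.2).trans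
      ((Eqv.par_right D'.2 h').trans (Eqv.par_comm E'.2 D'.2)))
  one := Quotient.mk _ ⟨0, IsStabilizerScalar.zero⟩
  mul_assoc := by
    rintro ⟨D⟩ ⟨E⟩ ⟨F⟩
    exact Quotient.sound (Eqv.par_assoc D.2 E.2 F.2)
  one_mul := by
    rintro ⟨D⟩
    exact Quotient.sound ((Eqv.par_comm IsStabilizerScalar.zero D.2).trans (Eqv.par_zero D.2))
  mul_one := by
    rintro ⟨D⟩
    exact Quotient.sound (Eqv.par_zero D.2)
  mul_comm := by
    rintro ⟨D⟩ ⟨E⟩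
    exact Quotient.sound (Eqv.par_comm D.2 E.2)

open Classical in
/-- The class of a stabilizer scalar diagram (`1` for other diagrams). -/
def cl (D : Diagram) : Scalar :=
  if h : IsStabilizerScalar D then Scalar.mk D h else 1

theorem cl_eq_iff {D E : Diagram} (hD : IsStabilizerScalar D) (hE : IsStabilizerScalar E) :
    cl D = cl E ↔ Eqv stabilizerPhases D E := by
  rw [cl, cl, dif_pos hD, dif_pos hE]
  exact ⟨fun h => Quotient.exact h, fun h => Quotient.sound h⟩

theorem cl_eq_of_eqv {D E : Diagram} (h : Eqv stabilizerPhases D E) : cl D = cl E := by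
  by_cases hD : IsStabilizerScalar D
  · exact (cl_eq_iff hD (h.isStabilizerScalar hD)).2 h
  · have hE : ¬ IsStabilizerScalar E := fun hE => hD (h.symm.isStabilizerScalar hE)
    rw [cl, cl, dif_neg hD, dif_neg hE]

theorem cl_par {D E : Diagram} (hD : IsStabilizerScalar D) (hE : IsStabilizerScalar E) :
    cl (D.par E) = cl D * cl E := by
  rw [cl, cl, cl, dif_pos hD, dif_pos hE, dif_pos (hD.par hE)]
  rfl

theorem cl_zero : cl 0 = 1 := by
  rw [cl, dif_pos IsStabilizerScalar.zero]
  rfl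

theorem IsStabilizerScalar.add {D E : Diagram} (hD : IsStabilizerScalar D)
    (hE : IsStabilizerScalar E) (h : ∀ a ∈ D.ends, a ∉ E.ends) : IsStabilizerScalar (D + E) :=
  ⟨hD.1.add hE.1 h, fun v hv => (Multiset.mem_add.1 hv).elim (hD.2 v) (hE.2 v)⟩

theorem cl_add {D E : Diagram} (hD : IsStabilizerScalar D) (hE : IsStabilizerScalar E)
    (h : ∀ a ∈ D.ends, a ∉ E.ends) : cl (D + E) = cl D * cl E := by
  rw [← cl_par hD hE, cl_eq_iff (hD.add hE h) (hD.par hE)]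
  -- With disjoint names, doubling the names of `D` and sending all others to odd numbers turns the
  -- plain union into the juxtaposition.
  have h1 := Eqv.of_rename (hD.add hE h).1 (hD.add hE h).valid
    (f := fun a => if a ∈ D.ends then 2 * a else 2 * a + 1)
    (fun a _ b _ h => by simp only at h; split_ifs at h <;> omega)
  rw [Diagram.rename_add] at h1
  unfold Diagram.par
  convert h1 using 2
  · exact Diagram.rename_congr fun a ha => by rw [if_pos ha]
  · exact Diagram.rename_congr fun a ha => by rw [if_neg fun h' => h a h' ha]

theorem cl_rename {D : Diagram} {f : ℕ → ℕ} (hD : IsStabilizerScalar D)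
    (hf : Set.InjOn f D.ends.toFinset) : cl (D.rename f) = cl D :=
  (cl_eq_of_eqv (Eqv.of_rename hD.1 hD.valid hf)).symm


/-! ### Spiders with phases in quarter turns -/

theorem quarter_add (k l : ℤ) : quarter (k + l) = quarter k + quarter l := by
  simp only [quarter, ← Real.Angle.coe_add]; congr 1; push_cast; ring
@[simp] theorem quarter_zero : quarter 0 = 0 := by simp [quarter]
theorem quarter_neg (k : ℤ) : quarter (-k) = -quarter k := by
  simp only [quarter, ← Real.Angle.coe_neg]; congr 1; push_cast; ring
theorem quarter_one : quarter 1 = ((Real.pi / 2 : ℝ) : Real.Angle) := by simp [quarter]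
theorem quarter_two : quarter 2 = (Real.pi : Real.Angle) := by
  simp only [quarter]; congr 1; push_cast; ring
theorem quarter_neg_one : quarter (-1) = ((-(Real.pi / 2) : ℝ) : Real.Angle) := by
  simp [quarter]
theorem quarter_four_mul (k : ℤ) : quarter (4 * k) = 0 := by
  have : ((4 * k : ℤ) * (Real.pi / 2) : ℝ) = k • (2 * Real.pi) := by
    push_cast; rw [zsmul_eq_mul]; ring
  rw [quarter, this, Real.Angle.coe_zsmul, Real.Angle.coe_two_pi, smul_zero]
theorem quarter_emod (k : ℤ) : quarter (k % 4) = quarter k := by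
  conv_rhs => rw [← Int.emod_add_mul_ediv k 4, quarter_add, quarter_four_mul, add_zero]
theorem quarter_mem (k : ℤ) : quarter k ∈ stabilizerPhases :=
  ⟨k, by simp only [quarter]; rw [← Real.Angle.coe_zsmul, zsmul_eq_mul]⟩

/-- A green spider of phase `k · π/2`. -/
def g (k : ℤ) (S : Multiset ℕ) : Node := green (quarter k) S
/-- A red spider of phase `k · π/2`. -/
def r (k : ℤ) (S : Multiset ℕ) : Node := red (quarter k) S

theorem g_emod (k : ℤ) (S : Multiset ℕ) : g (k % 4) S = g k S := by rw [g, g, quarter_emod]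
theorem r_emod (k : ℤ) (S : Multiset ℕ) : r (k % 4) S = r k S := by rw [r, r, quarter_emod]

@[simp] theorem g_ends (k : ℤ) (S : Multiset ℕ) : (g k S).ends = S := rfl
@[simp] theorem r_ends (k : ℤ) (S : Multiset ℕ) : (r k S).ends = S := rfl
@[simp] theorem had_ends (a b : ℕ) : (had a b).ends = {a, b} := rfl
@[simp] theorem wire_ends (a b : ℕ) : (wire a b).ends = {a, b} := rfl
@[simp] theorem star_ends : star.ends = 0 := rfl
@[simp] theorem g_phaseIn (k : ℤ) (S : Multiset ℕ) : (g k S).PhaseIn stabilizerPhases :=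
  quarter_mem k
@[simp] theorem r_phaseIn (k : ℤ) (S : Multiset ℕ) : (r k S).PhaseIn stabilizerPhases :=
  quarter_mem k
@[simp] theorem had_phaseIn (a b : ℕ) : (had a b).PhaseIn stabilizerPhases := trivial
@[simp] theorem wire_phaseIn (a b : ℕ) : (wire a b).PhaseIn stabilizerPhases := trivial
@[simp] theorem star_phaseIn : star.PhaseIn stabilizerPhases := trivial
@[simp] theorem g_swapColour (k : ℤ) (S : Multiset ℕ) : (g k S).swapColour = r k S := rfl
@[simp] theorem r_swapColour (k : ℤ) (S : Multiset ℕ) : (r k S).swapColour = g k S := rfl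
@[simp] theorem wire_swapColour (a b : ℕ) : (wire a b).swapColour = wire a b := rfl
@[simp] theorem had_swapColour (a b : ℕ) : (had a b).swapColour = had a b := rfl

theorem exists_fresh (S : Multiset ℕ) : ∃ N, ∀ n, N ≤ n → S.count n = 0 := by
  refine ⟨S.sum + 1, fun n hn => Multiset.count_eq_zero_of_notMem fun h => ?_⟩
  have := Multiset.single_le_sum (fun _ _ => Nat.zero_le _) n h
  omega

/-- All phases are multiples of `π/2`. -/
def Phases (D : Diagram) : Prop := ∀ v ∈ D, v.PhaseIn stabilizerPhases

theorem phases_cons (v : Node) (D : Diagram) :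
    Phases (v ::ₘ D) ↔ v.PhaseIn stabilizerPhases ∧ Phases D := by simp [Phases]
theorem phases_add (D E : Diagram) : Phases (D + E) ↔ Phases D ∧ Phases E := by
  simp [Phases, or_imp, forall_and]
theorem phases_singleton (v : Node) : Phases {v} ↔ v.PhaseIn stabilizerPhases := by simp [Phases]
theorem phases_zero : Phases 0 ↔ True := by simp [Phases]

/-- Rules that reduce the closedness of an explicit diagram to counting wire ends. -/
theorem closed_simps :
    (∀ D : Diagram, IsStabilizerScalar D ↔
      (∀ a, D.ends.count a = 0 ∨ D.ends.count a = 2) ∧ Phases D) ∧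
    (∀ (v : Node) (D : Diagram),
      Phases (v ::ₘ D) ↔ v.PhaseIn stabilizerPhases ∧ Phases D) ∧
    (∀ D E : Diagram, Phases (D + E) ↔ Phases D ∧ Phases E) ∧
    (∀ v : Node, Phases {v} ↔ v.PhaseIn stabilizerPhases) ∧ (Phases 0 ↔ True) ∧
    (∀ (k : ℤ) (S : Multiset ℕ), (g k S).PhaseIn stabilizerPhases ↔ True) ∧
    (∀ (k : ℤ) (S : Multiset ℕ), (r k S).PhaseIn stabilizerPhases ↔ True) ∧
    (∀ a b, (had a b).PhaseIn stabilizerPhases ↔ True) ∧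
    (∀ a b, (wire a b).PhaseIn stabilizerPhases ↔ True) ∧
    (star.PhaseIn stabilizerPhases ↔ True) ∧
    (∀ (v : Node) (D : Diagram), Diagram.ends (v ::ₘ D) = v.ends + D.ends) ∧
    (∀ D E : Diagram, Diagram.ends (D + E) = D.ends + E.ends) ∧
    (∀ v : Node, Diagram.ends {v} = v.ends) ∧ Diagram.ends 0 = 0 ∧
    (∀ (k : ℤ) (S : Multiset ℕ), (g k S).ends = S) ∧
    (∀ (k : ℤ) (S : Multiset ℕ), (r k S).ends = S) ∧
    (∀ a b, (had a b).ends = a ::ₘ {b}) ∧ (∀ a b, (wire a b).ends = a ::ₘ {b}) ∧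
    star.ends = 0 ∧
    (∀ (v : Node) (D : Diagram), insert v D = v ::ₘ D) ∧
    (∀ (a : ℕ) (S : Multiset ℕ), insert a S = a ::ₘ S) ∧
    (∀ (a : ℕ) (S T : Multiset ℕ), (S + T).count a = S.count a + T.count a) ∧
    (∀ (a b : ℕ) (S : Multiset ℕ),
      (b ::ₘ S).count a = S.count a + if a = b then 1 else 0) ∧
    (∀ a b : ℕ, ({b} : Multiset ℕ).count a = if a = b then 1 else 0) ∧
    (∀ a : ℕ, (0 : Multiset ℕ).count a = 0) ∧
    (∀ p : Prop, True ∧ p ↔ p) ∧ ∀ p : Prop, p ∧ True ↔ p := by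
  simp only [Multiset.count_add, Multiset.count_cons, Multiset.count_singleton,
    Multiset.count_zero, Diagram.ends_cons, Diagram.ends_add, Diagram.ends_singleton,
    Diagram.ends_zero, Multiset.insert_eq_cons, phases_cons, phases_add, phases_singleton,
    phases_zero, g_phaseIn, r_phaseIn, had_phaseIn, wire_phaseIn, star_phaseIn, g_ends, r_ends,
    had_ends, wire_ends, star_ends, true_and, and_true, implies_true, iff_self]
  exact fun D => Iff.rfl

theorem cl_rule {L R : Diagram} (hr : Rule L R) (C : Diagram) (h1 : IsStabilizerScalar (L + C))
    (h2 : IsStabilizerScalar (R + C)) : cl (L + C) = cl (R + C) :=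
  cl_eq_of_eqv (.rule C hr h1.valid h2.valid)

/-- A rule balanced by closed factors `c` and `d` becomes an identity in the monoid, with these
factors split off. -/
theorem cl_rule_scalar {c d L R C : Diagram} (hr : Rule (c + L) (d + R))
    (hc : IsStabilizerScalar c) (hd : IsStabilizerScalar d)
    (h1 : IsStabilizerScalar (L + C)) (h2 : IsStabilizerScalar (R + C))
    (hcL : ∀ a ∈ c.ends, a ∉ (L + C).ends) (hdR : ∀ a ∈ d.ends, a ∉ (R + C).ends) :
    cl c * cl (L + C) = cl d * cl (R + C) := by
  rw [← cl_add hc h1 hcL, ← cl_add hd h2 hdR, ← add_assoc, ← add_assoc]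
  refine cl_rule hr C ?_ ?_
  · rw [add_assoc]; exact hc.add h1 hcL
  · rw [add_assoc]; exact hd.add h2 hdR

/-- Equality of multisets up to the order of the elements. -/
theorem eq_of_perm {α : Type} {D E : Multiset α} (h : D = E := by
    simp only [Multiset.insert_eq_cons, ← Multiset.singleton_add, add_zero, zero_add, Diagram]
    first | done | ac_rfl) : D = E := h

/-- An explicit diagram is closed. -/
theorem closed_of_count {D : Diagram} (h : IsStabilizerScalar D := by
    simp only [closed_simps]
    intros
    first | done | grind) : IsStabilizerScalar D := h

/-- The class of the diagram `⟨aπ/2|bπ/2⟩`. -/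
def ip (a b : ℤ) : Scalar := cl {g a {0}, r b {0}}

theorem closed_ip (i : ℕ) (a b : ℤ) : IsStabilizerScalar {g a {i}, r b {i}} := by
  simp only [closed_simps]
  intro n; grind

theorem cl_ip (i : ℕ) (a b : ℤ) : cl {g a {i}, r b {i}} = ip a b := by
  have := cl_rename (f := fun _ => i) (closed_ip 0 a b) (by simp)
  rw [ip, ← this]
  simp [Diagram.rename, Node.rename, g, r]


/-! ### The rules for spiders with phases in quarter turns -/

theorem Rule.g_fuse (k l : ℤ) (e : ℕ) (S T : Multiset ℕ) :
    Rule {g k (e ::ₘ S), g l (e ::ₘ T)} {g (k + l) (S + T)} := by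
  simpa [g, quarter_add] using Rule.spider (quarter k) (quarter l) e S T
theorem Rule.r_fuse (k l : ℤ) (e : ℕ) (S T : Multiset ℕ) :
    Rule {r k (e ::ₘ S), r l (e ::ₘ T)} {r (k + l) (S + T)} := by
  simpa [Multiset.insert_eq_cons] using (Rule.g_fuse k l e S T).swap
theorem Rule.g_loop (k : ℤ) (e : ℕ) (S : Multiset ℕ) :
    Rule {g k (e ::ₘ e ::ₘ S)} {g k S} := Rule.loop (quarter k) e S
theorem Rule.g_wire (a b : ℕ) : Rule {g 0 {a, b}} {wire a b} := by
  simpa [g] using Rule.cup a b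
theorem Rule.r_wire (a b : ℕ) : Rule {r 0 {a, b}} {wire a b} := by
  simpa using (Rule.g_wire a b).swap
theorem Rule.g_bialgebra (i a b c d p q x y e : ℕ) :
    Rule ({g 0 {i}, r 0 {i}} +
        {g 0 {a, p, q}, g 0 {b, x, y}, r 0 {p, x, c}, r 0 {q, y, d}})
      (0 + {r 0 {a, b, e}, g 0 {e, c, d}}) := by
  simpa [g, r, Diagram.innerprod] using Rule.bialgebra i a b c d p q x y e
theorem Rule.g_copy (i e a b : ℕ) :
    Rule ({g 0 {i}, r 0 {i}} + {r 0 {e}, g 0 {e, a, b}}) (0 + {r 0 {a}, r 0 {b}}) := by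
  simpa [g, r, Diagram.innerprod] using Rule.copy i e a b
theorem Rule.g_pi (a e : ℕ) (P : Multiset (ℕ × ℕ)) :
    Rule {g 2 {a, e}, r 0 (e ::ₘ P.map Prod.fst)}
      (r 0 (a ::ₘ P.map Prod.snd) ::ₘ P.map fun p => g 2 {p.2, p.1}) := by
  simpa [g, r, quarter_two] using Rule.piCopy a e P
theorem Rule.r_pi (a e : ℕ) (P : Multiset (ℕ × ℕ)) :
    Rule {r 2 {a, e}, g 0 (e ::ₘ P.map Prod.fst)}
      (g 0 (a ::ₘ P.map Prod.snd) ::ₘ P.map fun p => r 2 {p.2, p.1}) := by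
  simpa [Diagram.swapColour, Multiset.map_map, Function.comp_def] using (Rule.g_pi a e P).swap
theorem Rule.g_commute (k : ℤ) (i j a b e f : ℕ) :
    Rule ({g 0 {i}, r 0 {i}} + {g 2 {a, e}, r k {e, b}})
      ({g 2 {j}, r k {j}} + {r (-k) {a, f}, g 2 {f, b}}) := by
  simpa [g, r, quarter_two, quarter_neg, Diagram.innerprod] using
    Rule.piCommutation (quarter k) i j a b e f
theorem Rule.r_colour (k : ℤ) (P : Multiset (ℕ × ℕ)) :
    Rule {r k (P.map Prod.fst)} (g k (P.map Prod.snd) ::ₘ P.map fun p => had p.1 p.2) :=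
  Rule.colour (quarter k) P
theorem Rule.g_colour (k : ℤ) (P : Multiset (ℕ × ℕ)) :
    Rule {g k (P.map Prod.fst)} (r k (P.map Prod.snd) ::ₘ P.map fun p => had p.1 p.2) := by
  simpa [Diagram.swapColour, Multiset.map_map, Function.comp_def] using
    (Rule.r_colour k P).swap
theorem Rule.had_euler (i j k a b e f : ℕ) :
    Rule (({g 0 {i}, r 0 {i}} + {g 0 {j}, r 0 {j}}) + {had a b})
      ({g (-1) {k}, r (-1) {k}} + {g 1 {a, e}, r 1 {e, f}, g 1 {f, b}}) := by
  simpa [g, r, quarter_one, quarter_neg_one, Diagram.innerprod] using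
    Rule.euler i j k a b e f

/-! ### Rewriting of closed diagrams up to a group of scalars -/

/-- If `L` is a stabilizer scalar diagram then so is `R`, and they are equal up to a scalar
in `W`. -/
def Rw (W : Subgroup Scalarˣ) (L R : Diagram) : Prop :=
  IsStabilizerScalar L → IsStabilizerScalar R ∧ ∃ u ∈ W, cl L = u * cl R

variable {W : Subgroup Scalarˣ}

theorem Rw.refl (D : Diagram) : Rw W D D := fun h => ⟨h, 1, W.one_mem, by simp⟩

theorem Rw.trans {D E F : Diagram} (h1 : Rw W D E) (h2 : Rw W E F) : Rw W D F := fun h => by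
  obtain ⟨hE, u, hu, e1⟩ := h1 h
  obtain ⟨hF, v, hv, e2⟩ := h2 hE
  exact ⟨hF, u * v, W.mul_mem hu hv, by rw [e1, e2, Units.val_mul, mul_assoc]⟩

/-- The scalar is inverted in `W`. Closedness has to be supplied, since a rewrite read backwards may
introduce wire names that already occur elsewhere. -/
theorem Rw.symm {D E : Diagram} (h : Rw W D E) (hD : IsStabilizerScalar E → IsStabilizerScalar D) :
    Rw W E D := fun hE => by
  obtain ⟨-, u, hu, e⟩ := h (hD hE)
  exact ⟨hD hE, u⁻¹, W.inv_mem hu, by rw [e, Units.inv_mul_cancel_left]⟩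

theorem Rw.step {D E L R : Diagram} (h : Rw W L R) (h1 : D = L) (h2 : R = E) : Rw W D E := by
  subst h1 h2; exact h

/-- Makes closedness of the source available when the freshness conditions of the rewrite are to be
checked. -/
theorem Rw.of_closed {L R : Diagram} (h : IsStabilizerScalar L → Rw W L R) : Rw W L R :=
  fun hL => h hL hL

theorem Rw.of_rule {L R C : Diagram} (hr : Rule L R)
    (h : IsStabilizerScalar (L + C) → IsStabilizerScalar (R + C)) : Rw W (L + C) (R + C) :=
  fun hL => ⟨h hL, 1, W.one_mem, by rw [cl_rule hr C hL (h hL), Units.val_one, one_mul]⟩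

theorem Rw.cl_eq {D E : Diagram} (h : Rw ⊥ D E) (hD : IsStabilizerScalar D) : cl D = cl E := by
  obtain ⟨-, u, hu, e⟩ := h hD
  rw [Subgroup.mem_bot.1 hu] at e
  simpa using e

theorem Rw.g_fuse (k l : ℤ) (e : ℕ) (S T : Multiset ℕ) (C : Diagram) :
    Rw W (g k (e ::ₘ S) ::ₘ g l (e ::ₘ T) ::ₘ C) (g (k + l) (S + T) ::ₘ C) := by
  refine (Rw.of_rule (C := C) (Rule.g_fuse k l e S T) fun h => ?_).step eq_of_perm eq_of_perm
  simp only [closed_simps] at h ⊢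
  refine ⟨fun n => ?_, h.2⟩
  grind

theorem Rw.r_fuse (k l : ℤ) (e : ℕ) (S T : Multiset ℕ) (C : Diagram) :
    Rw W (r k (e ::ₘ S) ::ₘ r l (e ::ₘ T) ::ₘ C) (r (k + l) (S + T) ::ₘ C) := by
  refine (Rw.of_rule (C := C) (Rule.r_fuse k l e S T) fun h => ?_).step eq_of_perm eq_of_perm
  simp only [closed_simps] at h ⊢
  refine ⟨fun n => ?_, h.2⟩
  grind

theorem Rw.g_split (k l : ℤ) (e : ℕ) (S T : Multiset ℕ) (C : Diagram)
    (he : (S + T + C.ends).count e = 0) :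
    Rw W (g (k + l) (S + T) ::ₘ C) (g k (e ::ₘ S) ::ₘ g l (e ::ₘ T) ::ₘ C) := by
  refine (Rw.g_fuse k l e S T C).symm fun h => ?_
  simp only [closed_simps] at h he ⊢
  refine ⟨fun n => ?_, h.2⟩
  grind

theorem Rw.r_split (k l : ℤ) (e : ℕ) (S T : Multiset ℕ) (C : Diagram)
    (he : (S + T + C.ends).count e = 0) :
    Rw W (r (k + l) (S + T) ::ₘ C) (r k (e ::ₘ S) ::ₘ r l (e ::ₘ T) ::ₘ C) := by
  refine (Rw.r_fuse k l e S T C).symm fun h => ?_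
  simp only [closed_simps] at h he ⊢
  refine ⟨fun n => ?_, h.2⟩
  grind

theorem Rw.g_loop (k : ℤ) (e : ℕ) (S : Multiset ℕ) (C : Diagram) :
    Rw W (g k (e ::ₘ e ::ₘ S) ::ₘ C) (g k S ::ₘ C) := by
  refine (Rw.of_rule (C := C) (Rule.g_loop k e S) fun h => ?_).step eq_of_perm eq_of_perm
  simp only [closed_simps] at h ⊢
  refine ⟨fun n => ?_, h.2⟩
  grind

/-- A two-legged spider without phase may change its colour. -/
theorem Rw.g_to_r (a b : ℕ) (C : Diagram) : Rw W (g 0 {a, b} ::ₘ C) (r 0 {a, b} ::ₘ C) := by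
  refine ((Rw.of_rule (C := C) (Rule.g_wire a b) fun h => ?_).step eq_of_perm rfl).trans
    (((Rw.of_rule (C := C) (Rule.r_wire a b) fun h => ?_).symm fun h => ?_).step rfl eq_of_perm)
  all_goals
    simp only [closed_simps] at h ⊢
    exact h

theorem Rw.r_to_g (a b : ℕ) (C : Diagram) : Rw W (r 0 {a, b} ::ₘ C) (g 0 {a, b} ::ₘ C) := by
  refine (Rw.g_to_r a b C).symm fun h => ?_
  simp only [closed_simps] at h ⊢
  exact h

theorem Rw.had_symm (a b : ℕ) (C : Diagram) : Rw W (had a b ::ₘ C) (had b a ::ₘ C) := by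
  refine (Rw.of_rule (C := C) (Rule.hadSymm a b) fun h => ?_).step eq_of_perm eq_of_perm
  simp only [closed_simps] at h ⊢
  refine ⟨fun n => ?_, h.2⟩
  grind

/-- The π-copy rule at a one-legged red spider: there are no other legs on which π could reappear.
-/
theorem Rw.g_pi_absorb (a e : ℕ) (C : Diagram) :
    Rw W (g 2 {a, e} ::ₘ r 0 {e} ::ₘ C) (r 0 {a} ::ₘ C) := by
  refine (Rw.of_rule (C := C) (Rule.g_pi a e 0) fun h => ?_).step eq_of_perm eq_of_perm
  simp only [closed_simps, Multiset.map_zero] at h ⊢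
  refine ⟨fun n => ?_, h.2⟩
  grind

theorem Rw.r_colour_one (k : ℤ) (a b : ℕ) (C : Diagram) (hb : (a ::ₘ C.ends).count b = 0) :
    Rw W (r k {a} ::ₘ C) (g k {b} ::ₘ had a b ::ₘ C) := by
  refine (Rw.of_rule (C := C) (Rule.r_colour k {(a, b)}) fun h => ?_).step eq_of_perm eq_of_perm
  simp only [closed_simps, Multiset.map_singleton] at h hb ⊢
  refine ⟨fun n => ?_, h.2⟩
  grind

theorem Rw.r_uncolour_one (k : ℤ) (a b : ℕ) (C : Diagram) :
    Rw W (g k {b} ::ₘ had a b ::ₘ C) (r k {a} ::ₘ C) := by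
  refine Rw.of_closed fun h => (Rw.r_colour_one k a b C ?_).symm fun _ => ?_
  · simp only [closed_simps] at h ⊢
    grind
  · simp only [closed_simps] at h ⊢
    refine ⟨fun n => ?_, h.2⟩
    grind

theorem Rw.g_uncolour_one (k : ℤ) (a b : ℕ) (C : Diagram) :
    Rw W (r k {b} ::ₘ had a b ::ₘ C) (g k {a} ::ₘ C) := by
  refine Rw.of_closed fun h => ((Rw.of_rule (C := C) (Rule.g_colour k {(a, b)})
    fun _ => ?_).symm fun _ => ?_).step eq_of_perm eq_of_perm <;>
  · simp only [closed_simps, Multiset.map_singleton] at h ⊢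
    refine ⟨fun n => ?_, h.2⟩
    grind


/-! ### Derivable equations between scalars -/

/-- The wires of the balancing scalars are given a name beyond all names in use, after which the
scalars split off. -/
theorem cl_rule_ip {k l : ℤ} {L R : Diagram} (C : Diagram)
    (hr : ∀ i j, Rule ({g 0 {i}, r 0 {i}} + L) ({g k {j}, r l {j}} + R))
    (h1 : IsStabilizerScalar (L + C)) (h2 : IsStabilizerScalar (R + C)) :
    ip 0 0 * cl (L + C) = ip k l * cl (R + C) := by
  obtain ⟨N, hN⟩ := exists_fresh ((L + C).ends + (R + C).ends)
  have h := hN N le_rfl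
  rw [Multiset.count_add] at h
  rw [← cl_ip N, ← cl_ip N]
  refine cl_rule_scalar (hr N N) (closed_ip _ _ _) (closed_ip _ _ _) h1 h2 ?_ ?_ <;>
  · intro a ha
    simp only [closed_simps, Multiset.mem_add, Multiset.mem_singleton, or_self] at ha
    subst ha
    rw [← Multiset.count_eq_zero]
    omega

theorem cl_rule_ip_left {L R : Diagram} (C : Diagram)
    (hr : ∀ i, Rule ({g 0 {i}, r 0 {i}} + L) (0 + R))
    (h1 : IsStabilizerScalar (L + C)) (h2 : IsStabilizerScalar (R + C)) :
    ip 0 0 * cl (L + C) = cl (R + C) := by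
  obtain ⟨N, hN⟩ := exists_fresh ((L + C).ends)
  have h := hN N le_rfl
  rw [← cl_ip N, ← one_mul (cl (R + C)), ← cl_zero]
  refine cl_rule_scalar (hr N) (closed_ip _ _ _) IsStabilizerScalar.zero h1 h2 ?_ ?_
  · intro a ha
    simp only [closed_simps, Multiset.mem_add, Multiset.mem_singleton, or_self] at ha
    subst ha
    rwa [← Multiset.count_eq_zero]
  · simp

theorem cl_red_empty (k : ℤ) : cl {r k 0} = cl {g k 0} := by
  refine (((Rw.of_rule (C := 0) (Rule.r_colour k 0) fun _ => ?_).step eq_of_perm eq_of_perm :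
    Rw ⊥ _ _)).cl_eq closed_of_count
  simpa using (by exact closed_of_count : IsStabilizerScalar {g k 0})

/-- The copy rule with its two dangling legs joined to each other. On the left the green spider has
a loop and the rest is ⟨0|0⟩; on the right the two red nodes fuse to a legless spider, whose colour
is immaterial. -/
theorem ip_zero_mul_self : ip 0 0 * ip 0 0 = cl {g 0 0} := by
  have h := cl_rule_ip_left 0 (fun i => Rule.g_copy i 1 2 2) closed_of_count closed_of_count
  have h1 : cl ({r 0 {1}, g 0 {1, 2, 2}} + 0) = ip 0 0 := by
    rw [← cl_ip 1]
    exact (((Rw.g_loop 0 2 {1} {r 0 {1}}).step eq_of_perm eq_of_perm : Rw ⊥ _ _)).cl_eq closed_of_count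
  have h2 : cl ({r 0 {2}, r 0 {2}} + 0) = cl {r 0 0} :=
    (((Rw.r_fuse 0 0 2 0 0 0).step eq_of_perm eq_of_perm : Rw ⊥ _ _)).cl_eq closed_of_count
  rw [h1, h2, cl_red_empty] at h
  exact h

theorem cl_star_mul : cl {star} * cl {g 0 0} = 1 := by
  rw [← cl_add (E := {g 0 0}) closed_of_count closed_of_count (by simp), ← cl_zero]
  have h1 : IsStabilizerScalar ({star, g 0 0} + 0) := closed_of_count
  rw [g, quarter_zero] at h1 ⊢
  exact cl_rule Rule.starRule 0 h1 IsStabilizerScalar.zero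

/-- The class of `⟨0|0⟩`, which represents `√2`. -/
def tU : Scalarˣ where
  val := ip 0 0
  inv := cl {star} * ip 0 0
  val_inv := by rw [mul_left_comm, ip_zero_mul_self, cl_star_mul]
  inv_val := by rw [mul_assoc, ip_zero_mul_self, cl_star_mul]

theorem tU_val : (tU : Scalar) = ip 0 0 := rfl

theorem cl_star : cl {star} = ↑(tU⁻¹ * tU⁻¹) := by
  rw [← Units.mul_left_inj (tU * tU), ← Units.val_mul (tU⁻¹ * tU⁻¹), Units.val_mul tU,
    tU_val, ip_zero_mul_self, cl_star_mul]
  simp [mul_mul_mul_comm]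

/-- The colour rule at the red node puts a Hadamard node on the wire, and the colour rule at the
green node takes it away again. -/
theorem ip_comm (a b : ℤ) : ip a b = ip b a := by
  have h : Rw ⊥ {g a {0}, r b {0}} {g b {1}, r a {1}} := by
    refine ((Rw.r_colour_one b 0 1 {g a {0}} ?_).step eq_of_perm rfl).trans ?_
    · simp
    refine ((Rw.had_symm 0 1 {g a {0}, g b {1}}).step eq_of_perm rfl).trans ?_
    exact (Rw.r_uncolour_one a 1 0 {g b {1}}).step eq_of_perm eq_of_perm
  rw [← cl_ip 0, ← cl_ip 1 b, h.cl_eq (closed_ip _ _ _)]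

/-- A red node absorbs a green node on a wire. -/
theorem cl_absorb (k : ℤ) (a b : ℕ) (C : Diagram)
    (h : IsStabilizerScalar (g k {a, b} ::ₘ r 0 {b} ::ₘ C)) :
    ip 0 0 * cl (g k {a, b} ::ₘ r 0 {b} ::ₘ C) = ip k 0 * cl (r 0 {a} ::ₘ C) := by
  obtain ⟨N, hN⟩ := exists_fresh ({a, b} + C.ends)
  have hf := hN N le_rfl
  -- The phase is split off onto a fresh third leg, so that the red node can be copied; the copy
  -- arriving at that leg forms the scalar ⟨kπ/2|0⟩.
  have h0 : Rw ⊥ (g k {a, b} ::ₘ r 0 {b} ::ₘ C)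
      ({r 0 {b}, g 0 {b, a, N}} + g k {N} ::ₘ C) := by
    refine (Rw.g_split 0 k N {a, b} 0 (r 0 {b} ::ₘ C) ?_).step (by rw [zero_add, add_zero]) eq_of_perm
    simp only [closed_simps] at hf ⊢
    grind
  have h1 := h0 h
  have h3 : IsStabilizerScalar (r 0 {a} ::ₘ C) := by
    simp only [closed_simps] at h ⊢
    refine ⟨fun n => ?_, h.2⟩
    have := h.1 n
    grind
  have h2 := cl_rule_ip_left (g k {N} ::ₘ C) (fun i => Rule.g_copy i b a N) h1.1 (by
    simp only [closed_simps] at h hf ⊢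
    refine ⟨fun n => ?_, h.2⟩
    have := h.1 n
    grind)
  rw [h0.cl_eq h, h2, ← cl_ip N, ← cl_add (closed_ip _ _ _) h3]
  · congr 1
    exact eq_of_perm
  · intro n hn
    simp only [closed_simps, Multiset.mem_add, Multiset.mem_singleton, or_self] at hn
    subst hn
    rw [← Multiset.count_eq_zero]
    simp only [closed_simps] at hf ⊢
    omega

theorem cl_commute (k : ℤ) (a b e f : ℕ) (C : Diagram)
    (h : IsStabilizerScalar (g 2 {a, e} ::ₘ r k {e, b} ::ₘ C))
    (hf : ({a, b} + C.ends).count f = 0) :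
    ip 0 0 * cl (g 2 {a, e} ::ₘ r k {e, b} ::ₘ C) =
      ip 2 k * cl (r (-k) {a, f} ::ₘ g 2 {f, b} ::ₘ C) := by
  have := cl_rule_ip C (fun i j => Rule.g_commute k i j a b e f) (L := {g 2 {a, e}, r k {e, b}})
    (by convert h using 1; exact eq_of_perm) (by
    simp only [closed_simps] at h hf ⊢
    refine ⟨fun n => ?_, h.2⟩
    have := h.1 n
    grind)
  convert this using 3 <;> exact eq_of_perm

/-- Moving a green `π` through a red spider. -/
theorem ip_add_two (b k : ℤ) : ip 0 0 * ip (b + 2) k = ip 2 k * ip b (-k) := by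
  -- On a wire from the green node `b` to a phase-free red node, π stands first next to `b`, where
  -- it fuses; after the commutation it stands next to the red end, which absorbs it.
  have h := cl_commute k 0 1 2 3 {g b {0}, r 0 {1}} closed_of_count (by simp)
  have h1 : Rw ⊥ (g 2 {0, 2} ::ₘ r k {2, 1} ::ₘ {g b {0}, r 0 {1}}) {g (b + 2) {2}, r k {2}} :=
    ((Rw.g_fuse b 2 0 0 {2} {r k {2, 1}, r 0 {1}}).step eq_of_perm rfl).trans
      ((Rw.r_fuse k 0 1 {2} 0 {g (b + 2) {2}}).step eq_of_perm eq_of_perm)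
  have h2 : Rw ⊥ (r (-k) {0, 3} ::ₘ g 2 {3, 1} ::ₘ {g b {0}, r 0 {1}}) {g b {0}, r (-k) {0}} :=
    ((Rw.g_pi_absorb 3 1 {r (-k) {0, 3}, g b {0}}).step eq_of_perm rfl).trans
      ((Rw.r_fuse (-k) 0 3 {0} 0 {g b {0}}).step eq_of_perm eq_of_perm)
  rw [h1.cl_eq closed_of_count, h2.cl_eq closed_of_count, cl_ip, cl_ip] at h
  exact h

/-- On a wire where r_k is followed by r_{-k}, the green π is pushed through both. Before the first
and after the second commutation the diagram collapses to ⟨0|0⟩, so t³ is t times the product of the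
two scalars produced, and t is cancelled. -/
theorem ip_two_mul_ip_two_neg (k : ℤ) : ip 2 k * ip 2 (-k) = ip 0 0 * ip 0 0 := by
  have h := cl_commute k 0 1 2 3 {g 0 {0}, r (-k) {1}} closed_of_count (by simp)
  have h1 : Rw ⊥ (g 2 {0, 2} ::ₘ r k {2, 1} ::ₘ {g 0 {0}, r (-k) {1}}) {g 0 {0}, r 0 {0}} :=
    ((Rw.r_fuse k (-k) 1 {2} 0 {g 0 {0}, g 2 {0, 2}}).step eq_of_perm rfl).trans
      ((Rw.g_pi_absorb 0 2 {g 0 {0}}).step (by rw [add_neg_cancel]; exact eq_of_perm) eq_of_perm)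
  have h2 : Rw ⊥ (r (-k) {0, 3} ::ₘ g 2 {3, 1} ::ₘ {g 0 {0}, r (-k) {1}})
      (g 2 {3, 1} ::ₘ r (-k) {1, 4} ::ₘ {g 0 {0}, r (-k) {0, 3}, r 0 {4}}) :=
    (Rw.r_split (-k) 0 4 {1} 0 {g 0 {0}, r (-k) {0, 3}, g 2 {3, 1}} (by simp)).step eq_of_perm eq_of_perm
  have h3 := cl_commute (-k) 3 4 1 5 {g 0 {0}, r (-k) {0, 3}, r 0 {4}} closed_of_count (by simp)
  have h4 : Rw ⊥ (r (- -k) {3, 5} ::ₘ g 2 {5, 4} ::ₘ {g 0 {0}, r (-k) {0, 3}, r 0 {4}})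
      {g 0 {0}, r 0 {0}} :=
    ((Rw.g_pi_absorb 5 4 {r (- -k) {3, 5}, g 0 {0}, r (-k) {0, 3}}).step eq_of_perm rfl).trans
      (((Rw.r_fuse (- -k) 0 5 {3} 0 {g 0 {0}, r (-k) {0, 3}}).step eq_of_perm rfl).trans
      ((Rw.r_fuse (- -k + 0) (-k) 3 0 {0} {g 0 {0}}).step eq_of_perm
        (by rw [add_zero, neg_add_cancel]; exact eq_of_perm)))
  rw [h1.cl_eq closed_of_count, h2.cl_eq closed_of_count, cl_ip] at h
  rw [h4.cl_eq closed_of_count, cl_ip] at h3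
  have h5 : tU * (ip 0 0 * ip 0 0) = tU * (ip 2 k * ip 2 (-k)) := by
    rw [tU_val]
    calc ip 0 0 * (ip 0 0 * ip 0 0) = ip 2 k * _ := by rw [h, mul_left_comm]
      _ = ip 0 0 * (ip 2 k * ip 2 (-k)) := by rw [h3]; ac_rfl
  exact ((Units.mul_right_inj _).1 h5).symm

theorem ip_emod_left (a b : ℤ) : ip (a % 4) b = ip a b := by rw [ip, g_emod, ip]
theorem ip_emod_right (a b : ℤ) : ip a (b % 4) = ip a b := by rw [ip, r_emod, ip]

/-- Adding π to the phase π gives 0, so `ip_add_two` expresses t · `ip 0 k` as the product just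
computed to be t². -/
theorem ip_zero_left (k : ℤ) : ip 0 k = ip 0 0 := by
  have h := ip_add_two 2 k
  rw [ip_two_mul_ip_two_neg, ← ip_emod_left (2 + 2)] at h
  exact (Units.mul_right_inj tU).1 h

theorem ip_zero_right (k : ℤ) : ip k 0 = ip 0 0 := by rw [ip_comm, ip_zero_left]

theorem cl_absorb' (k : ℤ) (a b : ℕ) (C : Diagram)
    (h : IsStabilizerScalar (g k {a, b} ::ₘ r 0 {b} ::ₘ C)) :
    cl (g k {a, b} ::ₘ r 0 {b} ::ₘ C) = cl (r 0 {a} ::ₘ C) := by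
  have := cl_absorb k a b C h
  rw [ip_zero_right k, ← tU_val] at this
  exact (Units.mul_right_inj tU).1 this

theorem cl_euler (a b e f : ℕ) (C : Diagram) (h : IsStabilizerScalar (had a b ::ₘ C))
    (he : ({a, b} + C.ends).count e = 0) (hf : ({a, b} + C.ends).count f = 0) (hef : e ≠ f) :
    ip 0 0 * ip 0 0 * cl (had a b ::ₘ C) =
      ip (-1) (-1) * cl (g 1 {a, e} ::ₘ r 1 {e, f} ::ₘ g 1 {f, b} ::ₘ C) := by
  obtain ⟨N, hN⟩ := exists_fresh ({a, b, e, f} + C.ends)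
  have h0 := hN N le_rfl
  have h1 := hN (N + 1) (Nat.le_succ N)
  have h2 : IsStabilizerScalar (g 1 {a, e} ::ₘ r 1 {e, f} ::ₘ g 1 {f, b} ::ₘ C) := by
    simp only [closed_simps] at h he hf ⊢
    refine ⟨fun n => ?_, h.2⟩
    have := h.1 n
    grind
  have h3 : ip 0 0 * ip 0 0 = cl {g 0 {N}, r 0 {N}} * cl {g 0 {N + 1}, r 0 {N + 1}} := by
    rw [cl_ip, cl_ip]
  have h4 : IsStabilizerScalar ({g 0 {N}, r 0 {N}} + {g 0 {N + 1}, r 0 {N + 1}}) := closed_of_count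
  rw [h3, ← cl_ip N (-1), ← cl_add (closed_ip _ _ _) (closed_ip _ _ _) (by simp), ← cl_add h4 h,
    ← cl_add (closed_ip _ _ _) h2]
  · have := cl_rule (Rule.had_euler N (N + 1) N a b e f) C
    convert this ?_ ?_ using 2
    · exact eq_of_perm
    · exact eq_of_perm
    all_goals
      simp only [closed_simps] at h h0 h1 h2 ⊢
      refine ⟨fun n => ?_, h.2⟩
      have := h.1 n
      have := h2.1 n
      grind
  · intro n hn
    simp only [closed_simps, Multiset.mem_add, Multiset.mem_singleton, or_self] at hn
    subst hn
    rw [← Multiset.count_eq_zero]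
    simp only [closed_simps] at h0 ⊢
    omega
  · intro n hn
    simp only [closed_simps, Multiset.mem_add, Multiset.mem_singleton, or_self] at hn
    rw [← Multiset.count_eq_zero]
    simp only [closed_simps] at h0 h1 ⊢
    rcases hn with rfl | rfl <;> omega

/-- The Euler rule for a Hadamard node between the green node `b` and a phase-free red node.
Undecomposed, the Hadamard node turns the red end green and everything fuses. Decomposed, the last
green spider is absorbed by the red end and the others fuse to the inner product on the right. -/
theorem cl_green_empty (b : ℤ) :
    ip 0 0 * ip 0 0 * cl {g b 0} = ip (-1) (-1) * ip (b + 1) 1 := by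
  have h := cl_euler 0 1 2 3 {g b {0}, r 0 {1}} closed_of_count (by simp) (by simp) (by simp)
  have h1 : Rw ⊥ (had 0 1 ::ₘ {g b {0}, r 0 {1}}) {g b 0} :=
    ((Rw.g_uncolour_one 0 0 1 {g b {0}}).step eq_of_perm rfl).trans
      ((Rw.g_fuse 0 b 0 0 0 0).step eq_of_perm (by rw [zero_add]; exact eq_of_perm))
  have h2 := cl_absorb' 1 3 1 {g 1 {0, 2}, r 1 {2, 3}, g b {0}} closed_of_count
  have h3 : Rw ⊥ (r 0 {3} ::ₘ {g 1 {0, 2}, r 1 {2, 3}, g b {0}}) {g (b + 1) {2}, r 1 {2}} :=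
    ((Rw.r_fuse 1 0 3 {2} 0 {g 1 {0, 2}, g b {0}}).step eq_of_perm rfl).trans
      ((Rw.g_fuse b 1 0 0 {2} {r 1 {2}}).step eq_of_perm eq_of_perm)
  rw [h3.cl_eq closed_of_count, cl_ip] at h2
  rw [h1.cl_eq closed_of_count] at h
  rw [h, ← h2]
  congr 2
  exact eq_of_perm


/-! ### The group of non-zero scalars -/

theorem ip_neg_one_mul_one : ip (-1) (-1) * ip 1 1 = tU * tU * (tU * tU) := by
  have h := cl_green_empty 0
  rw [← ip_zero_mul_self, zero_add] at h
  rw [tU_val, h]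

/-- The class of `⟨-π/2|-π/2⟩`, which represents `2 e^{-iπ/4}`. -/
def p7U : Scalarˣ where
  val := ip (-1) (-1)
  inv := ip 1 1 * ↑(tU⁻¹ * tU⁻¹ * (tU⁻¹ * tU⁻¹))
  val_inv := by
    rw [← mul_assoc, ip_neg_one_mul_one, ← Units.val_mul, ← Units.val_mul, ← Units.val_mul]
    simp only [← mul_inv, mul_inv_cancel, Units.val_one]
  inv_val := by
    rw [mul_comm, ← mul_assoc, ip_neg_one_mul_one, ← Units.val_mul, ← Units.val_mul,
      ← Units.val_mul]
    simp only [← mul_inv, mul_inv_cancel, Units.val_one]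

/-- The derivable class of the scalar `e^{iπ/4}`. -/
def omega : Scalarˣ := tU * tU * p7U⁻¹

theorem ip_neg_one : ip (-1) (-1) = ↑(tU ^ 2 * omega⁻¹) := by
  rw [omega, mul_inv, inv_inv, sq, mul_inv_cancel_left]; rfl

theorem ip_one_one : ip 1 1 = ↑(tU ^ 2 * omega) := by
  have h := ip_neg_one_mul_one
  rw [ip_neg_one, ← Units.val_mul, ← Units.val_mul] at h
  rw [← Units.mul_right_inj (tU ^ 2 * omega⁻¹), h, ← Units.val_mul]
  congr 1
  exact Additive.ofMul.injective (by simp only [ofMul_mul, ofMul_pow, ofMul_inv]; abel)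

/-- Moving π through the phase 3 ≡ -1 gives t⟨-1|-1⟩ = ⟨2|-1⟩⟨1|1⟩ in quarter turns, where all other
factors are known. -/
theorem ip_neg_one_two : ip (-1) 2 = ↑(tU * (omega ^ 2)⁻¹) := by
  have h := ip_add_two 1 3
  rw [← ip_emod_left (1 + 2), ← ip_emod_right _ 3, ← ip_emod_right 1, ip_comm 2 3,
    ← ip_emod_left 3] at h
  have h1 := ip_emod_left (-1) (-1)
  rw [← ip_emod_right] at h1
  have h2 := ip_emod_left (-1) 2
  norm_num at h h1 h2
  rw [h1, ip_neg_one, ip_one_one, h2, ← tU_val, ← Units.val_mul] at h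
  rw [← Units.mul_left_inj (tU ^ 2 * omega), ← h, ← Units.val_mul]
  congr 1
  exact Additive.ofMul.injective (by simp only [ofMul_mul, ofMul_pow, ofMul_inv]; abel)

theorem ip_one_two : ip 1 2 = ↑(tU * omega ^ 2) := by
  have h := ip_two_mul_ip_two_neg 1
  rw [ip_comm 2 1, ip_comm 2 (-1), ip_neg_one_two, ← tU_val, ← Units.val_mul] at h
  rw [← Units.mul_left_inj (tU * (omega ^ 2)⁻¹), h, ← Units.val_mul]
  congr 1
  exact Additive.ofMul.injective (by simp only [ofMul_mul, ofMul_pow, ofMul_inv]; abel)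

/-- Again from `ip_add_two`: in quarter turns t⟨-1|2⟩ = ⟨2|2⟩⟨1|2⟩, because -2 ≡ 2 modulo 4. -/
theorem ip_two_two : ip 2 2 = ↑(tU * (omega ^ 4)⁻¹) := by
  have h := ip_add_two 1 2
  have h1 := ip_emod_left (-1) 2
  have h2 := ip_emod_right 1 (-2)
  norm_num at h h1 h2
  rw [← h2, h1, ip_neg_one_two, ip_one_two, ← tU_val, ← Units.val_mul] at h
  rw [← Units.mul_left_inj (tU * omega ^ 2), ← h, ← Units.val_mul]
  congr 1
  exact Additive.ofMul.injective (by simp only [ofMul_mul, ofMul_pow, ofMul_inv]; abel)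

/-- As π = -π, the square of ⟨π|π⟩ is t²; inserting its expression tω⁻⁴ leaves ω⁻⁸ = 1. -/
theorem omega_pow_eight : omega ^ 8 = 1 := by
  have h := ip_two_mul_ip_two_neg 2
  have h2 := ip_emod_right 2 (-2)
  norm_num at h2
  rw [← h2, ip_two_two, ← tU_val, ← Units.val_mul, ← Units.val_mul, Units.val_inj] at h
  have h3 : omega ^ 8 = tU * tU * (tU * (omega ^ 4)⁻¹ * (tU * (omega ^ 4)⁻¹))⁻¹ := by
    exact Additive.ofMul.injective (by simp only [ofMul_mul, ofMul_pow, ofMul_inv]; abel)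
  rw [h3, h, mul_inv_cancel]

theorem ip_two_two' : ip 2 2 = ↑(tU * omega ^ 4) := by
  rw [ip_two_two]
  congr 2
  rw [inv_eq_iff_mul_eq_one, ← pow_add, omega_pow_eight]

theorem ip_one_emod (a b : ℤ) : ip a b = ip (a % 4) (b % 4) := by
  rw [ip_emod_left, ip_emod_right]

/-- The group generated by the non-zero scalars `√2` and `e^{iπ/4}`. -/
def scalarGroup : Subgroup Scalarˣ := Subgroup.closure {tU, omega}

theorem tU_mem : tU ∈ scalarGroup := Subgroup.subset_closure (by simp)
theorem omega_mem : omega ∈ scalarGroup := Subgroup.subset_closure (by simp)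

/-- The pairs left out are the odd ones with a ≡ -b modulo 4, for which the inner product has value
0. -/
theorem exists_ip (a b : ℤ) (h : a % 2 = 0 ∨ b % 2 = 0 ∨ a % 4 = b % 4) :
    ∃ u ∈ scalarGroup, ip a b = ↑u := by
  have ht := tU_mem
  have ho := omega_mem
  have h1 := ip_emod_left (-1) (-1)
  rw [← ip_emod_right] at h1
  have h2 := ip_emod_left (-1) 2
  norm_num at h1 h2
  have h3 : a % 4 = 0 ∨ a % 4 = 1 ∨ a % 4 = 2 ∨ a % 4 = 3 := by omega
  have h4 : b % 4 = 0 ∨ b % 4 = 1 ∨ b % 4 = 2 ∨ b % 4 = 3 := by omega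
  rw [ip_one_emod]
  rcases h3 with h3 | h3 | h3 | h3 <;> rcases h4 with h4 | h4 | h4 | h4 <;>
    first
    | exfalso; omega
    | rw [h3, ip_zero_left]; exact ⟨_, ht, rfl⟩
    | rw [h4, ip_zero_right]; exact ⟨_, ht, rfl⟩
    | rw [h3, h4, ip_one_one]; exact ⟨_, mul_mem (pow_mem ht _) ho, rfl⟩
    | rw [h3, h4, h1, ip_neg_one]; exact ⟨_, mul_mem (pow_mem ht _) (inv_mem ho), rfl⟩
    | rw [h3, h4, ip_two_two']; exact ⟨_, mul_mem ht (pow_mem ho _), rfl⟩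
    | rw [h3, h4, ip_one_two]; exact ⟨_, mul_mem ht (pow_mem ho _), rfl⟩
    | rw [h3, h4, ip_comm, ip_one_two]; exact ⟨_, mul_mem ht (pow_mem ho _), rfl⟩
    | rw [h3, h4, h2, ip_neg_one_two]; exact ⟨_, mul_mem ht (inv_mem (pow_mem ho _)), rfl⟩
    | rw [h3, h4, ip_comm, h2, ip_neg_one_two]
      exact ⟨_, mul_mem ht (inv_mem (pow_mem ho _)), rfl⟩

/-- The excluded phase π is exactly the one for which the pair (b + 1, 1) in `cl_green_empty` is an
excluded odd pair; the value 1 + e^{iπ} is zero. -/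
theorem exists_cl_green_empty (b : ℤ) (h : b % 4 ≠ 2) : ∃ u ∈ scalarGroup, cl {g b 0} = ↑u := by
  have h1 := cl_green_empty b
  obtain ⟨u, hu, e⟩ := exists_ip (-1) (-1) (by simp)
  obtain ⟨v, hv, e'⟩ := exists_ip (b + 1) 1 (by omega)
  refine ⟨(tU * tU)⁻¹ * (u * v), mul_mem (inv_mem (mul_mem tU_mem tU_mem)) (mul_mem hu hv), ?_⟩
  rw [e, e', ← tU_val, ← Units.val_mul, ← Units.val_mul] at h1
  rw [Units.val_mul, ← h1, Units.inv_mul_cancel_left]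

theorem mem_scalarGroup {u : Scalarˣ} (hu : u ∈ scalarGroup) :
    ∃ (s : Fin 8) (m : ℤ), u = omega ^ (s : ℕ) * tU ^ m := by
  rw [scalarGroup, Subgroup.mem_closure_pair] at hu
  obtain ⟨m, n, rfl⟩ := hu
  refine ⟨⟨(n % 8).toNat, by omega⟩, m, ?_⟩
  rw [mul_comm, ← zpow_natCast, Int.toNat_of_nonneg (by omega)]
  congr 1
  conv_lhs => rw [← Int.emod_add_mul_ediv n 8, zpow_add, zpow_mul,
    show omega ^ (8 : ℤ) = 1 from omega_pow_eight, one_zpow, mul_one]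


/-! ### Rewriting up to non-zero scalars -/

/-- Rewriting of stabilizer scalar diagrams up to powers of `√2` and `e^{iπ/4}`. -/
infix:50 " ≐ " => Rw scalarGroup

/-- Lets the balancing scalars in the rules disappear, as they are units in the group. -/
theorem Rw.of_mul {L R : Diagram} (h : IsStabilizerScalar L → IsStabilizerScalar R)
    {u v : Scalarˣ} (hu : u ∈ scalarGroup) (hv : v ∈ scalarGroup)
    (e : IsStabilizerScalar L → u * cl L = v * cl R) : L ≐ R := fun hL =>
  ⟨h hL, u⁻¹ * v, mul_mem (inv_mem hu) hv, by
    rw [Units.val_mul, mul_assoc, ← e hL, Units.inv_mul_cancel_left]⟩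

theorem Rw.of_cl_eq {L R : Diagram} (h : IsStabilizerScalar L → IsStabilizerScalar R)
    (e : IsStabilizerScalar L → cl L = cl R) : L ≐ R :=
  Rw.of_mul h (one_mem _) (one_mem _) fun hL => by rw [e hL]

/-- The exchange of colours on scalars. -/
def Scalar.swapColour : Scalar →* Scalar where
  toFun := Quotient.map (fun D => ⟨D.1.swapColour, by simpa [Diagram.IsScalar] using D.2.1,
    fun v hv => (Eqv.refl D.2.valid).swapColour.valid.1.2 v hv⟩) fun _ _ h => h.swapColour
  map_one' := rfl
  map_mul' := by
    rintro ⟨D⟩ ⟨E⟩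
    refine Quotient.sound ?_
    change Eqv _ (Diagram.swapColour (D.1.par E.1)) (D.1.swapColour.par E.1.swapColour)
    have : (D.1.par E.1).swapColour = D.1.swapColour.par E.1.swapColour := by
      simp only [Diagram.par, Diagram.swapColour_add, Diagram.rename_swapColour]
    rw [← this]
    exact .refl (Eqv.refl (D.2.par E.2).valid).swapColour.valid.1

theorem IsStabilizerScalar.swapColour {D : Diagram} (h : IsStabilizerScalar D) :
    IsStabilizerScalar D.swapColour :=
  ⟨by simpa [Diagram.IsScalar] using h.1, (Eqv.refl h.valid).swapColour.valid.1.2⟩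

theorem isStabilizerScalar_swapColour {D : Diagram} :
    IsStabilizerScalar D.swapColour ↔ IsStabilizerScalar D := by
  refine ⟨fun h => ?_, fun h => h.swapColour⟩
  rw [← D.swapColour_swapColour]
  exact h.swapColour

theorem swapColour_cl {D : Diagram} (h : IsStabilizerScalar D) :
    (cl D).swapColour = cl D.swapColour := by
  rw [cl, cl, dif_pos h, dif_pos h.swapColour]
  rfl

theorem swapColour_ip (a b : ℤ) : (ip a b).swapColour = ip a b := by
  rw [ip, swapColour_cl (closed_ip _ _ _)]
  simp only [Diagram.swapColour_insert, Diagram.swapColour_singleton, g_swapColour, r_swapColour,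
    ← Multiset.insert_eq_cons]
  rw [Multiset.pair_comm, cl_ip, cl_ip, ip_comm]

/-- Both generators are built from inner products ⟨a|a⟩, which are fixed by `ip_comm`. Hence
rewriting up to this group is stable under exchange of colours. -/
theorem swapColour_of_mem {u : Scalarˣ} (hu : u ∈ scalarGroup) :
    Scalar.swapColour (u : Scalar) = u := by
  have h1 : Units.map Scalar.swapColour tU = tU := Units.ext (swapColour_ip 0 0)
  have h2 : Units.map Scalar.swapColour omega = omega := by
    rw [omega, map_mul, map_mul, map_inv, h1]
    congr 2
    exact Units.ext (swapColour_ip (-1) (-1))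
  have : scalarGroup ≤ (Units.map Scalar.swapColour).eqLocus (MonoidHom.id _) := by
    rw [scalarGroup, Subgroup.closure_le]
    rintro x (rfl | rfl)
    · exact h1
    · exact h2
  exact congrArg Units.val (this hu)

theorem Rw.swap {D E : Diagram} (h : D ≐ E) : D.swapColour ≐ E.swapColour := fun hD => by
  have hD := isStabilizerScalar_swapColour.1 hD
  obtain ⟨hE, u, hu, e⟩ := h hD
  refine ⟨hE.swapColour, u, hu, ?_⟩
  rw [← swapColour_cl hD, ← swapColour_cl hE, e, map_mul, swapColour_of_mem hu]

/-- A rewrite step in a context, with exchanged colours. -/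
theorem Rw.swap_context {L R C : Diagram} (h : L + C.swapColour ≐ R + C.swapColour) :
    L.swapColour + C ≐ R.swapColour + C := by
  have := h.swap
  rwa [Diagram.swapColour_add, Diagram.swapColour_add, Diagram.swapColour_swapColour] at this

theorem Rw.scalar {D C : Diagram} (hD : ∃ u ∈ scalarGroup, cl D = ↑u) (h : IsStabilizerScalar D)
    (hC : IsStabilizerScalar (D + C) → IsStabilizerScalar C)
    (hd : IsStabilizerScalar (D + C) → ∀ a ∈ D.ends, a ∉ C.ends) : D + C ≐ C := fun hDC => by
  obtain ⟨u, hu, e⟩ := hD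
  exact ⟨hC hDC, u, hu, by rw [cl_add h (hC hDC) (hd hDC), e]⟩

theorem Rw.ip (a b : ℤ) (h : a % 2 = 0 ∨ b % 2 = 0 ∨ a % 4 = b % 4) (e : ℕ) (C : Diagram) :
    g a {e} ::ₘ r b {e} ::ₘ C ≐ C := by
  refine (Rw.scalar (C := C) (D := {g a {e}, r b {e}}) ?_ (closed_ip _ _ _)
    (fun h => ?_) (fun h => ?_)).step eq_of_perm rfl
  · rw [cl_ip]
    exact exists_ip a b h
  · simp only [closed_simps] at h ⊢
    refine ⟨fun n => ?_, h.2⟩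
    have := h.1 n
    grind
  · intro n hn
    simp only [closed_simps, Multiset.mem_add, Multiset.mem_singleton, or_self] at hn
    rw [← Multiset.count_eq_zero]
    simp only [closed_simps] at h
    have := h.1 n
    grind

theorem Rw.green_empty (b : ℤ) (h : b % 4 ≠ 2) (C : Diagram) : g b 0 ::ₘ C ≐ C := by
  refine (Rw.scalar (C := C) (D := {g b 0}) (exists_cl_green_empty b h) closed_of_count
    (fun h => ?_) (fun h => ?_)).step eq_of_perm rfl
  · simpa only [closed_simps, zero_add] using h
  · simp

theorem Rw.red_empty (b : ℤ) (h : b % 4 ≠ 2) (C : Diagram) : r b 0 ::ₘ C ≐ C :=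
  (Rw.green_empty b h (Diagram.swapColour C)).swap.step
    (by rw [Diagram.swapColour_cons, Diagram.swapColour_swapColour]; rfl)
    (Diagram.swapColour_swapColour C)

theorem Rw.star (C : Diagram) : star ::ₘ C ≐ C := by
  refine (Rw.scalar (C := C) (D := {Node.star}) ⟨_, ?_, cl_star⟩ closed_of_count
    (fun h => ?_) (fun h => ?_)).step eq_of_perm rfl
  · exact mul_mem (inv_mem tU_mem) (inv_mem tU_mem)
  · simpa only [closed_simps, zero_add] using h
  · simp

theorem Rw.swap_cons {D E C : Diagram} (h : D + C.swapColour ≐ E + C.swapColour)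
    {L R : Diagram} (hL : L = D.swapColour + C) (hR : R = E.swapColour + C) : L ≐ R :=
  h.swap_context.step hL hR.symm

/-! ### Copying -/

theorem Rw.red_copy_zero (e a b : ℕ) (C : Diagram) :
    r 0 {e} ::ₘ g 0 {e, a, b} ::ₘ C ≐ r 0 {a} ::ₘ r 0 {b} ::ₘ C := by
  have key : IsStabilizerScalar (r 0 {e} ::ₘ g 0 {e, a, b} ::ₘ C) →
      IsStabilizerScalar (r 0 {a} ::ₘ r 0 {b} ::ₘ C) := fun h => by
    simp only [closed_simps] at h ⊢
    refine ⟨fun n => ?_, h.2⟩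
    have := h.1 n
    grind
  refine Rw.of_mul key tU_mem (one_mem _) fun h => ?_
  have := cl_rule_ip_left C (fun i => Rule.g_copy i e a b) (by convert h using 1; exact eq_of_perm)
    (by convert key h using 1; exact eq_of_perm)
  rw [tU_val, Units.val_one, one_mul]
  convert this using 3 <;> exact eq_of_perm

/-- A red node whose phase is a multiple of `π` is copied. -/
theorem Rw.red_copy (k : ℤ) (hk : k % 2 = 0) (e a b : ℕ) (C : Diagram) :
    r k {e} ::ₘ g 0 {e, a, b} ::ₘ C ≐ r k {a} ::ₘ r k {b} ::ₘ C := by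
  rw [← r_emod, ← r_emod k {a}, ← r_emod k {b}]
  have : k % 4 = 0 ∨ k % 4 = 2 := by omega
  rcases this with h | h <;> rw [h]
  · exact Rw.red_copy_zero e a b C
  · obtain ⟨N, hN⟩ := exists_fresh ({e, a, b} + C.ends)
    have h0 := hN N le_rfl
    have h1 := hN (N + 1) (by omega)
    have h2 := hN (N + 2) (by omega)
    -- The phase π is moved onto a two-legged spider, which the π-copy rule carries to the legs `a`
    -- and `b`; the remaining phase-free node is copied, and each copy fuses with its π.
    refine ((Rw.r_split 0 2 N 0 {e} (g 0 {e, a, b} ::ₘ C) ?_).step eq_of_perm rfl).trans ?_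
    · simp only [closed_simps] at h0 ⊢
      grind
    refine ((Rw.of_rule (C := r 0 {N} ::ₘ C) (Rule.r_pi N e {(a, N + 1), (b, N + 2)})
      fun h => ?_).step (by
        simp only [Multiset.insert_eq_cons, Multiset.map_cons, Multiset.map_singleton]
        exact eq_of_perm) rfl).trans ?_
    · simp only [closed_simps, Multiset.insert_eq_cons, Multiset.map_cons, Multiset.map_singleton] at h h0 h1 h2 ⊢
      refine ⟨fun n => ?_, h.2⟩
      have := h.1 n
      grind
    refine ((Rw.red_copy_zero N (N + 1) (N + 2) (r 2 {N + 1, a} ::ₘ r 2 {N + 2, b} ::ₘ C)).step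
      (by simp only [Multiset.insert_eq_cons, Multiset.map_cons, Multiset.map_singleton]
          exact eq_of_perm) rfl).trans ?_
    refine ((Rw.r_fuse 0 2 (N + 1) 0 {a} (r 0 {N + 2} ::ₘ r 2 {N + 2, b} ::ₘ C)).step
      eq_of_perm rfl).trans ?_
    exact (Rw.r_fuse 0 2 (N + 2) 0 {b} (r 2 {a} ::ₘ C)).step eq_of_perm eq_of_perm

theorem Rw.green_copy (k : ℤ) (hk : k % 2 = 0) (e a b : ℕ) (C : Diagram) :
    g k {e} ::ₘ r 0 {e, a, b} ::ₘ C ≐ g k {a} ::ₘ g k {b} ::ₘ C := by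
  refine Rw.swap_cons (C := C) (D := {r k {e}, g 0 {e, a, b}}) (E := {r k {a}, r k {b}})
    ((Rw.red_copy k hk e a b C.swapColour).step eq_of_perm eq_of_perm) ?_ ?_ <;>
  · simp only [Multiset.insert_eq_cons, Diagram.swapColour_cons, Diagram.swapColour_singleton,
      g_swapColour, r_swapColour]
    exact eq_of_perm

/-- The bialgebra rule from right to left. -/
theorem Rw.bialgebra (a b c d e p q x y : ℕ) (C : Diagram)
    (hp : ({a, b, c, d, e, q, x, y} + C.ends).count p = 0)
    (hq : ({a, b, c, d, e, x, y} + C.ends).count q = 0)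
    (hx : ({a, b, c, d, e, y} + C.ends).count x = 0)
    (hy : ({a, b, c, d, e} + C.ends).count y = 0) :
    r 0 {a, b, e} ::ₘ g 0 {e, c, d} ::ₘ C ≐
      g 0 {a, p, q} ::ₘ g 0 {b, x, y} ::ₘ r 0 {p, x, c} ::ₘ r 0 {q, y, d} ::ₘ C := by
  have key : IsStabilizerScalar (r 0 {a, b, e} ::ₘ g 0 {e, c, d} ::ₘ C) →
      IsStabilizerScalar
      (g 0 {a, p, q} ::ₘ g 0 {b, x, y} ::ₘ r 0 {p, x, c} ::ₘ r 0 {q, y, d} ::ₘ C) := fun h => by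
    simp only [closed_simps] at h hp hq hx hy ⊢
    refine ⟨fun n => ?_, h.2⟩
    have := h.1 n
    grind (splits := 25)
  refine Rw.of_mul key (one_mem _) tU_mem fun h => ?_
  have := cl_rule_ip_left C (fun i => Rule.g_bialgebra i a b c d p q x y e)
    (by convert key h using 1; exact eq_of_perm) (by convert h using 1; exact eq_of_perm)
  rw [tU_val, Units.val_one, one_mul]
  convert this.symm using 3 <;> exact eq_of_perm


/-! ### Wires and Hadamard nodes -/

variable {W : Subgroup Scalarˣ}

/-- A spider may be inserted next to a Hadamard node. -/
theorem Rw.had_insert (a b c : ℕ) (C : Diagram) (hc : ({a, b} + C.ends).count c = 0) :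
    Rw W (had a b ::ₘ C) (had a c ::ₘ g 0 {c, b} ::ₘ C) := by
  have key : IsStabilizerScalar (had a b ::ₘ C) →
      IsStabilizerScalar (had a c ::ₘ g 0 {c, b} ::ₘ C) := fun h => by
    simp only [closed_simps] at h hc ⊢
    refine ⟨fun n => ?_, h.2⟩
    have := h.1 n
    grind
  intro h
  refine ⟨key h, 1, W.one_mem, ?_⟩
  rw [Units.val_one, one_mul]
  have hw : IsStabilizerScalar (wire b c ::ₘ had a c ::ₘ C) := by
    have := key h
    simp only [closed_simps] at this ⊢
    refine ⟨fun n => ?_, this.2⟩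
    have := this.1 n
    grind
  have hw' : IsStabilizerScalar ({wire b c} + had a c ::ₘ C) := hw
  have h1 : cl (had a c ::ₘ g 0 {c, b} ::ₘ C) = cl (wire b c ::ₘ had a c ::ₘ C) := by
    have h2 : IsStabilizerScalar ({g 0 {b, c}} + had a c ::ₘ C) := by
      have := key h
      simp only [closed_simps] at this ⊢
      refine ⟨fun n => ?_, this.2⟩
      have := this.1 n
      grind
    have := cl_rule (Rule.g_wire b c) (had a c ::ₘ C) h2 hw'
    rw [Multiset.singleton_add, Multiset.singleton_add] at this
    rw [← this]
    congr 1
    exact eq_of_perm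
  rw [h1]
  have hbc : b ≠ c := by
    simp only [closed_simps] at hc
    grind
  have hac : a ≠ c := by
    simp only [closed_simps] at hc
    grind
  have hcC : c ∉ C.ends := by
    rw [← Multiset.count_eq_zero]
    simp only [closed_simps] at hc
    omega
  -- The phase-free spider is a piece of wire plugged into the Hadamard node, and it is removed by
  -- topology alone.
  have h3 := Eqv.shorten b c hw.valid hbc (D := had a c ::ₘ C) (by
    simp only [closed_simps, if_true, if_neg hac.symm, Multiset.count_eq_zero_of_notMem hcC])
  rw [cl_eq_of_eqv h3]
  congr 1
  have h4 : C.rename (Function.update id c b) = C := by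
    conv_rhs => rw [← Diagram.rename_id C]
    exact Diagram.rename_congr fun d hd => by
      rw [Function.update_of_ne]; rintro rfl; exact hcC hd
  rw [Diagram.rename_cons, h4, Node.rename, Function.update_self, Function.update_of_ne hac]
  rfl

theorem Rw.had_absorb (a b c : ℕ) (C : Diagram) :
    Rw W (had a c ::ₘ g 0 {c, b} ::ₘ C) (had a b ::ₘ C) :=
  Rw.of_closed fun h => (Rw.had_insert a b c C (by
      simp only [closed_simps] at h ⊢
      have := h.1 c
      grind)).symm fun _ => by
    simp only [closed_simps] at h ⊢
    refine ⟨fun n => ?_, h.2⟩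
    have := h.1 n
    grind

/-- A red spider becomes green with Hadamard nodes at its legs. -/
theorem Rw.r_colour (k : ℤ) (P : Multiset (ℕ × ℕ)) (C : Diagram)
    (h : ∀ n, (P.map Prod.snd).count n = 0 ∨
      (P.map Prod.snd).count n = 1 ∧ (P.map Prod.fst + C.ends).count n = 0) :
    Rw W (r k (P.map Prod.fst) ::ₘ C)
      (g k (P.map Prod.snd) ::ₘ (P.map fun p => had p.1 p.2) + C) := by
  refine (Rw.of_rule (C := C) (Rule.r_colour k P) fun hC => ?_).step eq_of_perm eq_of_perm
  simp only [closed_simps, ends_map_had] at h hC ⊢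
  refine ⟨fun n => ?_, fun v hv => ?_, hC.2⟩
  · have := h n
    have := hC.1 n
    grind
  · obtain ⟨p, -, rfl⟩ := Multiset.mem_map.1 hv
    trivial

/-- A green spider with Hadamard nodes at all legs becomes red. -/
theorem Rw.r_uncolour (k : ℤ) (P : Multiset (ℕ × ℕ)) (C : Diagram) :
    Rw W (g k (P.map Prod.snd) ::ₘ (P.map fun p => had p.1 p.2) + C)
      (r k (P.map Prod.fst) ::ₘ C) := by
  refine Rw.of_closed fun hC => (Rw.r_colour k P C fun n => ?_).symm fun _ => ?_
  · simp only [closed_simps, ends_map_had] at hC ⊢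
    have := hC.1 n
    grind
  · simp only [closed_simps, ends_map_had] at hC ⊢
    refine ⟨fun n => ?_, hC.2.2⟩
    have := hC.1 n
    grind

theorem Rw.g_wire_insert (k : ℤ) (a b : ℕ) (S : Multiset ℕ) (C : Diagram)
    (hb : (a ::ₘ S + C.ends).count b = 0) :
    Rw W (g k (a ::ₘ S) ::ₘ C) (g k (b ::ₘ S) ::ₘ g 0 {b, a} ::ₘ C) := by
  refine (Rw.g_split k 0 b S {a} C ?_).step (by rw [add_zero]; congr 2; exact eq_of_perm) eq_of_perm
  simp only [closed_simps] at hb ⊢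
  omega

theorem Rw.r_wire_insert (k : ℤ) (a b : ℕ) (S : Multiset ℕ) (C : Diagram)
    (hb : (a ::ₘ S + C.ends).count b = 0) :
    Rw W (r k (a ::ₘ S) ::ₘ C) (r k (b ::ₘ S) ::ₘ g 0 {b, a} ::ₘ C) := by
  refine ((Rw.r_split k 0 b S {a} C ?_).step (by rw [add_zero]; congr 2; exact eq_of_perm) rfl).trans
    ((Rw.r_to_g b a (r k (b ::ₘ S) ::ₘ C)).step eq_of_perm eq_of_perm)
  simp only [closed_simps] at hb ⊢
  omega

/-- Two Hadamard nodes cancel. -/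
theorem Rw.had_had (a b c : ℕ) (C : Diagram) :
    Rw W (had a b ::ₘ had b c ::ₘ C) (g 0 {a, c} ::ₘ C) := by
  refine Rw.of_closed fun hC => ?_
  obtain ⟨N, hN⟩ := exists_fresh ({a, b, c} + C.ends)
  have h0 := hN N le_rfl
  refine ((Rw.had_insert a b N (had b c ::ₘ C) ?_).step rfl rfl).trans ?_
  · simp only [closed_simps] at h0 ⊢
    grind
  refine ((Rw.had_symm b c (had a N ::ₘ g 0 {N, b} ::ₘ C)).step eq_of_perm rfl).trans ?_
  -- With a spider inserted between them, the two Hadamard nodes are the colour change of a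
  -- two-legged red spider, which is again a wire.
  refine ((Rw.r_uncolour 0 {(a, N), (c, b)} C).step ?_ rfl).trans ?_
  · simp only [Multiset.insert_eq_cons, Multiset.map_cons, Multiset.map_singleton]
    exact eq_of_perm
  exact (Rw.r_to_g a c C).step rfl rfl

/-! ### The Hopf rule -/

/-- The bialgebra rule from left to right. -/
theorem Rw.bialgebra_symm (a b c d e p q x y : ℕ) (C : Diagram)
    (he : ({a, b, c, d} + C.ends).count e = 0) :
    g 0 {a, p, q} ::ₘ g 0 {b, x, y} ::ₘ r 0 {p, x, c} ::ₘ r 0 {q, y, d} ::ₘ C ≐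
      r 0 {a, b, e} ::ₘ g 0 {e, c, d} ::ₘ C := by
  have key : IsStabilizerScalar
      (g 0 {a, p, q} ::ₘ g 0 {b, x, y} ::ₘ r 0 {p, x, c} ::ₘ r 0 {q, y, d} ::ₘ C) →
      IsStabilizerScalar (r 0 {a, b, e} ::ₘ g 0 {e, c, d} ::ₘ C) := fun h => by
    simp only [closed_simps] at h he ⊢
    refine ⟨fun n => ?_, h.2⟩
    have := h.1 n
    grind (splits := 25)
  refine Rw.of_mul key tU_mem (one_mem _) fun h => ?_
  have := cl_rule_ip_left C (fun i => Rule.g_bialgebra i a b c d p q x y e)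
    (by convert h using 1; exact eq_of_perm) (by convert key h using 1; exact eq_of_perm)
  rw [tU_val, Units.val_one, one_mul]
  convert this using 3 <;> exact eq_of_perm

/-- The green spider is split into two, and a red spider with an `r 0` stub is placed on the wire
between them, so the left-hand pattern of the bialgebra rule appears. After that rule the stub is
copied through the single remaining green spider, and this cuts the connection. -/
theorem Rw.hopf_three (p x a c : ℕ) (C : Diagram) :
    g 0 {p, x, a} ::ₘ r 0 {p, x, c} ::ₘ C ≐ g 0 {a} ::ₘ r 0 {c} ::ₘ C := by
  obtain ⟨N, hN⟩ := exists_fresh ({p, x, a, c} + C.ends)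
  have h0 := hN N le_rfl
  have h1 := hN (N + 1) (by omega)
  have h2 := hN (N + 2) (by omega)
  have h3 := hN (N + 3) (by omega)
  have h4 := hN (N + 4) (by omega)
  refine ((Rw.g_split 0 0 N {p, x, a} 0 (r 0 {p, x, c} ::ₘ C) ?_).step
    (by rw [add_zero, add_zero]) rfl).trans ?_
  · simp only [closed_simps] at h0 ⊢
    grind
  refine ((Rw.g_split 0 0 (N + 1) {a, p} {N, x} (g 0 {N} ::ₘ r 0 {p, x, c} ::ₘ C) ?_).step
    (by rw [add_zero]; exact eq_of_perm) rfl).trans ?_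
  · simp only [closed_simps] at h0 h1 ⊢
    grind
  refine ((Rw.g_wire_insert 0 (N + 1) (N + 2) {a, p}
    (g 0 {N + 1, N, x} ::ₘ g 0 {N} ::ₘ r 0 {p, x, c} ::ₘ C) ?_).step eq_of_perm rfl).trans ?_
  · simp only [closed_simps] at h2 ⊢
    grind
  refine ((Rw.g_to_r (N + 2) (N + 1) (g 0 {a, p, N + 2} ::ₘ
    g 0 {N + 1, N, x} ::ₘ g 0 {N} ::ₘ r 0 {p, x, c} ::ₘ C)).step eq_of_perm rfl).trans ?_
  refine ((Rw.r_split 0 0 (N + 3) {N + 2, N + 1} 0 (g 0 {a, p, N + 2} ::ₘ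
    g 0 {N + 1, N, x} ::ₘ g 0 {N} ::ₘ r 0 {p, x, c} ::ₘ C) ?_).step
    (by rw [add_zero, add_zero]) rfl).trans ?_
  · simp only [closed_simps] at h3 ⊢
    grind
  refine ((Rw.bialgebra_symm a N c (N + 3) (N + 4) p (N + 2) x (N + 1)
    (r 0 {N + 3} ::ₘ g 0 {N} ::ₘ C) ?_).step eq_of_perm rfl).trans ?_
  · simp only [closed_simps] at h4 ⊢
    grind
  refine ((Rw.red_copy_zero (N + 3) (N + 4) c (r 0 {a, N, N + 4} ::ₘ g 0 {N} ::ₘ C)).step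
    eq_of_perm rfl).trans ?_
  refine ((Rw.r_fuse 0 0 (N + 4) {a, N} 0 (r 0 {c} ::ₘ g 0 {N} ::ₘ C)).step
    eq_of_perm rfl).trans ?_
  refine ((Rw.r_to_g a N (r 0 {c} ::ₘ g 0 {N} ::ₘ C)).step (by rw [add_zero, add_zero])
    rfl).trans ?_
  exact (Rw.g_fuse 0 0 N {a} 0 (r 0 {c} ::ₘ C)).step eq_of_perm (by rw [add_zero, add_zero])

/-- Two parallel wires between spiders of different colours can be removed. -/
theorem Rw.hopf (k l : ℤ) (p x : ℕ) (S T : Multiset ℕ) (C : Diagram) :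
    g k (p ::ₘ x ::ₘ S) ::ₘ r l (p ::ₘ x ::ₘ T) ::ₘ C ≐ g k S ::ₘ r l T ::ₘ C := by
  obtain ⟨N, hN⟩ := exists_fresh ({p, x} + S + T + C.ends)
  have h0 := hN N le_rfl
  have h1 := hN (N + 1) (by omega)
  refine ((Rw.g_split k 0 N S {p, x} (r l (p ::ₘ x ::ₘ T) ::ₘ C) ?_).step
    (by rw [add_zero]; congr 2; exact eq_of_perm) rfl).trans ?_
  · simp only [closed_simps] at h0 ⊢
    grind
  refine ((Rw.r_split l 0 (N + 1) T {p, x} (g k (N ::ₘ S) ::ₘ g 0 {N, p, x} ::ₘ C) ?_).step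
    (by rw [add_zero]; exact eq_of_perm) rfl).trans ?_
  · simp only [closed_simps] at h0 h1 ⊢
    grind
  refine ((Rw.hopf_three p x N (N + 1) (r l ((N + 1) ::ₘ T) ::ₘ g k (N ::ₘ S) ::ₘ C)).step
    eq_of_perm rfl).trans ?_
  refine ((Rw.g_fuse k 0 N S 0 (r 0 {N + 1} ::ₘ r l ((N + 1) ::ₘ T) ::ₘ C)).step
    eq_of_perm rfl).trans ?_
  exact (Rw.r_fuse l 0 (N + 1) T 0 (g k S ::ₘ C)).step
    (by rw [add_zero, add_zero]; exact eq_of_perm) (by rw [add_zero, add_zero]; exact eq_of_perm)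

/-! ### Odd phases -/

/-- Euler decomposition of the Hadamard node. -/
theorem Rw.euler (a b e f : ℕ) (C : Diagram) (he : ({a, b} + C.ends).count e = 0)
    (hf : ({a, b} + C.ends).count f = 0) (hef : e ≠ f) :
    had a b ::ₘ C ≐ g 1 {a, e} ::ₘ r 1 {e, f} ::ₘ g 1 {f, b} ::ₘ C := by
  refine Rw.of_mul (fun h => ?_) (mul_mem tU_mem tU_mem)
    (mul_mem (pow_mem tU_mem 2) (inv_mem omega_mem)) fun h => ?_
  · simp only [closed_simps] at h he hf ⊢
    refine ⟨fun n => ?_, h.2⟩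
    have := h.1 n
    grind
  · rw [← ip_neg_one, ← cl_euler a b e f C h he hf hef]
    rfl

theorem Rw.absorb (k : ℤ) (a b : ℕ) (C : Diagram) :
    g k {a, b} ::ₘ r 0 {b} ::ₘ C ≐ r 0 {a} ::ₘ C := by
  refine Rw.of_cl_eq (fun h => ?_) fun h => cl_absorb' k a b C h
  simp only [closed_simps] at h ⊢
  refine ⟨fun n => ?_, h.2⟩
  have := h.1 n
  grind

/-- A phase-free green end is a Hadamard node on a phase-free red end. Decomposing that node, its
last green spider is absorbed by the red end, its first cancels the phase -π/2, and the red middle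
survives. -/
theorem Rw.state_neg_one (a : ℕ) (C : Diagram) : g (-1) {a} ::ₘ C ≐ r 1 {a} ::ₘ C := by
  obtain ⟨N, hN⟩ := exists_fresh ({a} + C.ends)
  have h0 := hN N le_rfl
  have h1 := hN (N + 1) (by omega)
  have h2 := hN (N + 2) (by omega)
  have h3 := hN (N + 3) (by omega)
  refine ((Rw.g_split (-1) 0 N {a} 0 C ?_).step (by rw [add_zero, add_zero]) rfl).trans ?_
  · simp only [closed_simps] at h0 ⊢
    omega
  refine (Rw.symm ((Rw.g_uncolour_one 0 N (N + 1) (g (-1) {N, a} ::ₘ C)).step rfl eq_of_perm)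
    fun h => ?_).trans ?_
  · simp only [closed_simps] at h h1 ⊢
    refine ⟨fun n => ?_, h.2⟩
    have := h.1 n
    grind
  refine ((Rw.euler N (N + 1) (N + 2) (N + 3) (r 0 {N + 1} ::ₘ g (-1) {N, a} ::ₘ C)
    ?_ ?_ (by omega)).step eq_of_perm rfl).trans ?_
  · simp only [closed_simps] at h2 ⊢
    grind
  · simp only [closed_simps] at h3 ⊢
    grind
  refine ((Rw.absorb 1 (N + 3) (N + 1) (g 1 {N, N + 2} ::ₘ r 1 {N + 2, N + 3} ::ₘ
    g (-1) {N, a} ::ₘ C)).step eq_of_perm rfl).trans ?_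
  refine ((Rw.r_fuse 1 0 (N + 3) {N + 2} 0 (g 1 {N, N + 2} ::ₘ
    g (-1) {N, a} ::ₘ C)).step eq_of_perm rfl).trans ?_
  refine ((Rw.g_fuse 1 (-1) N {N + 2} {a} (r 1 {N + 2} ::ₘ C)).step
    (by rw [add_zero, add_zero]; exact eq_of_perm) rfl).trans ?_
  refine ((Rw.g_to_r (N + 2) a (r 1 {N + 2} ::ₘ C)).step (by norm_num) rfl).trans ?_
  exact (Rw.r_fuse 0 1 (N + 2) {a} 0 C).step eq_of_perm (by norm_num)

theorem Rw.state_one (a : ℕ) (C : Diagram) : g 1 {a} ::ₘ C ≐ r (-1) {a} ::ₘ C := by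
  refine Rw.of_closed fun h => Rw.symm ?_ fun _ => by simpa only [closed_simps] using h
  exact Rw.swap_cons (C := C) (D := {g (-1) {a}}) (E := {r 1 {a}})
    ((Rw.state_neg_one a C.swapColour).step eq_of_perm eq_of_perm) rfl rfl

theorem odd_emod {k : ℤ} (hk : k % 2 = 1) :
    (k % 4 = 1 ∧ -k % 4 = (-1) % 4) ∨ (k % 4 = (-1) % 4 ∧ -k % 4 = 1) := by omega

theorem Rw.state (k : ℤ) (hk : k % 2 = 1) (a : ℕ) (C : Diagram) :
    g k {a} ::ₘ C ≐ r (-k) {a} ::ₘ C := by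
  rw [← g_emod, ← r_emod]
  rcases odd_emod hk with ⟨h, h'⟩ | ⟨h, h'⟩ <;> rw [h, h']
  · rw [r_emod]; exact Rw.state_one a C
  · rw [g_emod]; exact Rw.state_neg_one a C

/-- Euler decomposition of the Hadamard node, with the other signs. -/
theorem Rw.euler_neg (a b e f : ℕ) (C : Diagram) (he : ({a, b} + C.ends).count e = 0)
    (hf : ({a, b} + C.ends).count f = 0) (hef : e ≠ f) :
    had a b ::ₘ C ≐ g (-1) {a, e} ::ₘ r (-1) {e, f} ::ₘ g (-1) {f, b} ::ₘ C := by
  obtain ⟨N, hN⟩ := exists_fresh ({a, b, e, f} + C.ends)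
  have h0 := hN N le_rfl
  have h1 := hN (N + 1) (by omega)
  have h2 := hN (N + 2) (by omega)
  have h3 := hN (N + 3) (by omega)
  -- The chain of a Hadamard node, its Euler decomposition, and the inverse of that decomposition is
  -- evaluated in two ways. Here the six spiders cancel from the middle outwards and the Hadamard
  -- node remains.
  have hI : had a N ::ₘ g 1 {N, N + 1} ::ₘ r 1 {N + 1, N + 2} ::ₘ g 1 {N + 2, N + 3} ::ₘ
      g (-1) {N + 3, e} ::ₘ r (-1) {e, f} ::ₘ g (-1) {f, b} ::ₘ C ≐ had a b ::ₘ C := by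
    refine ((Rw.g_fuse 1 (-1) (N + 3) {N + 2} {e} (had a N ::ₘ g 1 {N, N + 1} ::ₘ
      r 1 {N + 1, N + 2} ::ₘ r (-1) {e, f} ::ₘ g (-1) {f, b} ::ₘ C)).step eq_of_perm rfl).trans ?_
    refine ((Rw.g_to_r (N + 2) e (had a N ::ₘ g 1 {N, N + 1} ::ₘ
      r 1 {N + 1, N + 2} ::ₘ r (-1) {e, f} ::ₘ g (-1) {f, b} ::ₘ C)).step
      (by norm_num) rfl).trans ?_
    refine ((Rw.r_fuse 0 (-1) e {N + 2} {f} (had a N ::ₘ g 1 {N, N + 1} ::ₘ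
      r 1 {N + 1, N + 2} ::ₘ g (-1) {f, b} ::ₘ C)).step eq_of_perm rfl).trans ?_
    refine ((Rw.r_fuse 1 (0 + -1) (N + 2) {N + 1} {f} (had a N ::ₘ g 1 {N, N + 1} ::ₘ
      g (-1) {f, b} ::ₘ C)).step eq_of_perm rfl).trans ?_
    refine ((Rw.r_to_g (N + 1) f (had a N ::ₘ g 1 {N, N + 1} ::ₘ
      g (-1) {f, b} ::ₘ C)).step (by norm_num) rfl).trans ?_
    refine ((Rw.g_fuse 0 (-1) f {N + 1} {b} (had a N ::ₘ g 1 {N, N + 1} ::ₘ C)).step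
      eq_of_perm rfl).trans ?_
    refine ((Rw.g_fuse 1 (0 + -1) (N + 1) {N} {b} (had a N ::ₘ C)).step eq_of_perm rfl).trans ?_
    exact (Rw.had_absorb a b N C).step (by norm_num; exact eq_of_perm) rfl
  -- Here the first three spiders are contracted to a Hadamard node, which cancels the one before
  -- it.
  have hJ : had a N ::ₘ g 1 {N, N + 1} ::ₘ r 1 {N + 1, N + 2} ::ₘ g 1 {N + 2, N + 3} ::ₘ
      g (-1) {N + 3, e} ::ₘ r (-1) {e, f} ::ₘ g (-1) {f, b} ::ₘ C ≐
      g (-1) {a, e} ::ₘ r (-1) {e, f} ::ₘ g (-1) {f, b} ::ₘ C := by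
    refine ((Rw.symm (Rw.euler N (N + 3) (N + 1) (N + 2) (had a N ::ₘ
      g (-1) {N + 3, e} ::ₘ r (-1) {e, f} ::ₘ g (-1) {f, b} ::ₘ C) ?_ ?_ (by omega))
      fun h => ?_).step eq_of_perm rfl).trans ?_
    · simp only [closed_simps] at h1 ⊢
      grind
    · simp only [closed_simps] at h2 ⊢
      grind
    · simp only [closed_simps] at h h0 h1 h2 h3 ⊢
      refine ⟨fun n => ?_, h.2⟩
      have := h.1 n
      grind (splits := 25)
    refine ((Rw.had_had a N (N + 3) (g (-1) {N + 3, e} ::ₘ r (-1) {e, f} ::ₘ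
      g (-1) {f, b} ::ₘ C)).step eq_of_perm rfl).trans ?_
    exact (Rw.g_fuse 0 (-1) (N + 3) {a} {e} (r (-1) {e, f} ::ₘ g (-1) {f, b} ::ₘ C)).step
      eq_of_perm (by norm_num)
  refine Rw.trans (hI.symm fun h => ?_) hJ
  simp only [closed_simps] at h h0 h1 h2 h3 he hf ⊢
  refine ⟨fun n => ?_, h.2⟩
  have := h.1 n
  grind (splits := 25)


/-! ### Edges in graph-like diagrams -/

/-- A loop with a Hadamard node changes the phase by `π`. -/
theorem Rw.had_loop (k : ℤ) (a b : ℕ) (S : Multiset ℕ) (C : Diagram) :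
    g k (a ::ₘ b ::ₘ S) ::ₘ had a b ::ₘ C ≐ g (k + 2) S ::ₘ C := by
  obtain ⟨N, hN⟩ := exists_fresh ({a, b} + S + C.ends)
  have h0 := hN N le_rfl
  have h1 := hN (N + 1) (by omega)
  -- Both green ends of the decomposition fuse into the spider and add π/2 each; the red middle then
  -- hangs on it by two parallel wires, which the Hopf rule removes.
  refine ((Rw.euler a b N (N + 1) (g k (a ::ₘ b ::ₘ S) ::ₘ C) ?_ ?_ (by omega)).step
    eq_of_perm rfl).trans ?_
  · simp only [closed_simps] at h0 ⊢
    grind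
  · simp only [closed_simps] at h1 ⊢
    grind
  refine ((Rw.g_fuse k 1 a (b ::ₘ S) {N} (r 1 {N, N + 1} ::ₘ g 1 {N + 1, b} ::ₘ C)).step
    eq_of_perm rfl).trans ?_
  refine ((Rw.g_fuse (k + 1) 1 b (S + {N}) {N + 1} (r 1 {N, N + 1} ::ₘ C)).step
    eq_of_perm rfl).trans ?_
  refine ((Rw.hopf (k + 1 + 1) 1 N (N + 1) S 0 C).step eq_of_perm rfl).trans ?_
  exact (Rw.red_empty 1 (by norm_num) (g (k + 1 + 1) S ::ₘ C)).step eq_of_perm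
    (by rw [add_assoc]; rfl)

theorem Rw.euler_odd (k : ℤ) (hk : k % 2 = 1) (a b e f : ℕ) (C : Diagram)
    (he : ({a, b} + C.ends).count e = 0) (hf : ({a, b} + C.ends).count f = 0) (hef : e ≠ f) :
    had a b ::ₘ C ≐ g k {a, e} ::ₘ r k {e, f} ::ₘ g k {f, b} ::ₘ C := by
  rw [← g_emod, ← r_emod, ← g_emod k {f, b}]
  rcases odd_emod hk with ⟨h, -⟩ | ⟨h, -⟩ <;> rw [h]
  · exact Rw.euler a b e f C he hf hef
  · rw [g_emod, g_emod, r_emod]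
    exact Rw.euler_neg a b e f C he hf hef

/-- Read backwards: the Euler decomposition of the edge can be taken with either odd phase, and with
phase `k` its green ends cancel the two spiders of phase `-k`. -/
theorem Rw.red_edge (k : ℤ) (hk : k % 2 = 1) (a b e f : ℕ) (C : Diagram)
    (he : ({a, b} + C.ends).count e = 0) (hf : ({a, b} + C.ends).count f = 0) (hef : e ≠ f) :
    r k {a, b} ::ₘ C ≐ g (-k) {a, e} ::ₘ had e f ::ₘ g (-k) {f, b} ::ₘ C := by
  refine Rw.symm (D := g (-k) {a, e} ::ₘ had e f ::ₘ g (-k) {f, b} ::ₘ C) ?_ fun h => ?_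
  · obtain ⟨N, hN⟩ := exists_fresh ({a, b, e, f} + C.ends)
    have h0 := hN N le_rfl
    have h1 := hN (N + 1) (by omega)
    refine ((Rw.euler_odd k hk e f N (N + 1) (g (-k) {a, e} ::ₘ g (-k) {f, b} ::ₘ C) ?_ ?_
      (by omega)).step eq_of_perm rfl).trans ?_
    · simp only [closed_simps] at h0 ⊢
      grind
    · simp only [closed_simps] at h1 ⊢
      grind
    refine ((Rw.g_fuse (-k) k e {a} {N} (r k {N, N + 1} ::ₘ g k {N + 1, f} ::ₘ
      g (-k) {f, b} ::ₘ C)).step eq_of_perm rfl).trans ?_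
    refine ((Rw.g_fuse k (-k) f {N + 1} {b} (r k {N, N + 1} ::ₘ g (-k + k) ({a} + {N}) ::ₘ
      C)).step eq_of_perm rfl).trans ?_
    refine ((Rw.g_to_r (N + 1) b (r k {N, N + 1} ::ₘ g (-k + k) ({a} + {N}) ::ₘ
      C)).step (by rw [add_neg_cancel]; rfl) rfl).trans ?_
    refine ((Rw.r_fuse k 0 (N + 1) {N} {b} (g (-k + k) ({a} + {N}) ::ₘ
      C)).step eq_of_perm rfl).trans ?_
    refine ((Rw.g_to_r a N (r (k + 0) ({N} + {b}) ::ₘ C)).step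
      (by rw [neg_add_cancel]; exact eq_of_perm) rfl).trans ?_
    exact (Rw.r_fuse 0 (k + 0) N {a} {b} C).step eq_of_perm
      (by rw [zero_add, add_zero]; rfl)
  · simp only [closed_simps] at h he hf ⊢
    refine ⟨fun n => ?_, h.2⟩
    have := h.1 n
    grind

/-! ### Families of green spiders -/

/-- Green spiders, each with its phase and two groups of legs. -/
def nodes (G : Multiset (ℤ × Multiset ℕ × Multiset ℕ)) : Diagram :=
  G.map fun p => g p.1 (p.2.1 + p.2.2)

/-- The legs of the second group. -/
def tails (G : Multiset (ℤ × Multiset ℕ × Multiset ℕ)) : Multiset ℕ :=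
  (G.map fun p => p.2.2).sum

/-- Hadamard nodes. -/
def hads (H : Multiset (ℕ × ℕ)) : Diagram := H.map fun p => had p.1 p.2

@[simp] theorem nodes_zero : nodes 0 = 0 := rfl
@[simp] theorem nodes_cons (p : ℤ × Multiset ℕ × Multiset ℕ) (G) :
    nodes (p ::ₘ G) = g p.1 (p.2.1 + p.2.2) ::ₘ nodes G := Multiset.map_cons _ _ _
@[simp] theorem nodes_add (G G' : Multiset (ℤ × Multiset ℕ × Multiset ℕ)) :
    nodes (G + G') = nodes G + nodes G' := Multiset.map_add _ _ _
@[simp] theorem tails_zero : tails 0 = 0 := rfl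
@[simp] theorem tails_cons (p : ℤ × Multiset ℕ × Multiset ℕ) (G) :
    tails (p ::ₘ G) = p.2.2 + tails G := by simp [tails]
@[simp] theorem tails_add (G G' : Multiset (ℤ × Multiset ℕ × Multiset ℕ)) :
    tails (G + G') = tails G + tails G' := by simp [tails]
@[simp] theorem hads_zero : hads 0 = 0 := rfl
@[simp] theorem hads_cons (p : ℕ × ℕ) (H) : hads (p ::ₘ H) = had p.1 p.2 ::ₘ hads H :=
  Multiset.map_cons _ _ _
@[simp] theorem hads_add (H H' : Multiset (ℕ × ℕ)) : hads (H + H') = hads H + hads H' :=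
  Multiset.map_add _ _ _

theorem mem_tails {G : Multiset (ℤ × Multiset ℕ × Multiset ℕ)} {x : ℕ} (hx : x ∈ tails G) :
    ∃ k A T G', G = (k, A, x ::ₘ T) ::ₘ G' := by
  obtain ⟨p, hp, hx'⟩ := Multiset.mem_bind.1 (show x ∈ G.bind fun p => p.2.2 from hx)
  obtain ⟨G', rfl⟩ := Multiset.exists_cons_of_mem hp
  obtain ⟨T, hT⟩ := Multiset.exists_cons_of_mem hx'
  exact ⟨p.1, p.2.1, T, G', by rw [← hT]⟩

/-- A green spider joined to a family of green spiders is fused into it. -/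
theorem exists_absorb {G : Multiset (ℤ × Multiset ℕ × Multiset ℕ)} {x : ℕ} (hx : x ∈ tails G)
    (k : ℤ) (S : Multiset ℕ) :
    ∃ G' : Multiset (ℤ × Multiset ℕ × Multiset ℕ), (G'.map fun p => p.2.1) = G.map (fun p => p.2.1) ∧
      x ::ₘ tails G' = S + tails G ∧
      ∀ C, g k (x ::ₘ S) ::ₘ (nodes G + C) ≐ nodes G' + C := by
  obtain ⟨l, A, T, G, rfl⟩ := mem_tails hx
  refine ⟨(k + l, A, S + T) ::ₘ G, by simp, ?_, fun C => ?_⟩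
  · simp only [tails_cons]
    exact eq_of_perm
  · simp only [nodes_cons]
    exact (Rw.g_fuse k l x S (A + T) (nodes G + C)).step
      (by simp only [← Multiset.singleton_add, Diagram]; ac_rfl)
      (by simp only [← Multiset.singleton_add, Diagram]; ac_rfl)

/-- Supplies new inner wires for a colour change: the names are pairwise different and avoid `S`. -/
theorem exists_names (S A : Multiset ℕ) : ∃ P : Multiset (ℕ × ℕ), P.map Prod.fst = A ∧
    ∀ n, (P.map Prod.snd).count n = 0 ∨ (P.map Prod.snd).count n = 1 ∧ S.count n = 0 := by
  induction A using Multiset.induction_on with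
  | empty => exact ⟨0, rfl, fun n => Or.inl rfl⟩
  | cons a A ih =>
    obtain ⟨P, hP, h⟩ := ih
    obtain ⟨N, hN⟩ := exists_fresh (S + P.map Prod.snd)
    have := hN N le_rfl
    refine ⟨(a, N) ::ₘ P, by simp [hP], fun n => ?_⟩
    have := h n
    simp only [closed_simps, Multiset.map_cons] at *
    grind

/-- Green spiders without phase, each with two distinguished legs. -/
def stubs (P : Multiset (ℕ × ℕ × Multiset ℕ)) : Diagram :=
  P.map fun p => g 0 (p.1 ::ₘ p.2.1 ::ₘ p.2.2)

/-- The second distinguished legs. -/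
def inner (P : Multiset (ℕ × ℕ × Multiset ℕ)) : Multiset ℕ := P.map fun p => p.2.1

@[simp] theorem stubs_zero : stubs 0 = 0 := rfl
@[simp] theorem stubs_cons (p : ℕ × ℕ × Multiset ℕ) (P) :
    stubs (p ::ₘ P) = g 0 (p.1 ::ₘ p.2.1 ::ₘ p.2.2) ::ₘ stubs P := Multiset.map_cons _ _ _
@[simp] theorem inner_zero : inner 0 = 0 := rfl
@[simp] theorem inner_cons (p : ℕ × ℕ × Multiset ℕ) (P) :
    inner (p ::ₘ P) = p.2.1 ::ₘ inner P := Multiset.map_cons _ _ _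

/-- A spider moves through a spider of the other colour. -/
theorem exists_bialgebra (k : ℤ) (hk : k % 2 = 0) (P : Multiset (ℕ × ℕ × Multiset ℕ)) :
    ∀ (f u h : ℕ) (C : Diagram), ∃ Q : Multiset (ℕ × ℕ × ℕ × Multiset ℕ),
      (Q.map fun q => (q.1, q.2.2.2)) = (P.map fun p => (p.1, p.2.2)) ∧
      r k (f ::ₘ inner P) ::ₘ g 0 {f, u, h} ::ₘ (stubs P + C) ≐
        r k (u ::ₘ Q.map fun q => q.2.1) ::ₘ r k (h ::ₘ Q.map fun q => q.2.2.1) ::ₘ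
          (stubs (Q.map fun q => (q.1, q.2.1, q.2.2.1 ::ₘ q.2.2.2)) + C) := by
  induction P using Multiset.induction_on with
  | empty =>
    intro f u h C
    exact ⟨0, rfl, (Rw.red_copy k hk f u h C).step eq_of_perm
      (by simp only [Multiset.map_zero, stubs_zero]; exact eq_of_perm)⟩
  | cons p P ih =>
    obtain ⟨a, a', T⟩ := p
    intro f u h C
    obtain ⟨N, hN⟩ := exists_fresh ({a, a', f, u, h} + T + inner P + (stubs P).ends + C.ends)
    have h0 := hN N le_rfl
    have h1 := hN (N + 1) (by omega)
    have h2 := hN (N + 2) (by omega)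
    have h3 := hN (N + 3) (by omega)
    have h4 := hN (N + 4) (by omega)
    obtain ⟨Q, hQ, hr⟩ := ih N (N + 3) (N + 4) (g 0 (a ::ₘ (N + 1) ::ₘ (N + 2) ::ₘ T) ::ₘ
      r 0 {N + 1, N + 3, u} ::ₘ r 0 {N + 2, N + 4, h} ::ₘ C)
    refine ⟨(a, N + 1, N + 2, T) ::ₘ Q, by simp [hQ], ?_⟩
    simp only [Multiset.map_cons, stubs_cons, inner_cons]
    refine ((Rw.r_split 0 k N {f, a'} (inner P) (g 0 {f, u, h} ::ₘ g 0 (a ::ₘ a' ::ₘ T) ::ₘ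
      (stubs P + C)) ?_).step (by rw [zero_add]; exact eq_of_perm) rfl).trans ?_
    · simp only [closed_simps] at h0 ⊢
      grind
    refine ((Rw.bialgebra a' N u h f (N + 1) (N + 2) (N + 3) (N + 4) (r k (N ::ₘ inner P) ::ₘ
      g 0 (a ::ₘ a' ::ₘ T) ::ₘ (stubs P + C)) ?_ ?_ ?_ ?_).step eq_of_perm rfl).trans ?_
    · simp only [closed_simps] at h0 h1 ⊢
      grind
    · simp only [closed_simps] at h0 h2 ⊢
      grind
    · simp only [closed_simps] at h0 h3 ⊢
      grind
    · simp only [closed_simps] at h0 h4 ⊢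
      grind
    refine ((Rw.g_fuse 0 0 a' {N + 1, N + 2} (a ::ₘ T) (g 0 {N, N + 3, N + 4} ::ₘ
      r 0 {N + 1, N + 3, u} ::ₘ r 0 {N + 2, N + 4, h} ::ₘ r k (N ::ₘ inner P) ::ₘ
      (stubs P + C))).step eq_of_perm rfl).trans ?_
    refine (hr.step eq_of_perm rfl).trans ?_
    refine ((Rw.r_fuse k 0 (N + 3) (Q.map fun q => q.2.1) {N + 1, u} (
      r k ((N + 4) ::ₘ Q.map fun q => q.2.2.1) ::ₘ r 0 {N + 2, N + 4, h} ::ₘ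
      g 0 (a ::ₘ (N + 1) ::ₘ (N + 2) ::ₘ T) ::ₘ
      (stubs (Q.map fun q => (q.1, q.2.1, q.2.2.1 ::ₘ q.2.2.2)) + C))).step eq_of_perm rfl).trans ?_
    exact (Rw.r_fuse k 0 (N + 4) (Q.map fun q => q.2.2.1) {N + 2, h} (
      r k (u ::ₘ (N + 1) ::ₘ Q.map fun q => q.2.1) ::ₘ
      g 0 (a ::ₘ (N + 1) ::ₘ (N + 2) ::ₘ T) ::ₘ
      (stubs (Q.map fun q => (q.1, q.2.1, q.2.2.1 ::ₘ q.2.2.2)) + C))).step eq_of_perm eq_of_perm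

/-- A state of even phase is copied by a spider of the other colour. -/
theorem Rw.copy_stubs (k l : ℤ) (hk : k % 2 = 0) (hl : l % 2 = 0)
    (P : Multiset (ℕ × ℕ × Multiset ℕ)) :
    ∀ (f : ℕ) (C : Diagram), r k (f ::ₘ inner P) ::ₘ g l {f} ::ₘ (stubs P + C) ≐
      nodes (P.map fun p => (l, {p.1}, p.2.2)) + C := by
  induction P using Multiset.induction_on with
  | empty =>
    intro f C
    exact (Rw.ip l k (by omega) f C).step eq_of_perm eq_of_perm
  | cons p P ih =>
    obtain ⟨a, a', T⟩ := p
    intro f C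
    obtain ⟨N, hN⟩ := exists_fresh ({a, a', f} + T + inner P + (stubs P).ends + C.ends)
    have h0 := hN N le_rfl
    simp only [Multiset.map_cons, stubs_cons, inner_cons, nodes_cons]
    refine ((Rw.r_split 0 k N {f, a'} (inner P) (g l {f} ::ₘ g 0 (a ::ₘ a' ::ₘ T) ::ₘ
      (stubs P + C)) ?_).step (by rw [zero_add]; exact eq_of_perm) rfl).trans ?_
    · simp only [closed_simps] at h0 ⊢
      grind
    refine ((Rw.green_copy l hl f N a' (r k (N ::ₘ inner P) ::ₘ g 0 (a ::ₘ a' ::ₘ T) ::ₘ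
      (stubs P + C))).step eq_of_perm rfl).trans ?_
    refine ((Rw.g_fuse l 0 a' 0 (a ::ₘ T) (g l {N} ::ₘ r k (N ::ₘ inner P) ::ₘ
      (stubs P + C))).step eq_of_perm rfl).trans ?_
    exact (ih N (g (l + 0) (0 + a ::ₘ T) ::ₘ C)).step eq_of_perm eq_of_perm

/-- The Hadamard edges at a green spider move through a red spider. -/
theorem exists_peel (k : ℤ) (hk : k % 2 = 0) (l : ℤ) (hs : Multiset (ℕ × ℕ)) :
    ∀ (P : Multiset (ℕ × ℕ × Multiset ℕ)) (f : ℕ) (G : Multiset (ℤ × Multiset ℕ × Multiset ℕ))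
      (C : Diagram), hs.map Prod.snd ≤ tails G →
      ∃ P' f' G' E, (P'.map fun p => p.1) = (P.map fun p => p.1) ∧
        (G'.map fun p => p.2.1) = (G.map fun p => p.2.1) ∧
        (P'.map fun p => p.2.2).sum = (P.map fun p => p.2.2).sum + E.map Prod.fst ∧
        tails G' + hs.map Prod.snd = tails G + E.map Prod.snd ∧
        r k (f ::ₘ inner P) ::ₘ g l (f ::ₘ hs.map Prod.fst) ::ₘ
          (stubs P + hads hs + nodes G + C) ≐
        r k (f' ::ₘ inner P') ::ₘ g l {f'} ::ₘ (stubs P' + nodes G' + hads E + C) := by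
  induction hs using Multiset.induction_on with
  | empty =>
    intro P f G C _
    exact ⟨P, f, G, 0, rfl, rfl, by simp, by simp, (Rw.refl _).step
      (by simp only [Multiset.map_zero, hads_zero]; exact eq_of_perm) (by
        simp only [hads_zero]; exact eq_of_perm)⟩
  | cons q hs ih =>
    obtain ⟨h, h'⟩ := q
    intro P f G C hle
    simp only [Multiset.map_cons] at hle ⊢
    obtain ⟨N, hN⟩ := exists_fresh ({f, h, h'} + hs.map Prod.fst + inner P +
      (stubs P + hads hs + nodes G + C).ends)
    have h0 := hN N le_rfl
    -- One Hadamard edge is put on a three-legged green spider of its own, and the red spider moves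
    -- through it. This makes two copies of the red spider: one continues along `N`, the other faces
    -- the edge.
    obtain ⟨Q, hQ, hr⟩ := exists_bialgebra k hk P f N h (g l (N ::ₘ hs.map Prod.fst) ::ₘ had h h' ::ₘ
      (hads hs + nodes G + C))
    have hQ1 : (Q.map fun q => q.1) = P.map fun p => p.1 := by
      simpa [Multiset.map_map] using congrArg (Multiset.map Prod.fst) hQ
    have hQ2 : (Q.map fun q => q.2.2.2) = P.map fun p => p.2.2 := by
      simpa [Multiset.map_map] using congrArg (Multiset.map Prod.snd) hQ
    obtain ⟨R, hR, hR'⟩ := exists_names ({h, h'} + (Q.map fun q => q.2.2.1) +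
      Diagram.ends (r k (N ::ₘ Q.map fun q => q.2.1) ::ₘ g l (N ::ₘ hs.map Prod.fst) ::ₘ
      (stubs (Q.map fun q => (q.1, q.2.1, q.2.2.1 ::ₘ q.2.2.2)) + hads hs + nodes G + C)))
        (h ::ₘ Q.map fun q => q.2.2.1)
    obtain ⟨⟨h1, x⟩, R, rfl, rfl, hR1⟩ : ∃ q R', R = q ::ₘ R' ∧ q.1 = h ∧
        R'.map Prod.fst = Q.map fun q => q.2.2.1 := by
      have : h ∈ R.map Prod.fst := by rw [hR]; exact Multiset.mem_cons_self _ _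
      obtain ⟨q, hq, e⟩ := Multiset.mem_map.1 this
      obtain ⟨R', rfl⟩ := Multiset.exists_cons_of_mem hq
      rw [Multiset.map_cons, e, Multiset.cons_inj_right] at hR
      exact ⟨q, R', rfl, e, hR⟩
    have hmem : h' ∈ tails G := Multiset.mem_of_le hle (Multiset.mem_cons_self _ _)
    obtain ⟨G1, hG1, hG2, hG3⟩ := exists_absorb hmem k (R.map Prod.snd)
    obtain ⟨P', f', G', E, e1, e2, e3, e4, hr'⟩ := ih
      (Q.map fun q => (q.1, q.2.1, q.2.2.1 ::ₘ q.2.2.2)) N G1 (hads R + C) (by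
        have := add_le_add (le_refl (R.map Prod.snd)) hle
        rw [← hG2, Multiset.add_cons] at this
        exact (Multiset.le_add_left _ _).trans ((Multiset.cons_le_cons_iff _).1 this))
    refine ⟨P', f', G', R + E, ?_, ?_, ?_, ?_, ?_⟩
    · rw [e1, Multiset.map_map, ← hQ1]; rfl
    · rw [e2, hG1]
    · rw [e3, Multiset.map_map, Multiset.map_add, hR1, ← hQ2, ← add_assoc]
      congr 1
      clear * -
      induction Q using Multiset.induction_on with
      | empty => simp
      | cons q Q ih =>
        simp only [Multiset.map_cons, Multiset.sum_cons, Function.comp] at ih ⊢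
        rw [ih]
        exact eq_of_perm
    · rw [Multiset.map_add, ← add_assoc, add_comm (tails G), ← hG2, Multiset.add_cons, e4,
        Multiset.cons_add]
    refine ((Rw.g_split l 0 N (hs.map Prod.fst) {f, h1} (r k (f ::ₘ inner P) ::ₘ
      (stubs P + hads ((h1, h') ::ₘ hs) + nodes G + C)) ?_).step
      (by rw [add_zero]; exact eq_of_perm) rfl).trans ?_
    · simp only [closed_simps, hads_cons] at h0 ⊢
      omega
    refine (hr.step (by rw [hads_cons]; exact eq_of_perm) rfl).trans ?_
    refine ((Rw.r_colour k ((h1, x) ::ₘ R) (r k (N ::ₘ Q.map fun q => q.2.1) ::ₘ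
      (stubs (Q.map fun q => (q.1, q.2.1, q.2.2.1 ::ₘ q.2.2.2)) +
      g l (N ::ₘ hs.map Prod.fst) ::ₘ had h1 h' ::ₘ (hads hs + nodes G + C))) ?_).step
      (by rw [Multiset.map_cons, hR1]; exact eq_of_perm) rfl).trans ?_
    · intro n
      have := hR' n
      simp only [closed_simps, Multiset.map_cons, hR1] at this ⊢
      omega
    refine ((Rw.had_symm h1 h' (g k (x ::ₘ R.map Prod.snd) ::ₘ had h1 x ::ₘ
      r k (N ::ₘ Q.map fun q => q.2.1) ::ₘ hads R +
      (stubs (Q.map fun q => (q.1, q.2.1, q.2.2.1 ::ₘ q.2.2.2)) +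
      g l (N ::ₘ hs.map Prod.fst) ::ₘ (hads hs + nodes G + C)))).step
      (by simp only [Multiset.map_cons, hads]; exact eq_of_perm) rfl).trans ?_
    -- The Hadamard node created on the leg `h1` by the colour change cancels the edge being peeled
    -- off.
    refine ((Rw.had_had h' h1 x (g k (x ::ₘ R.map Prod.snd) ::ₘ
      r k (N ::ₘ Q.map fun q => q.2.1) ::ₘ hads R +
      (stubs (Q.map fun q => (q.1, q.2.1, q.2.2.1 ::ₘ q.2.2.2)) +
      g l (N ::ₘ hs.map Prod.fst) ::ₘ (hads hs + nodes G + C)))).step eq_of_perm rfl).trans ?_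
    refine ((Rw.g_fuse 0 k x {h'} (R.map Prod.snd) (
      r k (N ::ₘ Q.map fun q => q.2.1) ::ₘ hads R +
      (stubs (Q.map fun q => (q.1, q.2.1, q.2.2.1 ::ₘ q.2.2.2)) +
      g l (N ::ₘ hs.map Prod.fst) ::ₘ (hads hs + nodes G + C)))).step eq_of_perm rfl).trans ?_
    refine ((hG3 (r k (N ::ₘ Q.map fun q => q.2.1) ::ₘ hads R +
      (stubs (Q.map fun q => (q.1, q.2.1, q.2.2.1 ::ₘ q.2.2.2)) +
      g l (N ::ₘ hs.map Prod.fst) ::ₘ (hads hs + C)))).step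
      (by rw [zero_add]; exact eq_of_perm) rfl).trans ?_
    refine hr'.step ?_ (by rw [hads_add]; exact eq_of_perm)
    rw [inner, Multiset.map_map]
    simp only [Function.comp_def]
    exact eq_of_perm


/-! ### Local complementation and pivoting -/

theorem exists_map_fst_add {H : Multiset (ℕ × ℕ)} {S : Multiset ℕ} :
    ∀ {T : Multiset ℕ}, H.map Prod.fst = S + T →
      ∃ H1 H2, H = H1 + H2 ∧ H1.map Prod.fst = S ∧ H2.map Prod.fst = T := by
  induction H using Multiset.induction_on generalizing S with
  | empty =>
    intro T h
    obtain ⟨rfl, rfl⟩ := add_eq_zero.1 h.symm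
    exact ⟨0, 0, rfl, rfl, rfl⟩
  | cons p H ih =>
    intro T h
    rw [Multiset.map_cons] at h
    have : p.1 ∈ S + T := h ▸ Multiset.mem_cons_self _ _
    rcases Multiset.mem_add.1 this with h1 | h1
    · obtain ⟨S, rfl⟩ := Multiset.exists_cons_of_mem h1
      rw [Multiset.cons_add, Multiset.cons_inj_right] at h
      obtain ⟨H1, H2, rfl, rfl, rfl⟩ := ih h
      exact ⟨p ::ₘ H1, H2, by rw [Multiset.cons_add], by simp, rfl⟩
    · obtain ⟨T, rfl⟩ := Multiset.exists_cons_of_mem h1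
      rw [Multiset.add_cons, Multiset.cons_inj_right] at h
      obtain ⟨H1, H2, rfl, rfl, rfl⟩ := ih h
      exact ⟨H1, p ::ₘ H2, by rw [Multiset.add_cons], rfl, by simp⟩

theorem exists_of_map_eq_cons {α β : Type} {f : α → β} {s : Multiset α} {b : β} {t : Multiset β}
    (h : s.map f = b ::ₘ t) : ∃ a s', s = a ::ₘ s' ∧ f a = b ∧ s'.map f = t := by
  have : b ∈ s.map f := h ▸ Multiset.mem_cons_self _ _
  obtain ⟨a, ha, rfl⟩ := Multiset.mem_map.1 this
  obtain ⟨s', rfl⟩ := Multiset.exists_cons_of_mem ha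
  rw [Multiset.map_cons, Multiset.cons_inj_right] at h
  exact ⟨a, s', rfl, rfl, h⟩

/-- A red spider of odd phase is a complete graph. -/
theorem exists_complete (k : ℤ) (hk : k % 2 = 1) (S : Multiset ℕ) :
    ∀ (c : ℕ) (C : Diagram), ∃ hs G H,
      (G.map fun p => p.2.1) = S.map (fun a => ({a} : Multiset ℕ)) ∧
      tails G = hs.map Prod.snd + (H.map Prod.fst + H.map Prod.snd) ∧
      r k (c ::ₘ S) ::ₘ C ≐
        g (-k) (c ::ₘ hs.map Prod.fst) ::ₘ (hads hs + nodes G + hads H + C) := by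
  induction S using Multiset.induction_on with
  | empty =>
    intro c C
    refine ⟨0, 0, 0, rfl, rfl, (Rw.symm (Rw.state (-k) (by omega) c C) fun h => ?_).step
      (by rw [neg_neg]; rfl) eq_of_perm⟩
    simpa only [closed_simps] using h
  | cons a S ih =>
    intro c C
    obtain ⟨N, hN⟩ := exists_fresh ({c, a} + S + C.ends)
    have h0 := hN N le_rfl
    -- The legs `c` and `a` are split off onto a phase-free red spider, and the induction hypothesis
    -- treats the remaining red spider with `N` as its distinguished leg.
    obtain ⟨hs, G, H, e1, e2, h1⟩ := ih N (r 0 {N, c, a} ::ₘ C)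
    obtain ⟨M, hM⟩ := exists_fresh (Diagram.ends (g (-k) (N ::ₘ hs.map Prod.fst) ::ₘ
      (hads hs + nodes G + hads H + r 0 {N, c, a} ::ₘ C)))
    have m0 := hM M le_rfl
    have m1 := hM (M + 1) (by omega)
    -- The edges at the vertex `N` pass through the phase-free red spider, so that `c` and `a` both
    -- become adjacent to all vertices that `N` was adjacent to.
    obtain ⟨P', f', G', E, e3, e4, e5, e6, h2⟩ := exists_peel 0 rfl (-k) hs
      {(c, M, 0), (a, M + 1, 0)} N G (hads H + C) (by rw [e2]; exact Multiset.le_add_right _ _)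
    obtain ⟨c1, a1, T, T', rfl⟩ : ∃ c1 a1 T T', P' = {(c, c1, T), (a, a1, T')} := by
      simp only [Multiset.insert_eq_cons, Multiset.map_cons, Multiset.map_singleton] at e3
      obtain ⟨⟨c', c1, T⟩, P1, rfl, rfl, e⟩ := exists_of_map_eq_cons e3
      obtain ⟨⟨a', a1, T'⟩, rfl, rfl⟩ := Multiset.map_eq_singleton.1 e
      exact ⟨c1, a1, T, T', rfl⟩
    simp only [Multiset.insert_eq_cons, Multiset.map_cons, Multiset.map_singleton,
      Multiset.sum_cons, Multiset.sum_singleton, zero_add] at e5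
    obtain ⟨E1, E2, rfl, rfl, rfl⟩ := exists_map_fst_add e5.symm
    obtain ⟨L, hL⟩ := exists_fresh (Diagram.ends (g 0 {c, c1} ::ₘ g 0 {a, a1} ::ₘ
      (stubs {(c, c1, E1.map Prod.fst), (a, a1, E2.map Prod.fst)} + nodes G' + hads (E1 + E2) +
        hads H + C)))
    have l0 := hL L le_rfl
    have l1 := hL (L + 1) (by omega)
    refine ⟨(L, L + 1) ::ₘ E1, (-k, {a}, (L + 1) ::ₘ E2.map Prod.fst) ::ₘ G', H + E2, ?_, ?_, ?_⟩
    · simp [e4, e1]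
    · have e7 : tails G' + hs.map Prod.snd = H.map Prod.fst + H.map Prod.snd +
          (E1.map Prod.snd + E2.map Prod.snd) + hs.map Prod.snd := by
        rw [e6, e2, Multiset.map_add]; ac_rfl
      rw [tails_cons, add_right_cancel e7]
      simp only [Multiset.map_add, Multiset.map_cons]
      exact eq_of_perm
    refine ((Rw.r_split 0 k N {c, a} S C ?_).step (by rw [zero_add]; exact eq_of_perm) rfl).trans ?_
    · simp only [closed_simps] at h0 ⊢
      omega
    refine (h1.step eq_of_perm rfl).trans ?_
    refine ((Rw.r_wire_insert 0 c M {N, a} (g (-k) (N ::ₘ hs.map Prod.fst) ::ₘ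
      (hads hs + nodes G + hads H + C)) ?_).step eq_of_perm rfl).trans ?_
    · simp only [closed_simps] at m0 ⊢
      omega
    refine ((Rw.r_wire_insert 0 a (M + 1) {N, M} (g 0 {M, c} ::ₘ g (-k) (N ::ₘ hs.map Prod.fst) ::ₘ
      (hads hs + nodes G + hads H + C)) ?_).step eq_of_perm rfl).trans ?_
    · simp only [closed_simps] at m1 ⊢
      grind
    refine (h2.step (by
      simp only [Multiset.insert_eq_cons, stubs_cons, inner_cons, stubs_zero, inner_zero,
        ← Multiset.cons_zero]
      exact eq_of_perm) rfl).trans ?_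
    simp only [Multiset.insert_eq_cons, stubs_cons, inner_cons, stubs_zero, inner_zero,
        ← Multiset.cons_zero, hads_add, nodes_cons, hads_cons, Multiset.map_cons] at l0 l1 ⊢
    -- What is left of the vertex `N` is a state of odd phase. It turns red and fuses to a
    -- two-legged red spider between `c` and `a`, which is the missing edge together with their
    -- phases `-k`.
    refine ((Rw.state (-k) (by omega) f' (r 0 (f' ::ₘ c1 ::ₘ a1 ::ₘ 0) ::ₘ
      (g 0 (c ::ₘ c1 ::ₘ E1.map Prod.fst) ::ₘ g 0 (a ::ₘ a1 ::ₘ E2.map Prod.fst) ::ₘ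
      (nodes G' + (hads E1 + hads E2) + (hads H + C))))).step eq_of_perm rfl).trans ?_
    refine ((Rw.r_fuse 0 k f' {c1, a1} 0 
      (g 0 (c ::ₘ c1 ::ₘ E1.map Prod.fst) ::ₘ g 0 (a ::ₘ a1 ::ₘ E2.map Prod.fst) ::ₘ
      (nodes G' + (hads E1 + hads E2) + (hads H + C)))).step (by rw [neg_neg]; exact eq_of_perm)
      rfl).trans ?_
    refine ((Rw.red_edge k hk c1 a1 L (L + 1) 
      (g 0 (c ::ₘ c1 ::ₘ E1.map Prod.fst) ::ₘ g 0 (a ::ₘ a1 ::ₘ E2.map Prod.fst) ::ₘ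
      (nodes G' + (hads E1 + hads E2) + (hads H + C))) ?_ ?_ (by omega)).step
      (by rw [zero_add, add_zero]) rfl).trans ?_
    · simp only [closed_simps] at l0 ⊢
      omega
    · simp only [closed_simps] at l1 ⊢
      omega
    refine ((Rw.g_fuse 0 (-k) c1 (c ::ₘ E1.map Prod.fst) {L}
      (g 0 (a ::ₘ a1 ::ₘ E2.map Prod.fst) ::ₘ had L (L + 1) ::ₘ g (-k) {L + 1, a1} ::ₘ
      (nodes G' + (hads E1 + hads E2) + (hads H + C)))).step eq_of_perm rfl).trans ?_
    exact (Rw.g_fuse 0 (-k) a1 (a ::ₘ E2.map Prod.fst) {L + 1}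
      (g (0 + -k) (c ::ₘ E1.map Prod.fst + {L}) ::ₘ had L (L + 1) ::ₘ
      (nodes G' + (hads E1 + hads E2) + (hads H + C)))).step eq_of_perm
      (by rw [zero_add]; exact eq_of_perm)

/-- Each leg in `S` gets a phase-free green spider of its own, on which the edges created by
pivoting can be collected. -/
theorem exists_stubs (k : ℤ) (S : Multiset ℕ) : ∀ (F : Multiset ℕ) (C : Diagram),
    ∃ P : Multiset (ℕ × ℕ × Multiset ℕ), (P.map fun p => p.1) = S ∧
      (P.map fun p => p.2.2).sum = 0 ∧
      r k (F + S) ::ₘ C ≐ r k (F + inner P) ::ₘ (stubs P + C) := by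
  induction S using Multiset.induction_on with
  | empty => exact fun F C => ⟨0, rfl, rfl, (Rw.refl _).step (by simp) rfl⟩
  | cons a S ih =>
    intro F C
    obtain ⟨N, hN⟩ := exists_fresh (a ::ₘ F + S + C.ends)
    have h0 := hN N le_rfl
    obtain ⟨P, e1, e2, h⟩ := ih (N ::ₘ F) (g 0 {N, a} ::ₘ C)
    refine ⟨(a, N, 0) ::ₘ P, by simp [e1], by simp [e2], ?_⟩
    refine ((Rw.r_wire_insert k a N (F + S) C ?_).step eq_of_perm rfl).trans ?_
    · simp only [closed_simps] at h0 ⊢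
      omega
    exact h.step eq_of_perm (by simp only [stubs_cons, inner_cons]; exact eq_of_perm)

/-- Elimination of two adjacent spiders whose phases are multiples of `π`. -/
theorem exists_pivot (k l : ℤ) (hk : k % 2 = 0) (hl : l % 2 = 0) (f : ℕ) (S : Multiset ℕ)
    (hs : Multiset (ℕ × ℕ)) (G : Multiset (ℤ × Multiset ℕ × Multiset ℕ)) (C : Diagram)
    (hle : hs.map Prod.snd ≤ tails G) :
    ∃ G1 G' E, (G1.map fun p => p.2.1) = S.map (fun a => ({a} : Multiset ℕ)) ∧
      (G'.map fun p => p.2.1) = (G.map fun p => p.2.1) ∧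
      tails G1 = E.map Prod.fst ∧
      tails G' + hs.map Prod.snd = tails G + E.map Prod.snd ∧
      r k (f ::ₘ S) ::ₘ g l (f ::ₘ hs.map Prod.fst) ::ₘ (hads hs + nodes G + C) ≐
        nodes G1 + nodes G' + hads E + C := by
  obtain ⟨P, e1, e2, h1⟩ := exists_stubs k S {f} (g l (f ::ₘ hs.map Prod.fst) ::ₘ
    (hads hs + nodes G + C))
  obtain ⟨P', f', G', E, e3, e4, e5, e6, h2⟩ := exists_peel k hk l hs P f G C hle
  refine ⟨P'.map fun p => (l, {p.1}, p.2.2), G', E, ?_, e4, ?_, e6, ?_⟩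
  · rw [Multiset.map_map, ← e1, ← e3, Multiset.map_map]
    rfl
  · rw [tails, Multiset.map_map, ← zero_add (E.map Prod.fst), ← e2, ← e5]
    rfl
  refine (h1.step eq_of_perm rfl).trans ?_
  refine (h2.step eq_of_perm rfl).trans ?_
  exact (Rw.copy_stubs k l hk hl P' f' (nodes G' + hads E + C)).step eq_of_perm eq_of_perm

/-- Spiders with one marked leg are fused into other spiders. -/
theorem exists_absorb_nodes {S : Multiset ℕ} :
    ∀ {G : Multiset (ℤ × Multiset ℕ × Multiset ℕ)} (_ : S ≤ tails G)
      {G1 : Multiset (ℤ × Multiset ℕ × Multiset ℕ)}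
      (_ : (G1.map fun p => p.2.1) = S.map (fun a => ({a} : Multiset ℕ))),
    ∃ G' : Multiset (ℤ × Multiset ℕ × Multiset ℕ),
      (G'.map fun p => p.2.1) = G.map (fun p => p.2.1) ∧ tails G' + S = tails G + tails G1 ∧
      ∀ C, nodes G1 + nodes G + C ≐ nodes G' + C := by
  induction S using Multiset.induction_on with
  | empty =>
    intro G _ G1 h
    rw [Multiset.map_zero, Multiset.map_eq_zero] at h
    subst h
    exact ⟨G, rfl, by simp, fun C => (Rw.refl _).step (by simp) rfl⟩
  | cons a S ih =>
    intro G hS G1 h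
    rw [Multiset.map_cons] at h
    obtain ⟨⟨k, A, T⟩, G1, rfl, rfl, h'⟩ := exists_of_map_eq_cons h
    obtain ⟨G2, e1, e2, h2⟩ := exists_absorb (Multiset.mem_of_le hS (Multiset.mem_cons_self _ _))
      k T
    have hle : S ≤ tails G2 := by
      have := add_le_add (le_refl T) hS
      rw [← e2, Multiset.add_cons, Multiset.cons_le_cons_iff] at this
      exact (Multiset.le_add_left _ _).trans this
    obtain ⟨G', e3, e4, h3⟩ := ih hle h'
    refine ⟨G', e3.trans e1, ?_, fun C => ?_⟩
    · rw [tails_cons, Multiset.add_cons, e4, ← Multiset.cons_add, e2]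
      exact eq_of_perm
    · simp only [nodes_cons]
      exact ((h2 (nodes G1 + C)).step eq_of_perm eq_of_perm).trans (h3 C)


/-! ### Reduction of scalar diagrams -/

/-- The number represented by a scalar. -/
def Scalar.value : Scalar →* ℂ where
  toFun := Quotient.lift (fun D => D.1.value) fun D _ h => Eqv.value_eq h D.2.1
  map_one' := by
    change Diagram.value 0 = 1
    simp [Diagram.value, Diagram.entry, Diagram.internal]
  map_mul' := by
    rintro ⟨D⟩ ⟨E⟩
    exact Diagram.value_par D.2.1

theorem value_cl {D : Diagram} (h : IsStabilizerScalar D) : (cl D).value = D.value := by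
  rw [cl, dif_pos h]
  rfl

/-- If `D` is a stabilizer scalar diagram with non-zero value, then it is derivably equal to a
product of powers of `√2` and `e^{iπ/4}`. -/
def IsReducible (D : Diagram) : Prop :=
  IsStabilizerScalar D → D.value ≠ 0 → ∃ u ∈ scalarGroup, cl D = ↑u

theorem IsReducible.of_rw {D E : Diagram} (hE : IsReducible E) (h : D ≐ E) : IsReducible D := by
  intro hD hv
  obtain ⟨h1, u, hu, e⟩ := h hD
  rw [← value_cl hD, e, map_mul] at hv
  obtain ⟨v, hv', e'⟩ := hE h1 (by rw [← value_cl h1]; exact right_ne_zero_of_mul hv)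
  exact ⟨u * v, mul_mem hu hv', by rw [e, e', Units.val_mul]⟩

theorem value_green_pi : Diagram.value {g 2 0} = 0 := by
  simp [Diagram.value, Diagram.entry, Diagram.internal, g, Node.amp, quarter_two]

/-- A legless spider of phase π has value 1 + e^{iπ} = 0, which contradicts the non-zero value. -/
theorem isReducible_green_empty {k : ℤ} (hk : k % 4 = 2) (D : Diagram) :
    IsReducible (g k 0 ::ₘ D) := by
  intro h hv
  have hD : IsStabilizerScalar D := by simpa only [closed_simps, zero_add] using h
  have hg : IsStabilizerScalar {g k 0} := closed_of_count
  have h2 : IsStabilizerScalar {g 2 0} := closed_of_count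
  refine absurd ?_ hv
  rw [← value_cl h, ← Multiset.singleton_add, cl_add hg hD (by simp), map_mul, ← g_emod, hk,
    value_cl h2, value_green_pi, zero_mul]

/-- The ends of Hadamard nodes. -/
def hadEnds (H : Multiset (ℕ × ℕ)) : Multiset ℕ := H.map Prod.fst + H.map Prod.snd

@[simp] theorem hadEnds_zero : hadEnds 0 = 0 := rfl
@[simp] theorem hadEnds_cons (p : ℕ × ℕ) (H) : hadEnds (p ::ₘ H) = p.1 ::ₘ p.2 ::ₘ hadEnds H := by
  simp only [hadEnds, Multiset.map_cons]
  exact eq_of_perm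
@[simp] theorem hadEnds_add (H H' : Multiset (ℕ × ℕ)) :
    hadEnds (H + H') = hadEnds H + hadEnds H' := by
  simp only [hadEnds, Multiset.map_add]
  ac_rfl

/-- `H` and `H'` consist of the same Hadamard nodes up to orientation. -/
def HadEquiv (H H' : Multiset (ℕ × ℕ)) : Prop :=
  hadEnds H = hadEnds H' ∧ H.card = H'.card ∧ ∀ C, hads H + C ≐ hads H' + C

theorem HadEquiv.refl (H : Multiset (ℕ × ℕ)) : HadEquiv H H := ⟨rfl, rfl, fun _ => Rw.refl _⟩

theorem HadEquiv.trans {H H' H'' : Multiset (ℕ × ℕ)} (h : HadEquiv H H') (h' : HadEquiv H' H'') :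
    HadEquiv H H'' :=
  ⟨h.1.trans h'.1, h.2.1.trans h'.2.1, fun C => (h.2.2 C).trans (h'.2.2 C)⟩

theorem HadEquiv.add_left {H H' : Multiset (ℕ × ℕ)} (K : Multiset (ℕ × ℕ)) (h : HadEquiv H H') :
    HadEquiv (K + H) (K + H') :=
  ⟨by simp [h.1], by simp [h.2.1], fun C => (h.2.2 (hads K + C)).step
    (by rw [hads_add]; exact eq_of_perm) (by rw [hads_add]; exact eq_of_perm)⟩

theorem HadEquiv.flip (a b : ℕ) (H : Multiset (ℕ × ℕ)) :
    HadEquiv ((a, b) ::ₘ H) ((b, a) ::ₘ H) :=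
  ⟨by simp only [hadEnds_cons]; exact Multiset.cons_swap _ _ _, by simp, fun C =>
    (Rw.had_symm a b (hads H + C)).step (by simp) (by simp)⟩

theorem HadEquiv.swap (H : Multiset (ℕ × ℕ)) : HadEquiv H (H.map Prod.swap) := by
  induction H using Multiset.induction_on with
  | empty => exact .refl _
  | cons p H ih =>
    rw [Multiset.map_cons, ← Multiset.singleton_add, ← Multiset.singleton_add]
    refine (ih.add_left {p}).trans ?_
    rw [Multiset.singleton_add, Multiset.singleton_add]
    exact .flip p.1 p.2 _

/-- The Hadamard nodes at given legs form a loop, or can be separated from the others. -/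
theorem exists_extract (T : Multiset ℕ) : ∀ H : Multiset (ℕ × ℕ), T ≤ hadEnds H →
    (∃ a b T' H', T = a ::ₘ b ::ₘ T' ∧ HadEquiv H ((a, b) ::ₘ H')) ∨
    ∃ hs H', hs.map Prod.fst = T ∧ HadEquiv H (hs + H') := by
  induction T using Multiset.induction_on with
  | empty => exact fun H _ => .inr ⟨0, H, rfl, by rw [zero_add]; exact .refl H⟩
  | cons a T ih =>
    intro H hT
    rcases ih H ((Multiset.le_cons_self _ _).trans hT) with
      ⟨x, b, T', H', rfl, h⟩ | ⟨hs, H', rfl, h⟩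
    · exact .inl ⟨x, b, a ::ₘ T', H', by exact eq_of_perm, h⟩
    have hmem : a ∈ hs.map Prod.snd + hadEnds H' := by
      rw [h.1, hadEnds_add, hadEnds, add_assoc, ← Multiset.singleton_add,
        add_comm (hs.map Prod.fst), add_le_add_iff_right, Multiset.singleton_le] at hT
      exact hT
    -- Either `a` is the far end of a node already extracted, so both ends lie among the given legs
    -- and form a loop, or it is an end of one of the remaining nodes, to be oriented suitably.
    rcases Multiset.mem_add.1 hmem with h1 | h1
    · obtain ⟨⟨x, b⟩, hp, rfl⟩ := Multiset.mem_map.1 h1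
      obtain ⟨hs, rfl⟩ := Multiset.exists_cons_of_mem hp
      refine .inl ⟨b, x, hs.map Prod.fst, hs + H', by simp, h.trans ?_⟩
      rw [Multiset.cons_add]
      exact .flip _ _ _
    rcases Multiset.mem_add.1 h1 with h2 | h2
    · obtain ⟨p, hp, rfl⟩ := Multiset.mem_map.1 h2
      obtain ⟨H', rfl⟩ := Multiset.exists_cons_of_mem hp
      exact .inr ⟨p ::ₘ hs, H', by simp, by
        rw [Multiset.cons_add, ← Multiset.add_cons]; exact h⟩
    · obtain ⟨⟨x, b⟩, hp, rfl⟩ := Multiset.mem_map.1 h2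
      obtain ⟨H', rfl⟩ := Multiset.exists_cons_of_mem hp
      exact .inr ⟨(b, x) ::ₘ hs, H', by simp, by
        rw [Multiset.cons_add, ← Multiset.add_cons]
        exact h.trans ((HadEquiv.flip _ _ _).add_left _)⟩

/-- Green spiders joined by Hadamard nodes. -/
def IsGraph (G : Multiset (ℤ × Multiset ℕ × Multiset ℕ)) (H : Multiset (ℕ × ℕ)) : Prop :=
  (∀ A ∈ G.map (fun p => p.2.1), A = 0) ∧ tails G = hadEnds H

theorem card_of_map_eq {G G' : Multiset (ℤ × Multiset ℕ × Multiset ℕ)}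
    (h : (G'.map fun p => p.2.1) = G.map (fun p => p.2.1)) : G'.card = G.card := by
  simpa using congrArg Multiset.card h

/-- A green spider whose edges have been separated from the others becomes red. -/
theorem Rw.graph_to_red (k : ℤ) (hs : Multiset (ℕ × ℕ)) (C : Diagram) :
    g k (hs.map Prod.fst) ::ₘ (hads hs + C) ≐ r k (hs.map Prod.snd) ::ₘ C := by
  refine (((HadEquiv.swap hs).2.2 (g k (hs.map Prod.fst) ::ₘ C)).step eq_of_perm rfl).trans ?_
  refine (Rw.r_uncolour k (hs.map Prod.swap) C).step ?_ ?_
  · simp only [Multiset.map_map, Function.comp_def, hads, Prod.fst_swap, Prod.snd_swap]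
    exact eq_of_perm
  · simp only [Multiset.map_map, Function.comp_def, Prod.fst_swap]

/-- Local complementation. In red, the spider is joined to its neighbours by plain wires; as a
complete graph on these wires it is fused into the neighbours, and one spider has gone. If there are
no neighbours it is a unit. -/
theorem isReducible_of_odd {k : ℤ} (hk : k % 2 = 1) {hs : Multiset (ℕ × ℕ)}
    {G : Multiset (ℤ × Multiset ℕ × Multiset ℕ)} {H : Multiset (ℕ × ℕ)}
    (hG : ∀ A ∈ G.map (fun p => p.2.1), A = 0) (ht : tails G = hs.map Prod.snd + hadEnds H)
    (ih : ∀ G' H', G'.card = G.card → IsGraph G' H' → IsReducible (nodes G' + hads H')) :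
    IsReducible (g k (hs.map Prod.fst) ::ₘ (hads hs + (nodes G + hads H))) := by
  refine IsReducible.of_rw ?_ (Rw.graph_to_red k hs _)
  rcases Multiset.empty_or_exists_mem (hs.map Prod.snd) with h0 | ⟨c, hc⟩
  · rw [h0, zero_add] at ht
    rw [h0]
    exact (ih G H rfl ⟨hG, ht⟩).of_rw (Rw.red_empty k (by omega) _)
  obtain ⟨S, hS⟩ := Multiset.exists_cons_of_mem hc
  rw [hS] at ht ⊢
  obtain ⟨hs', G1, H1, e1, e2, h⟩ := exists_complete k hk S c (nodes G + hads H)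
  -- The distinguished vertex at `c` is treated on a par with the other vertices of the complete
  -- graph.
  obtain ⟨G', e3, e4, h'⟩ := exists_absorb_nodes (S := c ::ₘ S) (G := G)
    (by rw [ht]; exact Multiset.le_add_right _ _) (G1 := (-k, {c}, hs'.map Prod.fst) ::ₘ G1)
    (by simp [e1])
  refine IsReducible.of_rw (ih G' (hs' + H1 + H) (card_of_map_eq e3) ⟨by rwa [e3], ?_⟩)
    (h.trans ((h' (hads hs' + hads H1 + hads H)).step ?_ ?_))
  · rw [ht, tails_cons, e2] at e4
    refine add_right_cancel (b := c ::ₘ S) (e4.trans ?_)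
    simp only [hadEnds, Multiset.map_add]
    ac_rfl
  · simp only [nodes_cons]
    exact eq_of_perm
  · simp only [hads_add]

theorem le_of_le_add_of_disjoint {S T U : Multiset ℕ} (h : T ≤ S + U)
    (hd : ∀ x ∈ S, x ∉ T) : T ≤ U := by
  rw [Multiset.le_iff_count] at h ⊢
  intro x
  have := h x
  rw [Multiset.count_add] at this
  by_cases hx : x ∈ S
  · rw [Multiset.count_eq_zero_of_notMem (hd x hx)]
    exact Nat.zero_le _
  · rw [Multiset.count_eq_zero_of_notMem hx] at this
    omega

/-- Lexicographic induction on the numbers of spiders and of Hadamard edges. Complementation and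
pivoting may add many edges but remove spiders; removing loops or parallel edges keeps the spiders
and lowers the number of edges. -/
theorem isReducible_graph (n : ℕ) : ∀ (m : ℕ) (G : Multiset (ℤ × Multiset ℕ × Multiset ℕ))
    (H : Multiset (ℕ × ℕ)), G.card = n → H.card = m → IsGraph G H →
    IsReducible (nodes G + hads H) := by
  induction n using Nat.strong_induction_on with | _ n ihn => ?_
  intro m
  induction m using Nat.strong_induction_on with | _ m ihm => ?_
  intro G H hn hm hGH
  by_cases hloop : ∃ k A T G' a b T' H', G = (k, A, T) ::ₘ G' ∧ T = a ::ₘ b ::ₘ T' ∧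
      HadEquiv H ((a, b) ::ₘ H')
  · obtain ⟨k, A, T, G', a, b, T', H', rfl, rfl, h⟩ := hloop
    have hc := h.2.1
    rw [Multiset.card_cons] at hc
    refine IsReducible.of_rw (ihm H'.card (by omega) ((k + 2, A, T') ::ₘ G') H' (by simpa using hn)
      rfl ⟨by simpa using hGH.1, ?_⟩) (((h.2.2 _).step (add_comm _ _) rfl).trans
        ((Rw.had_loop k a b (A + T') (nodes G' + hads H')).step ?_ ?_))
    · have := hGH.2.trans h.1
      simpa using this
    · simp only [nodes_cons, hads_cons]
      exact eq_of_perm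
    · simp only [nodes_cons]
      exact eq_of_perm
  -- Without Hadamard loops, the edges at chosen legs of one spider can be oriented away from it and
  -- separated from the others. The spider may stand first or second in `G`, as pivoting treats two
  -- of them in turn.
  have hsep : ∀ {k A S T U G' K H'}, U = S + T →
      (G = (k, A, U) ::ₘ G' ∨ ∃ q, G = q ::ₘ (k, A, U) ::ₘ G') →
      HadEquiv H (K + H') → T ≤ hadEnds H' →
      ∃ hs H'', hs.map Prod.fst = T ∧ HadEquiv H' (hs + H'') := by
    rintro k A S T _ G' K H' rfl hG hH hT
    rcases exists_extract T H' hT with ⟨a, b, T', H'', rfl, h⟩ | h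
    · refine absurd ?_ hloop
      have h2 : HadEquiv H ((a, b) ::ₘ (K + H'')) := by
        rw [← Multiset.add_cons]
        exact hH.trans (h.add_left K)
      rcases hG with rfl | ⟨q, rfl⟩
      · exact ⟨k, A, _, G', a, b, S + T', K + H'', rfl, by exact eq_of_perm, h2⟩
      · exact ⟨k, A, _, q ::ₘ G', a, b, S + T', K + H'', Multiset.cons_swap _ _ _,
          by exact eq_of_perm, h2⟩
    · exact h
  by_cases hodd : ∃ p ∈ G, p.1 % 2 = 1
  · obtain ⟨⟨k, A, T⟩, hp, hk⟩ := hodd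
    obtain ⟨G, rfl⟩ := Multiset.exists_cons_of_mem hp
    obtain ⟨hA, ht⟩ := hGH
    simp only [Multiset.map_cons, Multiset.forall_mem_cons, tails_cons] at hA ht
    obtain ⟨rfl, hA⟩ := hA
    obtain ⟨hs, H', rfl, h⟩ := hsep (K := 0) (zero_add _).symm (Or.inl rfl) (by rw [zero_add]; exact .refl H)
      (ht ▸ Multiset.le_add_right _ _)
    rw [Multiset.card_cons] at hn
    refine IsReducible.of_rw (isReducible_of_odd hk (hs := hs) (G := G) (H := H') hA ?_
      fun G' H'' e hG' => ihn G'.card (by omega) _ G' H'' rfl rfl hG')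
      (((h.2.2 _).step (add_comm _ _) rfl).trans ((Rw.refl _).step ?_ rfl))
    · rw [h.1, hadEnds_add, hadEnds, add_assoc] at ht
      exact add_left_cancel ht
    · simp only [nodes_cons, hads_add, zero_add]
      exact eq_of_perm
  rcases Multiset.empty_or_exists_mem G with rfl | ⟨⟨k, A, T⟩, hp⟩
  · have h0 := congrArg Multiset.card hGH.2
    simp only [tails_zero, hadEnds, Multiset.card_add, Multiset.card_map, Multiset.card_zero] at h0
    obtain rfl : H = 0 := Multiset.card_eq_zero.1 (by omega)
    exact fun _ _ => ⟨1, one_mem _, by simp [cl_zero]⟩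
  have hk : k % 2 = 0 := (Int.emod_two_eq_zero_or_one k).resolve_right fun h => hodd ⟨_, hp, h⟩
  obtain ⟨G, rfl⟩ := Multiset.exists_cons_of_mem hp
  obtain ⟨hA, ht⟩ := hGH
  simp only [Multiset.map_cons, Multiset.forall_mem_cons, tails_cons] at hA ht
  obtain ⟨rfl, hA⟩ := hA
  rw [Multiset.card_cons] at hn
  obtain ⟨hs, H', rfl, h⟩ := hsep (K := 0) (zero_add _).symm (Or.inl rfl) (by rw [zero_add]; exact .refl H)
      (ht ▸ Multiset.le_add_right _ _)
  rw [h.1, hadEnds_add, hadEnds, add_assoc] at ht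
  replace ht := add_left_cancel ht
  refine IsReducible.of_rw (E := g k (hs.map Prod.fst) ::ₘ (hads hs + (nodes G + hads H'))) ?_
    (((h.2.2 _).step (add_comm _ _) rfl).trans ((Rw.refl _).step
      (by simp only [nodes_cons, hads_add, zero_add]; exact eq_of_perm) rfl))
  -- An isolated spider is either a unit or has phase π, and then the value is zero.
  rcases Multiset.empty_or_exists_mem hs with rfl | ⟨⟨x, f⟩, hq⟩
  · simp only [Multiset.map_zero, hads_zero, zero_add] at ht ⊢
    by_cases hk4 : k % 4 = 2
    · exact isReducible_green_empty hk4 _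
    · exact IsReducible.of_rw (ihn G.card (by omega) _ G H' rfl rfl ⟨hA, ht⟩)
        (Rw.green_empty k hk4 _)
  refine IsReducible.of_rw ?_ (Rw.graph_to_red k hs _)
  have hcard := h.2.1
  obtain ⟨hs, rfl⟩ := Multiset.exists_cons_of_mem hq
  simp only [Multiset.map_cons, Multiset.card_add, Multiset.card_cons] at ht hcard ⊢
  obtain ⟨l, A, T, G, rfl⟩ := mem_tails (G := G) (x := f) (by simp [ht])
  have hl : l % 2 = 0 := (Int.emod_two_eq_zero_or_one l).resolve_right fun h =>
    hodd ⟨(l, A, f ::ₘ T), by simp, h⟩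
  simp only [Multiset.map_cons, Multiset.forall_mem_cons, tails_cons, Multiset.cons_add,
    Multiset.cons_inj_right] at hA ht
  obtain ⟨rfl, hA⟩ := hA
  rw [Multiset.card_cons] at hn
  simp only [nodes_cons, zero_add]
  -- The chosen spider is red at this point, so parallel edges to its neighbour are parallel plain
  -- wires. The Hopf rule deletes two of them, and changing the colour back yields a graph with two
  -- edges fewer.
  by_cases hpar : ∃ y ∈ hs.map Prod.snd, y ∈ T
  · obtain ⟨y, hy, hyT⟩ := hpar
    obtain ⟨T, rfl⟩ := Multiset.exists_cons_of_mem hyT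
    obtain ⟨q, hq, rfl⟩ := Multiset.mem_map.1 hy
    obtain ⟨hs, rfl⟩ := Multiset.exists_cons_of_mem hq
    obtain ⟨P, hP, hP'⟩ := exists_names (hs.map Prod.snd + Diagram.ends (g l T ::ₘ
      (nodes G + hads H'))) (hs.map Prod.snd)
    simp only [Multiset.map_cons, Multiset.cons_add, Multiset.cons_inj_right,
      Multiset.card_cons] at ht hcard ⊢
    have hPc : P.card = hs.card := by simpa using congrArg Multiset.card hP
    refine IsReducible.of_rw (ihm (P + H').card (by rw [Multiset.card_add]; omega)
      ((k, 0, P.map Prod.snd) ::ₘ (l, 0, T) ::ₘ G) (P + H') (by simpa using hn) rfl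
      ⟨by simpa using hA, ?_⟩)
      (((Rw.hopf l k f q.2 T (hs.map Prod.snd) (nodes G + hads H')).step eq_of_perm rfl).trans
        ((Rw.r_colour k P (g l T ::ₘ (nodes G + hads H')) ?_).step (by rw [hP]; exact eq_of_perm) ?_))
    · rw [tails_cons, tails_cons, ht, hadEnds_add, hadEnds, hadEnds, hP]
      simp only
      ac_rfl
    · intro x
      rw [hP]
      exact hP' x
    · simp only [nodes_cons, hads_add, zero_add]
      rw [← hads]
      exact eq_of_perm
  have hTle : T ≤ hadEnds H' := le_of_le_add_of_disjoint (S := hs.map Prod.snd)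
    (by rw [← ht]; exact Multiset.le_add_right _ _) fun y hy hyT => hpar ⟨y, hy, hyT⟩
  -- The only edge between the two spiders is now the wire `f`, so the other edges of the neighbour
  -- can be separated too and the pair is pivoted away.
  obtain ⟨hs2, H2, rfl, h2⟩ := hsep (Multiset.singleton_add f T).symm (Or.inr ⟨_, rfl⟩) h hTle
  have ht2 : tails G = hs.map Prod.snd + hs2.map Prod.snd + hadEnds H2 := by
    rw [h2.1, hadEnds_add, hadEnds] at ht
    refine add_left_cancel (a := hs2.map Prod.fst) (ht.trans ?_)
    ac_rfl
  obtain ⟨G1, G', E, e1, e2, e3, e4, hr⟩ := exists_pivot k l hk hl f (hs.map Prod.snd) hs2 G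
    (hads H2) (by rw [ht2, add_right_comm]; exact Multiset.le_add_left _ _)
  have e5 : tails G' = hs.map Prod.snd + hadEnds H2 + E.map Prod.snd := by
    refine add_right_cancel (e4.trans ?_) (b := hs2.map Prod.snd)
    rw [ht2]
    ac_rfl
  obtain ⟨G2, e6, e7, hr'⟩ := exists_absorb_nodes (S := hs.map Prod.snd) (G := G')
    (by rw [e5, add_assoc]; exact Multiset.le_add_right _ _) e1
  have hc := (card_of_map_eq e6).trans (card_of_map_eq e2)
  refine IsReducible.of_rw (ihn G2.card (by omega) _ G2 (E + H2) rfl rfl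
    ⟨by rwa [e6, e2], ?_⟩) (((h2.2.2 (r k (f ::ₘ hs.map Prod.snd) ::ₘ
      g l (f ::ₘ hs2.map Prod.fst) ::ₘ nodes G)).step eq_of_perm rfl).trans
      ((hr.step ?_ rfl).trans ((hr' (hads E + hads H2)).step ?_ ?_)))
  · rw [e5, e3] at e7
    refine add_right_cancel (e7.trans ?_) (b := hs.map Prod.snd)
    rw [hadEnds_add, hadEnds, hadEnds]
    ac_rfl
  · rw [hads_add]
    exact eq_of_perm
  · exact eq_of_perm
  · rw [hads_add]

/-! ### From arbitrary diagrams to graphs -/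

/-- Green spiders and Hadamard nodes such that no two Hadamard nodes meet. -/
def IsPregraph (G : Multiset (ℤ × Multiset ℕ × Multiset ℕ)) (H : Multiset (ℕ × ℕ)) : Prop :=
  (∀ A ∈ G.map (fun p => p.2.1), A = 0) ∧ ∃ X, tails G = X + hadEnds H

theorem nodes_ends {G : Multiset (ℤ × Multiset ℕ × Multiset ℕ)}
    (hG : ∀ A ∈ G.map (fun p => p.2.1), A = 0) : (nodes G).ends = tails G := by
  induction G using Multiset.induction_on with
  | empty => rfl
  | cons p G ih =>
    rw [Multiset.map_cons, Multiset.forall_mem_cons] at hG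
    rw [nodes_cons, Diagram.ends_cons, ih hG.2, g_ends, hG.1, zero_add, tails_cons]

theorem hads_ends (H : Multiset (ℕ × ℕ)) : (hads H).ends = hadEnds H := by
  rw [hads, ends_map_had, hadEnds, add_comm]

/-- Here `X` collects the ends of plain wires between spiders. Each such wire is a self-loop or
joins two spiders; removing the loop or fusing the spiders takes two elements out of `X`. -/
theorem isReducible_pregraph (n : ℕ) : ∀ (X : Multiset ℕ)
    (G : Multiset (ℤ × Multiset ℕ × Multiset ℕ)) (H : Multiset (ℕ × ℕ)), X.card = n →
    (∀ A ∈ G.map (fun p => p.2.1), A = 0) → tails G = X + hadEnds H →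
    IsReducible (nodes G + hads H) := by
  induction n using Nat.strong_induction_on with | _ n ih => ?_
  intro X G H hn hG hX
  rcases Multiset.empty_or_exists_mem X with rfl | ⟨x, hx⟩
  · exact isReducible_graph _ _ G H rfl rfl ⟨hG, by rw [hX, zero_add]⟩
  refine fun hD => ?_
  have h2 := hD.1 x
  rw [Diagram.ends_add, nodes_ends hG, hads_ends, hX] at h2
  simp only [Multiset.count_add] at h2
  have h3 := Multiset.count_pos.2 hx
  obtain ⟨X, rfl⟩ := Multiset.exists_cons_of_mem hx
  rw [Multiset.count_cons_self] at h2 h3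
  -- An end at a Hadamard node is counted twice, once there and once at a spider; as the total is
  -- two, the name must occur twice in `X`.
  obtain ⟨X, rfl⟩ := Multiset.exists_cons_of_mem (Multiset.count_pos.1 (by omega :
    0 < X.count x))
  rw [Multiset.card_cons, Multiset.card_cons] at hn
  obtain ⟨k, A, T, G, rfl⟩ := mem_tails (x := x) (G := G) (by simp [hX])
  simp only [Multiset.map_cons, Multiset.forall_mem_cons, tails_cons, Multiset.cons_add,
    Multiset.cons_inj_right] at hG hX
  obtain ⟨rfl, hG⟩ := hG
  refine (?_ : IsReducible _) hD
  rcases Multiset.mem_add.1 (show x ∈ T + tails G by simp [hX]) with hT | hT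
  · obtain ⟨T, rfl⟩ := Multiset.exists_cons_of_mem hT
    rw [Multiset.cons_add, Multiset.cons_inj_right] at hX
    refine IsReducible.of_rw (ih X.card (by omega) X ((k, 0, T) ::ₘ G) H rfl (by simpa using hG)
      (by simpa using hX)) ((Rw.g_loop k x T (nodes G + hads H)).step ?_ ?_) <;>
    · simp only [nodes_cons]
      exact eq_of_perm
  · obtain ⟨l, A, T', G, rfl⟩ := mem_tails hT
    simp only [Multiset.map_cons, Multiset.forall_mem_cons, tails_cons, Multiset.cons_add,
      Multiset.add_cons, Multiset.cons_inj_right] at hG hX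
    obtain ⟨rfl, hG⟩ := hG
    refine IsReducible.of_rw (ih X.card (by omega) X ((k + l, 0, T + T') ::ₘ G) H rfl
      (by simpa using hG) (by simpa [add_assoc] using hX))
      ((Rw.g_fuse k l x T T' (nodes G + hads H)).step ?_ ?_) <;>
    · simp only [nodes_cons]
      exact eq_of_perm

theorem IsPregraph.add {G G' : Multiset (ℤ × Multiset ℕ × Multiset ℕ)} {H H' : Multiset (ℕ × ℕ)}
    (h : IsPregraph G H) (h' : IsPregraph G' H') : IsPregraph (G + G') (H + H') := by
  obtain ⟨hG, X, hX⟩ := h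
  obtain ⟨hG', X', hX'⟩ := h'
  refine ⟨fun A hA => ?_, X + X', ?_⟩
  · rw [Multiset.map_add] at hA
    exact (Multiset.mem_add.1 hA).elim (hG A) (hG' A)
  · rw [tails_add, hX, hX', hadEnds_add]
    ac_rfl

theorem isPregraph_single (k : ℤ) (S : Multiset ℕ) : IsPregraph {(k, 0, S)} 0 :=
  ⟨by simp, S, by simp [tails]⟩

/-- Spiders are inserted at the legs of Hadamard nodes. -/
theorem exists_pregraph_had (a b : ℕ) (C : Diagram) :
    ∃ G H, IsPregraph G H ∧ had a b ::ₘ C ≐ nodes G + hads H + C := by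
  obtain ⟨N, hN⟩ := exists_fresh ({a, b} + C.ends)
  have h0 := hN N le_rfl
  have h1 := hN (N + 1) (by omega)
  refine ⟨{(0, 0, {N, b}), (0, 0, {N + 1, a})}, {(N, N + 1)}, ⟨by simp, {a, b}, ?_⟩, ?_⟩
  · simp only [tails, hadEnds, Multiset.insert_eq_cons, Multiset.map_cons, Multiset.map_singleton,
      Multiset.sum_cons, Multiset.sum_singleton]
    exact eq_of_perm
  refine (Rw.had_insert a b N C h0).trans ?_
  refine (Rw.had_symm a N (g 0 {N, b} ::ₘ C)).trans ?_
  refine (Rw.had_insert N a (N + 1) (g 0 {N, b} ::ₘ C) ?_).step rfl ?_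
  · simp only [closed_simps] at h0 h1 ⊢
    grind
  · simp only [nodes, hads, Multiset.insert_eq_cons, Multiset.map_cons, Multiset.map_singleton,
      zero_add]
    exact eq_of_perm

theorem exists_pregraph_hads (P : Multiset (ℕ × ℕ)) : ∀ C : Diagram,
    ∃ G H, IsPregraph G H ∧ hads P + C ≐ nodes G + hads H + C := by
  induction P using Multiset.induction_on with
  | empty => exact fun C => ⟨0, 0, ⟨by simp, 0, rfl⟩, (Rw.refl _).step rfl (by simp)⟩
  | cons p P ih =>
    intro C
    obtain ⟨G, H, h, hr⟩ := ih (had p.1 p.2 ::ₘ C)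
    obtain ⟨G', H', h', hr'⟩ := exists_pregraph_had p.1 p.2 (nodes G + hads H + C)
    refine ⟨G + G', H + H', h.add h', (hr.step ?_ rfl).trans (hr'.step ?_ ?_)⟩
    · rw [hads_cons]
      exact eq_of_perm
    · exact eq_of_perm
    · rw [nodes_add, hads_add]
      exact eq_of_perm

theorem mem_stabilizerPhases {α : Real.Angle} (h : α ∈ stabilizerPhases) : ∃ k, α = quarter k := by
  obtain ⟨k, rfl⟩ := h
  refine ⟨k, ?_⟩
  simp only [quarter]
  rw [← Real.Angle.coe_zsmul, zsmul_eq_mul]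

/-- Red spiders change colour, a wire is a phase-free green spider, a star is a unit, and each
Hadamard node created or already present is shielded by spiders at both legs. -/
theorem exists_pregraph_node (v : Node) (hv : v.PhaseIn stabilizerPhases) (C : Diagram) :
    ∃ G H, IsPregraph G H ∧ v ::ₘ C ≐ nodes G + hads H + C := by
  cases v with
  | green α S =>
    obtain ⟨k, rfl⟩ := mem_stabilizerPhases hv
    exact ⟨{(k, 0, S)}, 0, isPregraph_single k S, (Rw.refl _).step rfl (by simp [nodes, g])⟩
  | red α S =>
    obtain ⟨k, rfl⟩ := mem_stabilizerPhases hv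
    obtain ⟨P, rfl, hP⟩ := exists_names (S + C.ends) S
    obtain ⟨G, H, h, hr⟩ := exists_pregraph_hads P (g k (P.map Prod.snd) ::ₘ C)
    refine ⟨{(k, 0, P.map Prod.snd)} + G, 0 + H, (isPregraph_single _ _).add h,
      (Rw.r_colour k P C hP).trans (hr.step ?_ ?_)⟩
    · rw [hads]
      exact eq_of_perm
    · rw [Multiset.singleton_add, nodes_cons, zero_add, zero_add]
      exact eq_of_perm
  | had a b => exact exists_pregraph_had a b C
  | star => exact ⟨0, 0, ⟨by simp, 0, rfl⟩, (Rw.star C).step rfl (by simp)⟩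
  | wire a b =>
    refine ⟨{(0, 0, {a, b})}, 0, isPregraph_single _ _, Rw.of_closed fun hD =>
      (Rw.symm (Rw.of_rule (C := C) (Rule.g_wire a b) fun h => ?_) fun h => ?_).step
        eq_of_perm ?_⟩
    · simpa only [closed_simps] using h
    · simpa only [closed_simps] using h
    · simp [nodes]

theorem exists_pregraph (D : Diagram) (hD : Phases D) : ∀ C : Diagram,
    ∃ G H, IsPregraph G H ∧ D + C ≐ nodes G + hads H + C := by
  induction D using Multiset.induction_on with
  | empty => exact fun C => ⟨0, 0, ⟨by simp, 0, rfl⟩, (Rw.refl _).step rfl (by simp)⟩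
  | cons v D ih =>
    intro C
    rw [phases_cons] at hD
    obtain ⟨G, H, h, hr⟩ := ih hD.2 (v ::ₘ C)
    obtain ⟨G', H', h', hr'⟩ := exists_pregraph_node v hD.1 (nodes G + hads H + C)
    refine ⟨G + G', H + H', h.add h', (hr.step ?_ rfl).trans (hr'.step ?_ ?_)⟩
    · exact eq_of_perm
    · exact eq_of_perm
    · rw [nodes_add, hads_add]
      exact eq_of_perm

theorem isReducible (D : Diagram) : IsReducible D := by
  intro hD
  obtain ⟨G, H, ⟨hG, X, hX⟩, hr⟩ := exists_pregraph D hD.2 0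
  exact ((isReducible_pregraph _ X G H rfl hG hX).of_rw
    (hr.step (add_zero _).symm (add_zero _))) hD


/-! ### Normal forms -/

theorem value_ip (a b : ℤ) : (ip a b).value =
    (1 + ((quarter b).toCircle : ℂ)) / (Real.sqrt 2 : ℂ) +
      (quarter a).toCircle * ((1 - ((quarter b).toCircle : ℂ)) / (Real.sqrt 2 : ℂ)) := by
  rw [ip, value_cl (closed_ip _ _ _)]
  have h : Diagram.internal {g a {0}, r b {0}} = {0} := by
    ext n
    simp only [Diagram.internal, closed_simps, Finset.mem_filter, Multiset.mem_toFinset,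
      Multiset.mem_add, Multiset.mem_singleton, Finset.mem_singleton]
    grind
  rw [Diagram.value, Diagram.entry, h, show ({0} : Finset ℕ).powerset = {∅, {0}} from rfl,
    Finset.sum_pair (by simp)]
  simp [g, r, Node.amp, ket0, ket1, ketPlus, ketMinus]
  ring

theorem value_tU : Scalar.value (tU : Scalar) = (Real.sqrt 2 : ℂ) := by
  rw [tU_val, value_ip]
  simp only [quarter_zero, Real.Angle.toCircle_zero, Circle.coe_one, sub_self, zero_div, mul_zero,
    add_zero]
  rw [div_eq_iff sqrt_two_ne_zero, sqrt_two_mul_self]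
  norm_num

theorem value_omega : Scalar.value (omega : Scalar) = Complex.exp (Complex.I * Real.pi / 4) := by
  -- The value of ω is obtained from ω⟨-π/2|-π/2⟩ = t² by dividing 2 by √2(1 - i).
  have h : ((omega * p7U : Scalarˣ) : Scalar) = (tU * tU : Scalarˣ) := by
    rw [omega, inv_mul_cancel_right]
  have h1 := congrArg Scalar.value h
  rw [Units.val_mul, Units.val_mul, map_mul, map_mul, value_tU, sqrt_two_mul_self] at h1
  have h2 : Scalar.value (p7U : Scalar) = (Real.sqrt 2 : ℂ) * (1 - Complex.I) := by
    change (ip (-1) (-1)).value = _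
    have h3 : (((quarter (-1)).toCircle : Circle) : ℂ) = -Complex.I := by
      rw [quarter_neg_one, Real.Angle.toCircle_coe, Circle.coe_exp, Complex.ofReal_neg, neg_mul,
        Complex.exp_neg]
      push_cast
      rw [Complex.exp_pi_div_two_mul_I, Complex.inv_I]
    rw [value_ip, h3]
    field_simp
    rw [sq, sqrt_two_mul_self]
    linear_combination (-1 : ℂ) * Complex.I_sq
  have h4 : Complex.exp (Complex.I * Real.pi / 4) = (Real.sqrt 2 : ℂ) / 2 * (1 + Complex.I) := by
    rw [show Complex.I * Real.pi / 4 = ((Real.pi / 4 : ℝ) : ℂ) * Complex.I by push_cast; ring,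
      Complex.exp_mul_I, ← Complex.ofReal_cos, ← Complex.ofReal_sin, Real.cos_pi_div_four,
      Real.sin_pi_div_four]
    push_cast
    ring
  have h5 : (Real.sqrt 2 : ℂ) * (1 - Complex.I) ≠ 0 := by
    intro h0
    rw [h2, h0, mul_zero] at h1
    norm_num at h1
  rw [h2] at h1
  rw [h4]
  refine mul_right_cancel₀ h5 (h1.trans ?_)
  linear_combination (-(1 - Complex.I ^ 2) / 2) * sqrt_two_mul_self + Complex.I_sq

theorem value_omega_pow (s : ℕ) (m : ℤ) :
    Scalar.value ((omega ^ s * tU ^ m : Scalarˣ) : Scalar) =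
      (Real.sqrt 2 : ℂ) ^ m * Complex.exp (Complex.I * (s : ℂ) * Real.pi / 4) := by
  change ((Units.map Scalar.value (omega ^ s * tU ^ m) : ℂˣ) : ℂ) = _
  rw [map_mul, map_pow, map_zpow, Units.val_mul, Units.val_pow_eq_pow_val,
    Units.val_zpow_eq_zpow_val, Units.coe_map, Units.coe_map]
  change Scalar.value omega ^ s * Scalar.value tU ^ m = _
  rw [value_omega, value_tU, ← Complex.exp_nat_mul, mul_comm]
  congr 2
  ring

theorem closed_copies {D : Diagram} (h : IsStabilizerScalar D) (n : ℕ) :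
    IsStabilizerScalar (D.copies n) := by
  induction n with
  | zero => exact IsStabilizerScalar.zero
  | succ n ih => exact h.par ih

theorem cl_copies {D : Diagram} (h : IsStabilizerScalar D) (n : ℕ) :
    cl (D.copies n) = cl D ^ n := by
  induction n with
  | zero => rw [Diagram.copies, cl_zero, pow_zero]
  | succ n ih => rw [Diagram.copies, cl_par h (closed_copies h n), ih, pow_succ']

theorem innerprod_eq (a b : ℤ) :
    Diagram.innerprod 0 (quarter a) (quarter b) = {g a {0}, r b {0}} := rfl

theorem innerprod_zero : Diagram.innerprod 0 0 0 = {g 0 {0}, r 0 {0}} := by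
  rw [← innerprod_eq, quarter_zero]

/-- The power of `√2` represented by the phase diagrams. -/
def phaseExponent : Fin 8 → ℕ := ![0, 2, 1, 3, 1, 3, 1, 2]

theorem phaseDiagram_spec (s : Fin 8) : IsStabilizerScalar (phaseDiagram s) ∧
    cl (phaseDiagram s) = ↑(omega ^ (s : ℕ) * tU ^ (phaseExponent s : ℤ)) := by
  have h3 := closed_ip 0
  have e5 : (omega ^ 2)⁻¹ = omega ^ 6 := by
    rw [inv_eq_iff_mul_eq_one, ← pow_add, omega_pow_eight]
  have e7 : omega⁻¹ = omega ^ 7 := by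
    rw [inv_eq_iff_mul_eq_one, ← pow_succ', omega_pow_eight]
  -- The diagram for s = 5 is the product of those for s = 6 and s = 7.
  have e8 : omega ^ 13 = omega ^ 5 := by
    rw [show 13 = 8 + 5 from rfl, pow_add, omega_pow_eight, one_mul]
  have i1 : cl {g 1 {0}, r 1 {0}} = ↑(omega ^ 1 * tU ^ 2) := by
    rw [cl_ip, ip_one_one, pow_one, mul_comm]
  have i2 : cl {g 1 {0}, r 2 {0}} = ↑(omega ^ 2 * tU ^ 1) := by
    rw [cl_ip, ip_one_two, mul_comm, pow_one]
  have i4 : cl {g 2 {0}, r 2 {0}} = ↑(omega ^ 4 * tU ^ 1) := by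
    rw [cl_ip, ip_two_two', mul_comm, pow_one]
  have i6 : cl {g (-1) {0}, r 2 {0}} = ↑(omega ^ 6 * tU ^ 1) := by
    rw [cl_ip, ip_neg_one_two, mul_comm, e5, pow_one]
  have i7 : cl {g (-1) {0}, r (-1) {0}} = ↑(omega ^ 7 * tU ^ 2) := by
    rw [cl_ip, ip_neg_one, mul_comm, e7]
  fin_cases s
  · exact ⟨IsStabilizerScalar.zero, by simp [phaseDiagram, phaseExponent, cl_zero]⟩
  · exact ⟨h3 1 1, i1⟩
  · exact ⟨h3 1 2, i2⟩
  · refine ⟨(h3 1 2).par (h3 1 1), (cl_par (h3 1 2) (h3 1 1)).trans ?_⟩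
    rw [i1, i2, ← Units.val_mul, mul_mul_mul_comm, ← pow_add, ← pow_add]
    rfl
  · exact ⟨h3 2 2, i4⟩
  · refine ⟨(h3 (-1) 2).par (h3 (-1) (-1)), (cl_par (h3 (-1) 2) (h3 (-1) (-1))).trans ?_⟩
    rw [i6, i7, ← Units.val_mul, mul_mul_mul_comm, ← pow_add, ← pow_add, e8]
    rfl
  · exact ⟨h3 (-1) 2, i6⟩
  · exact ⟨h3 (-1) (-1), i7⟩

theorem modulusDiagram_spec (m : ℤ) : IsStabilizerScalar (modulusDiagram m) ∧
    cl (modulusDiagram m) = ↑(tU ^ m) := by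
  have hs : IsStabilizerScalar {Node.star} := closed_of_count
  have hi : IsStabilizerScalar (Diagram.innerprod 0 0 0) := innerprod_zero ▸ closed_ip 0 0 0
  have ei : cl (Diagram.innerprod 0 0 0) = tU := by rw [innerprod_zero, cl_ip]; rfl
  have es (n : ℕ) : cl (Diagram.copies {Node.star} n) = ↑(tU ^ (-(2 * n) : ℤ)) := by
    rw [cl_copies hs, cl_star, ← Units.val_pow_eq_pow_val, ← mul_inv, inv_pow, ← sq, ← pow_mul,
      zpow_neg]
    rfl
  rw [modulusDiagram]
  split_ifs with h1 h2 h3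
  · refine ⟨closed_copies hi _, ?_⟩
    rw [cl_copies hi, ei, ← Units.val_pow_eq_pow_val, ← zpow_natCast, Int.toNat_of_nonneg h1.le]
  · subst h2
    exact ⟨IsStabilizerScalar.zero, by simp [cl_zero]⟩
  · refine ⟨closed_copies hs _, ?_⟩
    rw [es]
    congr 2
    rw [Int.even_iff] at h3
    omega
  -- For odd negative `m`, one √2 and (1 - m)/2 factors 1/2 give the exponent 1 - (1 - m) = m.
  · refine ⟨hi.par (closed_copies hs _), ?_⟩
    rw [cl_par hi (closed_copies hs _), ei, es, ← Units.val_mul, ← zpow_one_add]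
    congr 2
    rw [Int.even_iff] at h3
    omega

theorem closed_normalForm (s : Fin 8) (m : ℤ) : IsStabilizerScalar (normalForm s m) :=
  (phaseDiagram_spec s).1.par (modulusDiagram_spec m).1

theorem cl_normalForm (s : Fin 8) (m : ℤ) :
    cl (normalForm s m) = ↑(omega ^ (s : ℕ) * tU ^ (phaseExponent s + m)) := by
  rw [normalForm, cl_par (phaseDiagram_spec s).1 (modulusDiagram_spec m).1,
    (phaseDiagram_spec s).2, (modulusDiagram_spec m).2, ← Units.val_mul, mul_assoc, ← zpow_add]

theorem value_normalForm (s : Fin 8) (m : ℤ) :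
    (normalForm s m).value = (Real.sqrt 2 : ℂ) ^ (phaseExponent s + m) *
      Complex.exp (Complex.I * ((s : ℕ) : ℂ) * Real.pi / 4) := by
  rw [← value_cl (closed_normalForm s m), cl_normalForm, value_omega_pow]

/-- Taking absolute values determines the exponent, because √2 > 1; the quotient of the exponentials
then determines `s` modulo 8, hence as an element of `Fin 8`. -/
theorem polar_injective {s s' : Fin 8} {m m' : ℤ}
    (h : (Real.sqrt 2 : ℂ) ^ m * Complex.exp (Complex.I * ((s : ℕ) : ℂ) * Real.pi / 4) =
      (Real.sqrt 2 : ℂ) ^ m' * Complex.exp (Complex.I * ((s' : ℕ) : ℂ) * Real.pi / 4)) :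
    s = s' ∧ m = m' := by
  have hn (n : ℕ) : ‖Complex.exp (Complex.I * (n : ℂ) * Real.pi / 4)‖ = 1 := by
    rw [show Complex.I * (n : ℂ) * Real.pi / 4 = ((n * Real.pi / 4 : ℝ) : ℂ) * Complex.I by
      push_cast; ring, Complex.norm_exp_ofReal_mul_I]
  have h2 : (1 : ℝ) < Real.sqrt 2 := by
    rw [Real.lt_sqrt (by norm_num)]
    norm_num
  have h1 := congrArg norm h
  rw [norm_mul, norm_mul, hn, hn, mul_one, mul_one, norm_zpow, norm_zpow, Complex.norm_real,
    Real.norm_of_nonneg (Real.sqrt_nonneg 2)] at h1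
  have hm : m = m' := zpow_right_injective₀ (by positivity) h2.ne' h1
  subst hm
  refine ⟨?_, rfl⟩
  have h3 := mul_left_cancel₀ (zpow_ne_zero m sqrt_two_ne_zero) h
  rw [Complex.exp_eq_exp_iff_exists_int] at h3
  obtain ⟨n, hn⟩ := h3
  have h4 : (((s : ℕ) : ℤ) : ℂ) = (((s' : ℕ) : ℤ) + 8 * n : ℤ) := by
    have hpi : Complex.I * (Real.pi : ℂ) ≠ 0 :=
      mul_ne_zero Complex.I_ne_zero (Complex.ofReal_ne_zero.2 Real.pi_ne_zero)
    refine mul_right_cancel₀ hpi ?_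
    push_cast
    linear_combination 4 * hn
  have h5 : ((s : ℕ) : ℤ) = ((s' : ℕ) : ℤ) + 8 * n := by exact_mod_cast h4
  have := s.2
  have := s'.2
  ext
  omega

theorem value_normalForm_ne_zero (s : Fin 8) (m : ℤ) : (normalForm s m).value ≠ 0 := by
  rw [value_normalForm]
  exact mul_ne_zero (zpow_ne_zero _ sqrt_two_ne_zero) (Complex.exp_ne_zero _)

theorem normalForm_injective {s s' : Fin 8} {m m' : ℤ}
    (h : (normalForm s m).value = (normalForm s' m').value) : s = s' ∧ m = m' := by
  rw [value_normalForm, value_normalForm] at h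
  obtain ⟨rfl, h⟩ := polar_injective h
  exact ⟨rfl, add_left_cancel h⟩

theorem exists_cl_normalForm {u : Scalarˣ} (hu : u ∈ scalarGroup) :
    ∃ s m, cl (normalForm s m) = ↑u := by
  obtain ⟨s, m, rfl⟩ := mem_scalarGroup hu
  exact ⟨s, m - phaseExponent s, by rw [cl_normalForm, add_sub_cancel]⟩

/-! ### Completeness and the group of normal forms -/

variable {A : AddSubgroup Real.Angle}

theorem exists_eqv_normalForm {D : Diagram} (hD : IsStabilizerScalar D) (hv : D.value ≠ 0) :
    ∃ s m, Eqv stabilizerPhases D (normalForm s m) := by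
  obtain ⟨u, hu, e⟩ := isReducible D hD hv
  obtain ⟨s, m, h⟩ := exists_cl_normalForm hu
  exact ⟨s, m, (cl_eq_iff hD (closed_normalForm s m)).1 (e.trans h.symm)⟩

/-- Completeness for non-zero scalars. -/
theorem Eqv.of_value_eq {D D' : Diagram} (hD : IsStabilizerScalar D)
    (hD' : IsStabilizerScalar D') (hv : D.value ≠ 0) (h : D.value = D'.value) :
    Eqv stabilizerPhases D D' := by
  obtain ⟨s, m, h1⟩ := exists_eqv_normalForm hD hv
  obtain ⟨s', m', h2⟩ := exists_eqv_normalForm hD' (h ▸ hv)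
  obtain ⟨rfl, rfl⟩ := normalForm_injective
    ((h1.value_eq hD.1).symm.trans (h.trans (h2.value_eq hD'.1)))
  exact h1.trans h2.symm

/-- The normal form diagram for a power of `√2` and a phase. -/
def normalFormOf (p : Multiplicative (ZMod 8 × ℤ)) : NormalFormDiagram :=
  -- The phase diagram already contributes a power of √2, which the modulus diagram has to
  -- compensate.
  ⟨normalForm p.toAdd.1 (p.toAdd.2 - phaseExponent p.toAdd.1), _, _, rfl⟩

theorem cl_normalFormOf (p : Multiplicative (ZMod 8 × ℤ)) :
    cl (normalFormOf p).1 = ↑(omega ^ p.toAdd.1.val * tU ^ p.toAdd.2) := by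
  refine (cl_normalForm _ _).trans ?_
  rw [add_sub_cancel]
  rfl

theorem closed_normalFormDiagram (x : NormalFormDiagram) : IsStabilizerScalar x.1 := by
  obtain ⟨_, s, m, rfl⟩ := x
  exact closed_normalForm s m

/-- Normal form diagrams are indexed by a phase and a power of `√2`. -/
def normalFormEquiv : Multiplicative (ZMod 8 × ℤ) ≃ NormalFormDiagram :=
  Equiv.ofBijective normalFormOf ⟨fun p q h => by
    have h1 := normalForm_injective (congrArg Diagram.value (congrArg Subtype.val h))
    have h2 : p.toAdd.1 = q.toAdd.1 := h1.1
    refine Multiplicative.toAdd.injective (Prod.ext h2 ?_)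
    have h3 := h1.2
    rw [h2] at h3
    exact sub_left_injective h3, fun x => by
    obtain ⟨_, s, m, rfl⟩ := x
    refine ⟨Multiplicative.ofAdd (s, m + phaseExponent s), Subtype.ext ?_⟩
    change normalForm s (m + phaseExponent s - phaseExponent s) = _
    rw [add_sub_cancel_right]⟩

theorem omega_pow_val_add (a b : ZMod 8) :
    omega ^ (a + b).val = omega ^ a.val * omega ^ b.val := by
  rw [ZMod.val_add, ← pow_add, ← pow_eq_pow_mod _ omega_pow_eight]

end ZX
end

/-! ### The main theorem -/

theorem mainTheorem6 (A : AddSubgroup Real.Angle) (hA : ZX.stabilizerPhases ≤ A) :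
    -- the canonical diagrams represent the intended numbers
    (∀ s : Fin 8, ∃ k : ℕ, (ZX.phaseDiagram s).value =
      (Real.sqrt 2 : ℂ) ^ k * Complex.exp (Complex.I * ((s : ℕ) : ℂ) * Real.pi / 4)) ∧
    (∀ r : ℤ, (ZX.modulusDiagram r).value = (Real.sqrt 2 : ℂ) ^ r) ∧
    (∀ (s : Fin 8) (r : ℤ), ZX.IsStabilizerScalar (ZX.normalForm s r) ∧
      (ZX.normalForm s r).value ≠ 0) ∧
    -- unique normal form
    (∀ D : ZX.Diagram, ZX.IsStabilizerScalar D → D.value ≠ 0 →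
      ∃! p : Fin 8 × ℤ, ZX.Eqv A D (ZX.normalForm p.1 p.2)) ∧
    -- completeness
    (∀ D D' : ZX.Diagram, ZX.IsStabilizerScalar D → ZX.IsStabilizerScalar D' → D.value ≠ 0 →
      D.value = D'.value → ZX.Eqv A D D') ∧
    -- the normal form diagrams form a group, isomorphic to `ℤ/8 × ℤ`
    (∃ _ : Group ZX.NormalFormDiagram,
      (1 : ZX.NormalFormDiagram).1 = 0 ∧
      (∀ x y : ZX.NormalFormDiagram, ZX.Eqv A (x.1.par y.1) (x * y).1) ∧
      ∃ φ : ZX.NormalFormDiagram ≃* Multiplicative (ZMod 8 × ℤ), ∀ x : ZX.NormalFormDiagram,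
        x.1.value = (Real.sqrt 2 : ℂ) ^ (φ x).toAdd.2 *
          Complex.exp (Complex.I * (((φ x).toAdd.1.val : ℕ) : ℂ) * Real.pi / 4)) ∧
    -- non-zero stabilizer scalars are invertible
    (∀ D : ZX.Diagram, ZX.IsStabilizerScalar D → D.value ≠ 0 →
      ∃ E : ZX.Diagram, ZX.IsStabilizerScalar E ∧ ZX.Eqv A (E.par D) 0) := by
  refine ⟨fun s => ⟨ZX.phaseExponent s, ?_⟩, fun m => ?_, fun s m =>
    ⟨ZX.closed_normalForm s m, ZX.value_normalForm_ne_zero s m⟩, fun D hD hv => ?_,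
    fun D D' hD hD' hv h => (ZX.Eqv.of_value_eq hD hD' hv h).mono hA, ?_, fun D hD hv => ?_⟩
  · obtain ⟨h, e⟩ := ZX.phaseDiagram_spec s
    rw [← ZX.value_cl h, e, ZX.value_omega_pow, zpow_natCast]
  · obtain ⟨h, e⟩ := ZX.modulusDiagram_spec m
    have := ZX.value_omega_pow 0 m
    rw [pow_zero, one_mul] at this
    rw [← ZX.value_cl h, e, this]
    simp
  · obtain ⟨s, m, h⟩ := ZX.exists_eqv_normalForm hD hv
    refine ⟨(s, m), h.mono hA, ?_⟩
    rintro ⟨s', m'⟩ h'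
    obtain ⟨rfl, rfl⟩ := ZX.normalForm_injective
      ((h'.value_eq hD.1).symm.trans (h.value_eq hD.1))
    rfl
  · let e := ZX.normalFormEquiv
    have he (p) : ZX.cl (e p).1 = _ := ZX.cl_normalFormOf p
    -- The group structure is transported from ℤ/8 × ℤ; that its product is derivably the
    -- juxtaposition is then an identity between powers of ω and t.
    letI : Group ZX.NormalFormDiagram := e.symm.group
    refine ⟨inferInstance, ?_, fun x y => ZX.Eqv.mono hA ?_, e.symm.mulEquiv, fun x => ?_⟩
    · change (e 1).1 = 0
      -- The phase exponent for s = 0 vanishes, so the unit is literally the empty diagram and not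
      -- just derivably equal to it.
      change ZX.normalForm 0 (0 - 0) = 0
      simp [ZX.normalForm, ZX.phaseDiagram, ZX.modulusDiagram, ZX.Diagram.par,
        ZX.Diagram.rename]
    · obtain ⟨p, rfl⟩ := e.surjective x
      obtain ⟨q, rfl⟩ := e.surjective y
      have h : e p * e q = e (p * q) := by
        change e (e.symm (e p) * e.symm (e q)) = _
        rw [e.symm_apply_apply, e.symm_apply_apply]
      have hp := ZX.closed_normalFormDiagram (e p)
      have hq := ZX.closed_normalFormDiagram (e q)
      rw [h, ← ZX.cl_eq_iff (hp.par hq) (ZX.closed_normalFormDiagram _), ZX.cl_par hp hq, he, he,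
        he, ← Units.val_mul, toAdd_mul, Prod.fst_add, Prod.snd_add, ZX.omega_pow_val_add,
        zpow_add, mul_mul_mul_comm]
    · obtain ⟨p, rfl⟩ := e.surjective x
      rw [← ZX.value_cl (ZX.closed_normalFormDiagram _), he, ZX.value_omega_pow]
      change _ = _ ^ (e.symm (e p)).toAdd.2 * Complex.exp (_ * (((e.symm (e p)).toAdd.1.val : ℕ) : ℂ)
        * _ / _)
      rw [e.symm_apply_apply]
  · obtain ⟨u, hu, h⟩ := ZX.isReducible D hD hv
    -- The inverse unit again lies in the group of scalars, so it is represented by a normal form.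
    obtain ⟨s, m, h'⟩ := ZX.exists_cl_normalForm (inv_mem hu)
    have hN := ZX.closed_normalForm s m
    refine ⟨ZX.normalForm s m, hN, ZX.Eqv.mono hA ?_⟩
    rw [← ZX.cl_eq_iff (hN.par hD) ZX.IsStabilizerScalar.zero, ZX.cl_par hN hD, h, h',
      ← Units.val_mul, inv_mul_cancel, Units.val_one, ZX.cl_zero]
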